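/- **Setting.** Let $\mathsf R=[\underline m,\overline m]\times[\underline n,\overline n]$ with integer bounds. A *T-mesh* $\mathsf T$ is a partition of $\mathsf R$ into (finitely many) open rectangles with integer corners. Its vertices $\mathsf V$ are the corners of the rectangles. Its edges are the open horizontal or vertical segments between two vertices that contain no vertex and meet no rectangle. The horizontal (vertical) skeleton $h\mathsf S$ ($v\mathsf S$) is the union of the horizontal (vertical) edges and all vertices, and $\mathsf S=h\mathsf S\cup v\mathsf S$. A *segment* is a maximal closed horizontal or vertical line segment made of contiguous vertices and edges. The *active region* is $\mathsf{AR}=[\underline m+2,\overline m-2]\times[\underline n+2,\overline n-2]$. $\mathsf T$ is *admissible* if the following hold. 1. $\mathsf{AR}\neq\emptyset$. 2. $\mathsf S$ contains the full lines $\{i\}\times[\underline n,\overline n]$ for $i\in\{\underline m+k,\overline m-k: 0\le k\le 3\}$ and $[\underline m,\overline m]\times\{j\}$ for $j\in\{\underline n+k,\overline n-k:0\le k\le 3\}$. 3. Every valence-three vertex in the interior of $\mathsf R$ lies in $\mathsf{AR}$. 4. Any two vertices on the boundary of one rectangle that share a coordinate are joined by a line segment contained in $\mathsf S$. A *T-junction*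 is a valence-three vertex in $\mathsf{AR}$. It is horizontal (vertical) if its missing edge is horizontal (vertical). For a horizontal T-junction $T=(i,j)$ with missing left edge, let $i_1<i_2<i_3=i<i_4$ be consecutive elements of $\{k\in\mathbb Z:(k,j)\in v\mathsf S\}$. Its *extension* is $[i_1,i_4]\times\{j\}$ and its *face extension* is $[i_1,i[\,\times\{j\}$. The other three orientations are analogous. An admissible T-mesh is *analysis-suitable* if no horizontal T-junction extension meets a vertical one. The *extended T-mesh* $\mathsf T_{ext}$ is obtained by adding all T-junction extensions to the skeleton of $\mathsf T$. Let * $n^a$ be the number of active vertices, that is, vertices of $\mathsf T$ in $\mathsf{AR}$; * $n^+$ be the number of crossing vertices, that is, intersection points of a horizontal and a vertical face extension; * $n^-$ be the number of overlap vertices, that is, points that are not vertices of $\mathsf T$ and that are either in $v\mathsf S$ and on a horizontal face extension intersecting the face extension of another horizontal T-junction, or in $h\mathsf S$ and on a vertical face extension intersecting the face extension of another vertical T-junction. Let $\xi_{\underline m}<\dots<\xi_{\overline m}$ and $\eta_{\underline n}<\dots<\eta_{\overline n}$ be real knots (no multiplicities). Let $\mathcal S_{ext}$ be the real vector space of functions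 $f\in C^{2,2}(\mathbb R^2)$ (twice continuously differentiable in each variable) that vanish outside $[\xi_{\underline m},\xi_{\overline m}]\times[\eta_{\underline n},\eta_{\overline n}]$ and agree with a bicubic polynomial on $]\xi_{a},\xi_{b}[\times]\eta_{c},\eta_{d}[$ for every rectangle $]a,b[\times]c,d[$ of $\mathsf T_{ext}$. The *constraint matrix* $\mathbf M$ has one column (unknown $d_v$) for each vertex $v$ of $\mathsf T_{ext}$. It has four rows for each segment $G$ of $\mathsf T_{ext}$, expressing that the cubic polynomial $\sum_{v=(i,j)\in G}d_v(X-\xi_i)^3$ (for $G$ horizontal), respectively $\sum_{v=(i,j)\in G}d_v(X-\eta_j)^3$ (for $G$ vertical), is zero. The *reduced constraint matrix* $\overline{\mathbf M}$ is obtained by deleting the rows of the eight segments on the lines $i\in\{\underline m,\underline m+1,\overline m-1,\overline m\}$ (vertical) and $j\in\{\underline n,\underline n+1,\overline n-1,\overline n\}$ (horizontal), and the columns of the sixteen vertices in which these lines meet, i.e. the vertices lying on deleted segments only. The remaining vertices and segments form the *simplified extended T-mesh*; let $\overline n^{G}$ be its number of segments. It is *diagonalizable* if its segments can be ordered $G_1,\dots,G_{\overline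 n^G}$ so that every $G_j$ has at least four of the remaining vertices that lie on none of the $G_i$, $i<j$. **Theorem.** Let $\mathsf T$ be an admissible T-mesh, with strictly increasing knots as above. 1. If $\overline{\mathbf M}$ has full rank $4\overline n^{G}$ (the number of its rows), then $$\dim\mathcal S_{ext}=n^a+n^++n^-.$$ 2. If $\mathsf T$ is analysis-suitable, then its simplified extended T-mesh is diagonalizable and $\overline{\mathbf M}$ has full rank $4\overline n^{G}$. Consequently $\dim\mathcal S_{ext}=n^a+n^++n^-$. -/

import Mathlib

/-- A nondegenerate open rectangle `]left, right[ × ]bottom, top[` with integer corners. -/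
structure IntRect where
  left : ℤ
  right : ℤ
  bottom : ℤ
  top : ℤ
  left_lt_right : left < right
  bottom_lt_top : bottom < top

/-- `P ⊆ Q` for open rectangles with integer corners. -/
def IntRect.Within (P Q : IntRect) : Prop :=
  Q.left ≤ P.left ∧ P.right ≤ Q.right ∧ Q.bottom ≤ P.bottom ∧ P.top ≤ Q.top

/-- The horizontal segment `[a, b] × {j}` (with `a < b`) meets the open rectangle `Q`. -/
def IntRect.MeetsH (Q : IntRect) (j a b : ℤ) : Prop :=
  Q.bottom < j ∧ j < Q.top ∧ a < Q.right ∧ Q.left < b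

/-- The vertical segment `{i} × [c, d]` (with `c < d`) meets the open rectangle `Q`. -/
def IntRect.MeetsV (Q : IntRect) (i c d : ℤ) : Prop :=
  Q.left < i ∧ i < Q.right ∧ c < Q.top ∧ Q.bottom < d

/-- `p` is one of the four corners of `Q`. -/
def IntRect.IsCorner (Q : IntRect) (p : ℤ × ℤ) : Prop :=
  (p.1 = Q.left ∨ p.1 = Q.right) ∧ (p.2 = Q.bottom ∨ p.2 = Q.top)

/-- `p` lies on the topological boundary of `Q`. -/
def IntRect.OnBoundary (Q : IntRect) (p : ℤ × ℤ) : Prop :=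
  (Q.left ≤ p.1 ∧ p.1 ≤ Q.right ∧ Q.bottom ≤ p.2 ∧ p.2 ≤ Q.top) ∧
    (p.1 = Q.left ∨ p.1 = Q.right ∨ p.2 = Q.bottom ∨ p.2 = Q.top)

/-- A collection of rectangles in the index domain `[left, right] × [bottom, top]`;
`IsTMesh` below says that it is a rectangular partition. -/
structure RectMesh where
  left : ℤ
  right : ℤ
  bottom : ℤ
  top : ℤ
  faces : Set IntRect

/-- `a < b < c < d` are four consecutive members of `S`. -/
def Consecutive4 (S : Set ℤ) (a b c d : ℤ) : Prop :=
  a ∈ S ∧ b ∈ S ∧ c ∈ S ∧ d ∈ S ∧ a < b ∧ b < c ∧ c < d ∧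
    ∀ k ∈ S, a ≤ k → k ≤ d → k = a ∨ k = b ∨ k = c ∨ k = d

namespace RectMesh

/-- The rectangles partition the index domain: they lie in it, and every unit cell
`]i, i + 1[ × ]j, j + 1[` of it lies in exactly one of them. -/
def IsTMesh (T : RectMesh) : Prop :=
  T.left < T.right ∧ T.bottom < T.top ∧
  (∀ Q ∈ T.faces, T.left ≤ Q.left ∧ Q.right ≤ T.right ∧
    T.bottom ≤ Q.bottom ∧ Q.top ≤ T.top) ∧
  ∀ i j : ℤ, T.left ≤ i → i < T.right → T.bottom ≤ j → j < T.top →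
    ∃! Q : IntRect, Q ∈ T.faces ∧ Q.left ≤ i ∧ i < Q.right ∧ Q.bottom ≤ j ∧ j < Q.top

/-- The integer points of the index domain. -/
noncomputable def box (T : RectMesh) : Finset (ℤ × ℤ) :=
  Finset.Icc T.left T.right ×ˢ Finset.Icc T.bottom T.top

open scoped Classical in
/-- The vertices: the corners of the rectangles. -/
noncomputable def vertices (T : RectMesh) : Finset (ℤ × ℤ) :=
  T.box.filter fun p => ∃ Q ∈ T.faces, Q.IsCorner p

/-- The horizontal segment `[a, b] × {j}`, `a < b`, meets no rectangle of the mesh,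
that is, it is contained in the skeleton. -/
def HFree (T : RectMesh) (j a b : ℤ) : Prop := ∀ Q ∈ T.faces, ¬ Q.MeetsH j a b

/-- The vertical segment `{i} × [c, d]`, `c < d`, meets no rectangle of the mesh,
that is, it is contained in the skeleton. -/
def VFree (T : RectMesh) (i c d : ℤ) : Prop := ∀ Q ∈ T.faces, ¬ Q.MeetsV i c d

/-- There is a horizontal edge from the vertex `p` (left) to the vertex `q` (right). -/
def IsHEdge (T : RectMesh) (p q : ℤ × ℤ) : Prop :=
  p ∈ T.vertices ∧ q ∈ T.vertices ∧ p.2 = q.2 ∧ p.1 < q.1 ∧ T.HFree p.2 p.1 q.1 ∧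
    ∀ k : ℤ, p.1 < k → k < q.1 → (k, p.2) ∉ T.vertices

/-- There is a vertical edge from the vertex `p` (below) to the vertex `q` (above). -/
def IsVEdge (T : RectMesh) (p q : ℤ × ℤ) : Prop :=
  p ∈ T.vertices ∧ q ∈ T.vertices ∧ p.1 = q.1 ∧ p.2 < q.2 ∧ T.VFree p.1 p.2 q.2 ∧
    ∀ k : ℤ, p.2 < k → k < q.2 → (p.1, k) ∉ T.vertices

def HasRight (T : RectMesh) (p : ℤ × ℤ) : Prop := ∃ q, T.IsHEdge p q
def HasLeft (T : RectMesh) (p : ℤ × ℤ) : Prop := ∃ q, T.IsHEdge q p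
def HasUp (T : RectMesh) (p : ℤ × ℤ) : Prop := ∃ q, T.IsVEdge p q
def HasDown (T : RectMesh) (p : ℤ × ℤ) : Prop := ∃ q, T.IsVEdge q p

/-- Integer points of the horizontal skeleton: the vertices and the integer points of
horizontal edges. -/
def hSkel (T : RectMesh) : Set (ℤ × ℤ) :=
  {p | p ∈ T.vertices ∨ ∃ u w, T.IsHEdge u w ∧ u.2 = p.2 ∧ u.1 < p.1 ∧ p.1 < w.1}

/-- Integer points of the vertical skeleton: the vertices and the integer points of
vertical edges. -/
def vSkel (T : RectMesh) : Set (ℤ × ℤ) :=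
  {p | p ∈ T.vertices ∨ ∃ u w, T.IsVEdge u w ∧ u.1 = p.1 ∧ u.2 < p.2 ∧ p.2 < w.2}

/-- The horizontal indices at which row `j` meets the vertical skeleton. -/
def hJ (T : RectMesh) (j : ℤ) : Set ℤ := {k | (k, j) ∈ T.vSkel}

/-- The vertical indices at which column `i` meets the horizontal skeleton. -/
def vJ (T : RectMesh) (i : ℤ) : Set ℤ := {k | (i, k) ∈ T.hSkel}

/-- The active region. -/
def InAR (T : RectMesh) (p : ℤ × ℤ) : Prop :=
  T.left + 2 ≤ p.1 ∧ p.1 ≤ T.right - 2 ∧ T.bottom + 2 ≤ p.2 ∧ p.2 ≤ T.top - 2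

/-! The four orientations of a valence three vertex. -/

/-- Orientation `⊢`. -/
def MissLeft (T : RectMesh) (p : ℤ × ℤ) : Prop :=
  T.HasRight p ∧ T.HasUp p ∧ T.HasDown p ∧ ¬ T.HasLeft p
/-- Orientation `⊣`. -/
def MissRight (T : RectMesh) (p : ℤ × ℤ) : Prop :=
  T.HasLeft p ∧ T.HasUp p ∧ T.HasDown p ∧ ¬ T.HasRight p
/-- Orientation `⊥` (the edge going down is missing). -/
def MissDown (T : RectMesh) (p : ℤ × ℤ) : Prop :=
  T.HasUp p ∧ T.HasLeft p ∧ T.HasRight p ∧ ¬ T.HasDown p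
/-- Orientation `⊤` (the edge going up is missing). -/
def MissUp (T : RectMesh) (p : ℤ × ℤ) : Prop :=
  T.HasDown p ∧ T.HasLeft p ∧ T.HasRight p ∧ ¬ T.HasUp p

/-- Vertices with exactly three edges. -/
def IsValenceThree (T : RectMesh) (p : ℤ × ℤ) : Prop :=
  T.MissLeft p ∨ T.MissRight p ∨ T.MissDown p ∨ T.MissUp p

/-- Admissibility. The active region is nonempty; the four outermost grid lines on each
side run through the whole index domain; valence three vertices in the interior of the
index domain belong to the active region (none sits in the outer frame); two vertices on
the boundary of the same rectangle that share a coordinate are joined within the skeleton. -/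
structure IsAdmissible (T : RectMesh) : Prop where
  width : T.left + 4 ≤ T.right
  height : T.bottom + 4 ≤ T.top
  columns : ∀ k : ℤ, 0 ≤ k → k ≤ 3 →
    T.VFree (T.left + k) T.bottom T.top ∧ T.VFree (T.right - k) T.bottom T.top
  rows : ∀ k : ℤ, 0 ≤ k → k ≤ 3 →
    T.HFree (T.bottom + k) T.left T.right ∧ T.HFree (T.top - k) T.left T.right
  frame : ∀ p ∈ T.vertices, T.left < p.1 → p.1 < T.right → T.bottom < p.2 → p.2 < T.top →
    T.IsValenceThree p → T.InAR p
  joinV : ∀ Q ∈ T.faces, ∀ p ∈ T.vertices, ∀ q ∈ T.vertices,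
    Q.OnBoundary p → Q.OnBoundary q → p.1 = q.1 → p.2 < q.2 → T.VFree p.1 p.2 q.2
  joinH : ∀ Q ∈ T.faces, ∀ p ∈ T.vertices, ∀ q ∈ T.vertices,
    Q.OnBoundary p → Q.OnBoundary q → p.2 = q.2 → p.1 < q.1 → T.HFree p.2 p.1 q.1

/-- `v` is a horizontal T-junction (`⊢` or `⊣`, in the active region) whose extension,
face and edge part together, is `[a, b] × {v.2}`. -/
def HExt (T : RectMesh) (v : ℤ × ℤ) (a b : ℤ) : Prop :=
  T.InAR v ∧ ∃ k l : ℤ, Consecutive4 (T.hJ v.2) a k l b ∧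
    ((T.MissLeft v ∧ v.1 = l) ∨ (T.MissRight v ∧ v.1 = k))

/-- `v` is a vertical T-junction (`⊥` or `⊤`, in the active region) whose extension,
face and edge part together, is `{v.1} × [a, b]`. -/
def VExt (T : RectMesh) (v : ℤ × ℤ) (a b : ℤ) : Prop :=
  T.InAR v ∧ ∃ k l : ℤ, Consecutive4 (T.vJ v.1) a k l b ∧
    ((T.MissDown v ∧ v.2 = l) ∨ (T.MissUp v ∧ v.2 = k))

/-- Integer points of the face extension of the horizontal T-junction `v`: the part of the
extension on the side of the missing edge, without `v` itself. -/
def OnHFace (T : RectMesh) (v p : ℤ × ℤ) : Prop :=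
  p.2 = v.2 ∧ ∃ a b : ℤ, T.HExt v a b ∧
    ((T.MissLeft v ∧ a ≤ p.1 ∧ p.1 < v.1) ∨ (T.MissRight v ∧ v.1 < p.1 ∧ p.1 ≤ b))

/-- Integer points of the face extension of the vertical T-junction `v`: the part of the
extension on the side of the missing edge, without `v` itself. -/
def OnVFace (T : RectMesh) (v p : ℤ × ℤ) : Prop :=
  p.1 = v.1 ∧ ∃ a b : ℤ, T.VExt v a b ∧
    ((T.MissDown v ∧ a ≤ p.2 ∧ p.2 < v.2) ∨ (T.MissUp v ∧ v.2 < p.2 ∧ p.2 ≤ b))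

/-- Analysis-suitable: admissible, and no horizontal T-junction extension meets a vertical
one. -/
def IsAnalysisSuitable (T : RectMesh) : Prop :=
  T.IsAdmissible ∧ ∀ (v w : ℤ × ℤ) (a b c d : ℤ), T.HExt v a b → T.VExt w c d →
    ¬ (a ≤ w.1 ∧ w.1 ≤ b ∧ c ≤ v.2 ∧ v.2 ≤ d)

/-- The open rectangle `Q` lies in a rectangle of `T` and meets no T-junction extension,
that is, `Q` lies in the index domain and misses the skeleton of the extended T-mesh. -/
def MissesExtended (T : RectMesh) (Q : IntRect) : Prop :=
  (∃ P ∈ T.faces, Q.Within P) ∧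
  (∀ (v : ℤ × ℤ) (a b : ℤ), T.HExt v a b → ¬ Q.MeetsH v.2 a b) ∧
  (∀ (v : ℤ × ℤ) (a b : ℤ), T.VExt v a b → ¬ Q.MeetsV v.1 a b)

/-- The extended T-mesh, obtained by adding all T-junction extensions to the skeleton: its
rectangles are the maximal open rectangles that miss the enlarged skeleton. -/
def extended (T : RectMesh) : RectMesh where
  left := T.left
  right := T.right
  bottom := T.bottom
  top := T.top
  faces := {Q | T.MissesExtended Q ∧ ∀ P, T.MissesExtended P → Q.Within P → P = Q}

open scoped Classical in
/-- The active vertices (anchors). -/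
noncomputable def activeVertices (T : RectMesh) : Finset (ℤ × ℤ) :=
  T.vertices.filter T.InAR

open scoped Classical in
/-- The crossing vertices: intersections of a horizontal and a vertical face extension. -/
noncomputable def crossingVertices (T : RectMesh) : Finset (ℤ × ℤ) :=
  T.box.filter fun p => (∃ v, T.OnHFace v p) ∧ ∃ w, T.OnVFace w p

open scoped Classical in
/-- The overlap vertices: the points, other than vertices of `T`, at which face extensions
that overlap another face extension of the same direction meet the skeleton of `T`. -/
noncomputable def overlapVertices (T : RectMesh) : Finset (ℤ × ℤ) :=
  T.box.filter fun p => p ∉ T.vertices ∧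
    ((p ∈ T.vSkel ∧ ∃ v w, v ≠ w ∧ T.OnHFace v p ∧ ∃ q, T.OnHFace v q ∧ T.OnHFace w q) ∨
     (p ∈ T.hSkel ∧ ∃ v w, v ≠ w ∧ T.OnVFace v p ∧ ∃ q, T.OnVFace v q ∧ T.OnVFace w q))

/-- `(p, q)` is a horizontal segment: a maximal closed horizontal line segment of
contiguous vertices and edges, with left end `p` and right end `q`. -/
def IsHSegment (X : RectMesh) (p q : ℤ × ℤ) : Prop :=
  p.2 = q.2 ∧ p.1 < q.1 ∧ X.HFree p.2 p.1 q.1 ∧ ¬ X.HasLeft p ∧ ¬ X.HasRight q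

/-- `(p, q)` is a vertical segment, with lower end `p` and upper end `q`. -/
def IsVSegment (X : RectMesh) (p q : ℤ × ℤ) : Prop :=
  p.1 = q.1 ∧ p.2 < q.2 ∧ X.VFree p.1 p.2 q.2 ∧ ¬ X.HasDown p ∧ ¬ X.HasUp q

open scoped Classical in
/-- All segments of a mesh, each given by the pair of its end vertices. -/
noncomputable def segments (X : RectMesh) : Finset ((ℤ × ℤ) × (ℤ × ℤ)) :=
  (X.vertices ×ˢ X.vertices).filter fun s => X.IsHSegment s.1 s.2 ∨ X.IsVSegment s.1 s.2

end RectMesh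

/-- The point `v` lies on the (axis-parallel) segment from `s.1` to `s.2`. -/
def OnSegment (s : (ℤ × ℤ) × (ℤ × ℤ)) (v : ℤ × ℤ) : Prop :=
  s.1.1 ≤ v.1 ∧ v.1 ≤ s.2.1 ∧ s.1.2 ≤ v.2 ∧ v.2 ≤ s.2.2

namespace RectMesh

open scoped Classical in
/-- The constraint matrix of the extended T-mesh. Columns are indexed by the vertices (the
unknowns are the vertex cofactors `d_v`); each segment contributes four rows, the
coefficients of `1, X, X², X³` in the edge conformality condition
`∑ d_v (X - ξ_{v.1})³ = 0` (horizontal) or `∑ d_v (X - η_{v.2})³ = 0` (vertical), the sum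
being over the vertices on the segment. -/
noncomputable def constraintMatrix (T : RectMesh) (ξ η : ℤ → ℝ) :
    Matrix ({s // s ∈ T.extended.segments} × Fin 4) {v // v ∈ T.extended.vertices} ℝ :=
  fun r v =>
    if OnSegment r.1.1 v.1 then
      if r.1.1.1.2 = r.1.1.2.2 then
        ((Polynomial.X - Polynomial.C (ξ v.1.1)) ^ 3).coeff (r.2 : ℕ)
      else
        ((Polynomial.X - Polynomial.C (η v.1.2)) ^ 3).coeff (r.2 : ℕ)
    else 0

/-- The two first and two last columns of the index domain. -/
def IsOuterColumn (T : RectMesh) (i : ℤ) : Prop :=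
  i = T.left ∨ i = T.left + 1 ∨ i = T.right - 1 ∨ i = T.right

/-- The two first and two last rows of the index domain. -/
def IsOuterRow (T : RectMesh) (j : ℤ) : Prop :=
  j = T.bottom ∨ j = T.bottom + 1 ∨ j = T.top - 1 ∨ j = T.top

open scoped Classical in
/-- The segments of the simplified extended T-mesh: all segments of the extended T-mesh
except the horizontal ones in outer rows and the vertical ones in outer columns. -/
noncomputable def reducedSegments (T : RectMesh) : Finset ((ℤ × ℤ) × (ℤ × ℤ)) :=
  T.extended.segments.filter fun s =>
    ¬ (s.1.2 = s.2.2 ∧ T.IsOuterRow s.1.2) ∧ ¬ (s.1.1 = s.2.1 ∧ T.IsOuterColumn s.1.1)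

open scoped Classical in
/-- The vertices of the simplified extended T-mesh: all vertices of the extended T-mesh
except the (corner) vertices that lie on removed segments only. -/
noncomputable def reducedVertices (T : RectMesh) : Finset (ℤ × ℤ) :=
  T.extended.vertices.filter fun v => ¬ (T.IsOuterColumn v.1 ∧ T.IsOuterRow v.2)

open scoped Classical in
/-- The reduced constraint matrix: rows of removed segments and columns of removed vertices
are deleted. -/
noncomputable def reducedMatrix (T : RectMesh) (ξ η : ℤ → ℝ) :
    Matrix ({s // s ∈ T.reducedSegments} × Fin 4) {v // v ∈ T.reducedVertices} ℝ :=
  (T.constraintMatrix ξ η).submatrix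
    (fun r => (⟨r.1.1, (Finset.mem_filter.mp r.1.2).1⟩, r.2))
    (fun v => ⟨v.1, (Finset.mem_filter.mp v.2).1⟩)

open scoped Classical in
/-- The simplified extended T-mesh is diagonalizable: its segments can be enumerated such
that each has at least four vertices that lie on none of the preceding segments. -/
def IsDiagonalizable (T : RectMesh) : Prop :=
  ∃ G : Fin T.reducedSegments.card ≃ {s // s ∈ T.reducedSegments},
    ∀ j, 4 ≤ (T.reducedVertices.filter fun v =>
      OnSegment (G j).1 v ∧ ∀ i < j, ¬ OnSegment (G i).1 v).card

end RectMesh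

/-- `C^{2,2}(ℝ²)`: the partial derivatives up to order two along either variable exist and
are continuous on `ℝ²`. -/
def IsC22 (f : ℝ × ℝ → ℝ) : Prop :=
  (∀ y, ContDiff ℝ 2 fun x => f (x, y)) ∧ (∀ x, ContDiff ℝ 2 fun y => f (x, y)) ∧
  ∀ k ≤ 2, Continuous (fun p : ℝ × ℝ => iteratedDeriv k (fun x => f (x, p.2)) p.1) ∧
    Continuous (fun p : ℝ × ℝ => iteratedDeriv k (fun y => f (p.1, y)) p.2)

/-- `f` agrees on the set `s` with a polynomial of degree at most three in each variable. -/
def IsBicubicOn (f : ℝ × ℝ → ℝ) (s : Set (ℝ × ℝ)) : Prop :=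
  ∃ c : Fin 4 → Fin 4 → ℝ, ∀ p ∈ s, f p = ∑ i, ∑ j, c i j * p.1 ^ (i : ℕ) * p.2 ^ (j : ℕ)

theorem IsC22.zero : IsC22 0 := by
  refine ⟨fun y => contDiff_const, fun x => contDiff_const, fun k _ => ⟨?_, ?_⟩⟩ <;>
  · simp only [Pi.zero_apply, iteratedDeriv_const]
    split_ifs <;> exact continuous_const

theorem IsC22.add {f g : ℝ × ℝ → ℝ} (hf : IsC22 f) (hg : IsC22 g) : IsC22 (f + g) := by
  obtain ⟨f1, f2, f3⟩ := hf
  obtain ⟨g1, g2, g3⟩ := hg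
  refine ⟨fun y => (f1 y).add (g1 y), fun x => (f2 x).add (g2 x), fun k hk => ?_⟩
  have hk' : ((k : ℕ∞) : WithTop ℕ∞) ≤ 2 := 
    WithTop.coe_le_coe.mpr ((Nat.cast_le (α := ℕ∞) (n := 2)).mpr hk)
  obtain ⟨f4, f5⟩ := f3 k hk
  obtain ⟨g4, g5⟩ := g3 k hk
  refine ⟨(f4.add g4).congr fun p => ?_, (f5.add g5).congr fun p => ?_⟩
  · exact (iteratedDeriv_add (((f1 p.2).of_le hk').contDiffAt)
      (((g1 p.2).of_le hk').contDiffAt)).symm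
  · exact (iteratedDeriv_add (((f2 p.1).of_le hk').contDiffAt)
      (((g2 p.1).of_le hk').contDiffAt)).symm

theorem IsC22.smul {f : ℝ × ℝ → ℝ} (a : ℝ) (hf : IsC22 f) : IsC22 (a • f) := by
  obtain ⟨f1, f2, f3⟩ := hf
  refine ⟨fun y => (f1 y).const_smul a, fun x => (f2 x).const_smul a, fun k hk => ?_⟩
  have hk' : ((k : ℕ∞) : WithTop ℕ∞) ≤ 2 := 
    WithTop.coe_le_coe.mpr ((Nat.cast_le (α := ℕ∞) (n := 2)).mpr hk)
  obtain ⟨f4, f5⟩ := f3 k hk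
  refine ⟨(f4.const_smul a).congr fun p => ?_, (f5.const_smul a).congr fun p => ?_⟩
  · exact (iteratedDeriv_const_smul (((f1 p.2).of_le hk').contDiffAt) a).symm
  · exact (iteratedDeriv_const_smul (((f2 p.1).of_le hk').contDiffAt) a).symm

/-- The homogeneous extended spline space: functions in `C^{2,2}(ℝ²)` that are bicubic on
every element of the extended T-mesh in the parametric domain and vanish outside the full
parametric domain. -/
def RectMesh.splineSpace (T : RectMesh) (ξ η : ℤ → ℝ) : Submodule ℝ (ℝ × ℝ → ℝ) where
  carrier := {f | IsC22 f ∧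
    (∀ Q ∈ T.extended.faces, IsBicubicOn f
      (Set.Ioo (ξ Q.left) (ξ Q.right) ×ˢ Set.Ioo (η Q.bottom) (η Q.top))) ∧
    ∀ p, p ∉ Set.Icc (ξ T.left) (ξ T.right) ×ˢ Set.Icc (η T.bottom) (η T.top) → f p = 0}
  zero_mem' := ⟨IsC22.zero, fun _ _ => ⟨fun _ _ => 0, fun p _ => by simp⟩, fun _ _ => rfl⟩
  add_mem' := by
    rintro f g ⟨hf, hf', hf''⟩ ⟨hg, hg', hg''⟩
    refine ⟨hf.add hg, fun Q hQ => ?_, fun p hp => by simp [hf'' p hp, hg'' p hp]⟩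
    obtain ⟨c, hc⟩ := hf' Q hQ
    obtain ⟨d, hd⟩ := hg' Q hQ
    refine ⟨fun i j => c i j + d i j, fun p hp => ?_⟩
    simp only [Pi.add_apply, hc p hp, hd p hp, add_mul, Finset.sum_add_distrib]
  smul_mem' := by
    rintro a f ⟨hf, hf', hf''⟩
    refine ⟨hf.smul a, fun Q hQ => ?_, fun p hp => by simp [hf'' p hp]⟩
    obtain ⟨c, hc⟩ := hf' Q hQ
    refine ⟨fun i j => a * c i j, fun p hp => ?_⟩
    simp only [Pi.smul_apply, smul_eq_mul, hc p hp, Finset.mul_sum, mul_assoc]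

/-!
The dimension is found with the smoothing cofactor method. Everything is expressed through the
unit edges `HUnit` and `VUnit` of the integer grid that belong to the skeleton of a mesh; vertices,
segments and both skeletons can be read off them, and reflection in the diagonal (`RectMesh.swap`)
reduces statements about columns to statements about rows.

*Splines and cofactors.* A `C²` function that is a cubic polynomial on both sides of a knot `t` and
vanishes to the left of it is a multiple of `(x - t)³` to the right. Hence a univariate spline with
compact support is a combination of truncated powers `(x - t)₊³`, and the coefficients are
combinations of point evaluations (`exists_coeff_functional`); the latter makes it possible to
expand a bivariate spline in one variable after the other, without any regularity of the
coefficient functions to be checked. So every element of the spline space is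
`∑ d (i, j) (x - ξ i)₊³ (y - η j)₊³` with unique cofactors `d`. Being bicubic across a grid edge
that is absent from the skeleton means that the cofactors on the line of the edge, to the left of
it or below it, cancel: this is `RowCond` and `ColCond`, and `rank_splineSpace` is the resulting isomorphism.

*Cofactors and the matrix.* Subtracting conditions at the two ends of a segment turns these
conditions into one condition for each segment. The sixteen corner unknowns are determined by the
others through the four outer rows, because the cubes at four distinct knots are a basis of the
cubic polynomials. The conditions for the outer columns then come for free: the sum of
`d (i, j) (x - ξ i)³ (y - η j)³` over all vertices vanishes since all rows do, the inner columns
contribute nothing, and the cubes at the four outer knots are independent. Thus the cofactors are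
the kernel of the reduced constraint matrix (`rank_cofactorSpace`), and in case of full rank the
dimension is the number of vertices minus four times the number of segments of the simplified
extended T-mesh.

*Counting.* On each horizontal segment of the simplified extended T-mesh exactly four of the
vertices on the vertical skeleton are neither active nor overlap vertices: its first two and its
last two (`Row.Valid.bad_run`). At the end of the line these are the vertices outside the active
region; at the end of an extension they are the two new vertices of the face extension, by the
condition on vertices on the boundary of one face. The same holds vertically, and the remaining new
vertices are the crossing vertices. This gives `IsAdmissible.card_reducedVertices`.

*Analysis-suitable meshes.* In every nonempty set of segments some member has four vertices on no
other member (`IsAnalysisSuitable.exists_hasPrivate`). This is clear for a complete line. Without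
complete lines, take the lowest horizontal segment; if no member qualifies, then its left
end is the end of an extension that is crossed by a vertical segment of the set, whose lower end is
the end of an extension that in turn is crossed by a horizontal segment of the set, which is not
below the first one. The two extensions then intersect, which is excluded. Removing such segments one
by one, and listing them in reverse order, diagonalizes the mesh; a diagonalizable mesh has a
block triangular matrix with invertible `4 × 4` blocks (`IsDiagonalizable.rank`).
-/


/-! ### Transposition and unit edges of a rectangular mesh -/

namespace IntRect

/-- The reflection of a rectangle in the diagonal. -/
def swap (Q : IntRect) : IntRect :=
  ⟨Q.bottom, Q.top, Q.left, Q.right, Q.bottom_lt_top, Q.left_lt_right⟩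

/-- The unit cell `]i, i + 1[ × ]j, j + 1[` is contained in `Q`. -/
def HasCell (Q : IntRect) (i j : ℤ) : Prop :=
  Q.left ≤ i ∧ i < Q.right ∧ Q.bottom ≤ j ∧ j < Q.top

theorem ext' {P Q : IntRect} (h1 : P.left = Q.left) (h2 : P.right = Q.right)
    (h3 : P.bottom = Q.bottom) (h4 : P.top = Q.top) : P = Q := by
  cases P; cases Q; simp_all

end IntRect

namespace RectMesh

/-- The reflection of a mesh in the diagonal. It exchanges the horizontal and the vertical
notions, so that each statement has to be proved for one of the two directions only. -/
def swap (T : RectMesh) : RectMesh :=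
  ⟨T.bottom, T.top, T.left, T.right, {Q | Q.swap ∈ T.faces}⟩

variable {X : RectMesh}

theorem IsTMesh.swap (hX : X.IsTMesh) : X.swap.IsTMesh := by
  obtain ⟨h1, h2, h3, h4⟩ := hX
  refine ⟨h2, h1, fun Q hQ => ?_, fun i j hi hi' hj hj' => ?_⟩
  · obtain ⟨a, b, c, d⟩ := h3 Q.swap hQ
    exact ⟨c, d, a, b⟩
  · obtain ⟨Q, ⟨hQ, a, b, c, d⟩, hu⟩ := h4 j i hj hj' hi hi'
    refine ⟨Q.swap, ⟨hQ, c, d, a, b⟩, ?_⟩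
    rintro P ⟨hP, a', b', c', d'⟩
    exact congrArg IntRect.swap (hu P.swap ⟨hP, c', d', a', b'⟩)

theorem hFree_swap {j a b : ℤ} : X.swap.HFree j a b ↔ X.VFree j a b :=
  ⟨fun h Q hQ hm => h Q.swap hQ hm, fun h Q hQ hm => h Q.swap hQ hm⟩

/-- The unit edge `[i, i + 1] × {j}` belongs to the skeleton. -/
def HUnit (X : RectMesh) (i j : ℤ) : Prop :=
  X.left ≤ i ∧ i < X.right ∧ X.bottom ≤ j ∧ j ≤ X.top ∧ X.HFree j i (i + 1)

/-- The unit edge `{i} × [j, j + 1]` belongs to the skeleton. -/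
def VUnit (X : RectMesh) (i j : ℤ) : Prop :=
  X.left ≤ i ∧ i ≤ X.right ∧ X.bottom ≤ j ∧ j < X.top ∧ X.VFree i j (j + 1)

theorem hUnit_swap {i j : ℤ} : X.swap.HUnit i j ↔ X.VUnit j i := by
  unfold HUnit VUnit
  rw [hFree_swap]
  simp only [RectMesh.swap]
  tauto

theorem vUnit_swap {i j : ℤ} : X.swap.VUnit i j ↔ X.HUnit j i :=
  (hUnit_swap (X := X.swap)).symm

theorem IsTMesh.exists_cell (hX : X.IsTMesh) {i j : ℤ} (h1 : X.left ≤ i) (h2 : i < X.right)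
    (h3 : X.bottom ≤ j) (h4 : j < X.top) : ∃ Q ∈ X.faces, Q.HasCell i j := by
  obtain ⟨Q, ⟨hQ, h⟩, -⟩ := hX.2.2.2 i j h1 h2 h3 h4
  exact ⟨Q, hQ, h⟩

theorem IsTMesh.cell_unique (hX : X.IsTMesh) {P Q : IntRect} (hP : P ∈ X.faces)
    (hQ : Q ∈ X.faces) {i j : ℤ} (h1 : P.HasCell i j) (h2 : Q.HasCell i j) : P = Q := by
  obtain ⟨a, b, c, d⟩ := hX.2.2.1 P hP
  obtain ⟨a', b', c', d'⟩ := h1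
  exact (hX.2.2.2 i j (by omega) (by omega) (by omega) (by omega)).unique ⟨hP, a', b', c', d'⟩
    ⟨hQ, h2⟩

theorem not_hUnit_iff {i j : ℤ} (h1 : X.left ≤ i) (h2 : i < X.right)
    (h3 : X.bottom ≤ j) (h4 : j ≤ X.top) :
    ¬ X.HUnit i j ↔ ∃ Q ∈ X.faces, Q.HasCell i (j - 1) ∧ Q.HasCell i j := by
  simp only [HUnit, HFree, h1, h2, h3, h4, true_and, not_forall, not_not, IntRect.MeetsH,
    IntRect.HasCell]
  refine exists_congr fun Q => ?_
  simp only [exists_prop]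
  refine and_congr_right fun _ => ?_
  omega

theorem not_vUnit_iff {i j : ℤ} (h1 : X.left ≤ i) (h2 : i ≤ X.right)
    (h3 : X.bottom ≤ j) (h4 : j < X.top) :
    ¬ X.VUnit i j ↔ ∃ Q ∈ X.faces, Q.HasCell (i - 1) j ∧ Q.HasCell i j := by
  simp only [VUnit, VFree, h1, h2, h3, h4, true_and, not_forall, not_not, IntRect.MeetsV,
    IntRect.HasCell]
  refine exists_congr fun Q => ?_
  simp only [exists_prop]
  refine and_congr_right fun _ => ?_
  omega

theorem hFree_iff {j a b : ℤ} (h1 : X.left ≤ a) (h2 : b ≤ X.right)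
    (h3 : X.bottom ≤ j) (h4 : j ≤ X.top) :
    a < b → (X.HFree j a b ↔ ∀ i, a ≤ i → i < b → X.HUnit i j) := by
  refine fun hab => ⟨fun h i hi hi' => ⟨by omega, by omega, h3, h4, fun Q hQ hm => h Q hQ ?_⟩,
    fun h Q hQ hm => ?_⟩
  · unfold IntRect.MeetsH at *; omega
  · obtain ⟨c1, c2, c3, c4⟩ := hm
    have hlr := Q.left_lt_right
    refine (h (max a Q.left) (by omega) (by omega)).2.2.2.2 Q hQ ⟨c1, c2, by omega, by omega⟩

theorem vFree_iff {i a b : ℤ} (h1 : X.bottom ≤ a) (h2 : b ≤ X.top)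
    (h3 : X.left ≤ i) (h4 : i ≤ X.right) (hab : a < b) :
    (X.VFree i a b ↔ ∀ j, a ≤ j → j < b → X.VUnit i j) := by
  rw [← hFree_swap, hFree_iff (X := X.swap) h1 h2 h3 h4 hab]
  simp only [hUnit_swap]

theorem IsTMesh.hUnit_bottom_top (hX : X.IsTMesh) {i : ℤ} (h1 : X.left ≤ i) (h2 : i < X.right) :
    X.HUnit i X.bottom ∧ X.HUnit i X.top := by
  have hb := hX.2.1
  refine ⟨⟨h1, h2, le_rfl, hb.le, fun Q hQ hm => ?_⟩, ⟨h1, h2, hb.le, le_rfl, fun Q hQ hm => ?_⟩⟩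
  all_goals
    have := hX.2.2.1 Q hQ
    obtain ⟨c1, c2, -⟩ := hm
    omega

theorem IsTMesh.vUnit_left_right (hX : X.IsTMesh) {j : ℤ} (h1 : X.bottom ≤ j) (h2 : j < X.top) :
    X.VUnit X.left j ∧ X.VUnit X.right j := by
  have := hX.swap.hUnit_bottom_top (i := j) h1 h2
  simp only [hUnit_swap] at this
  exact this

/-- If a horizontal line ends at an interior point, then both vertical unit edges are present
there: a rectangular partition has no reflex corners. -/
theorem IsTMesh.vUnit_of_hUnit_right (hX : X.IsTMesh) {i j : ℤ} (hi : X.left < i)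
    (hj : X.bottom < j) (hj' : j < X.top) (h1 : X.HUnit i j)
    (h2 : ¬ X.HUnit (i - 1) j) : X.VUnit i j ∧ X.VUnit i (j - 1) := by
  have hi' := h1.2.1
  obtain ⟨Q, hQ, q1, q2⟩ := (not_hUnit_iff (by omega) (by omega) hj.le hj'.le).1 h2
  constructor <;> by_contra h3
  · obtain ⟨P, hP, p1, p2⟩ := (not_vUnit_iff hi.le hi'.le hj.le hj').1 h3
    obtain rfl := hX.cell_unique hQ hP q2 p1
    refine (not_hUnit_iff hi.le hi' hj.le hj'.le).2 ⟨Q, hQ, ?_, p2⟩ h1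
    unfold IntRect.HasCell at *; omega
  · obtain ⟨P, hP, p1, p2⟩ := (not_vUnit_iff hi.le hi'.le (by omega) (by omega)).1 h3
    obtain rfl := hX.cell_unique hQ hP q1 p1
    refine (not_hUnit_iff hi.le hi' hj.le hj'.le).2 ⟨Q, hQ, p2, ?_⟩ h1
    unfold IntRect.HasCell at *; omega

theorem IsTMesh.vUnit_of_hUnit_left (hX : X.IsTMesh) {i j : ℤ} (hi : i < X.right)
    (hj : X.bottom < j) (hj' : j < X.top) (h1 : X.HUnit (i - 1) j)
    (h2 : ¬ X.HUnit i j) : X.VUnit i j ∧ X.VUnit i (j - 1) := by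
  have hi' := h1.1
  obtain ⟨Q, hQ, q1, q2⟩ := (not_hUnit_iff (by omega) (by omega) hj.le hj'.le).1 h2
  constructor <;> by_contra h3
  · obtain ⟨P, hP, p1, p2⟩ := (not_vUnit_iff (by omega) hi.le hj.le hj').1 h3
    obtain rfl := hX.cell_unique hQ hP q2 p2
    refine (not_hUnit_iff hi' (by omega) hj.le hj'.le).2 ⟨Q, hQ, ?_, p1⟩ h1
    unfold IntRect.HasCell at *; omega
  · obtain ⟨P, hP, p1, p2⟩ := (not_vUnit_iff (by omega) hi.le (by omega) (by omega)).1 h3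
    obtain rfl := hX.cell_unique hQ hP q1 p2
    refine (not_hUnit_iff hi' (by omega) hj.le hj'.le).2 ⟨Q, hQ, p1, ?_⟩ h1
    unfold IntRect.HasCell at *; omega

theorem IsTMesh.hUnit_side (hX : X.IsTMesh) {Q : IntRect} (hQ : Q ∈ X.faces) {i : ℤ}
    (h1 : Q.left ≤ i) (h2 : i < Q.right) : X.HUnit i Q.bottom ∧ X.HUnit i Q.top := by
  have hb := hX.2.2.1 Q hQ
  have hbt := Q.bottom_lt_top
  refine ⟨⟨by omega, by omega, by omega, by omega, fun P hP hm => ?_⟩,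
    ⟨by omega, by omega, by omega, by omega, fun P hP hm => ?_⟩⟩
  · obtain ⟨c1, c2, c3, c4⟩ := hm
    obtain rfl := hX.cell_unique hQ hP (i := i) (j := Q.bottom)
      ⟨h1, h2, le_rfl, hbt⟩ ⟨by omega, by omega, by omega, by omega⟩
    omega
  · obtain ⟨c1, c2, c3, c4⟩ := hm
    obtain rfl := hX.cell_unique hQ hP (i := i) (j := Q.top - 1)
      ⟨h1, h2, by omega, by omega⟩ ⟨by omega, by omega, by omega, by omega⟩
    omega

theorem IsTMesh.vUnit_side (hX : X.IsTMesh) {Q : IntRect} (hQ : Q ∈ X.faces) {j : ℤ}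
    (h1 : Q.bottom ≤ j) (h2 : j < Q.top) : X.VUnit Q.left j ∧ X.VUnit Q.right j := by
  have := hX.swap.hUnit_side (Q := Q.swap) hQ (i := j) h1 h2
  simp only [hUnit_swap] at this
  exact this

/-- The vertices are the points at which the skeleton has both a horizontal and a vertical
unit edge. -/
theorem IsTMesh.mem_vertices (hX : X.IsTMesh) {i j : ℤ} :
    (i, j) ∈ X.vertices ↔
      (X.HUnit (i - 1) j ∨ X.HUnit i j) ∧ (X.VUnit i (j - 1) ∨ X.VUnit i j) := by
  classical
  simp only [vertices, box, Finset.mem_filter, Finset.mem_product, Finset.mem_Icc]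
  constructor
  · rintro ⟨-, Q, hQ, h1, h2⟩
    have hlr := Q.left_lt_right
    have hbt := Q.bottom_lt_top
    have hb := hX.2.2.1 Q hQ
    simp only at h1 h2
    constructor
    · rcases h1 with rfl | rfl
      · have := hX.hUnit_side hQ (i := Q.left) le_rfl hlr
        rcases h2 with rfl | rfl <;> simp [this]
      · have := hX.hUnit_side hQ (i := Q.right - 1) (by omega) (by omega)
        rcases h2 with rfl | rfl <;> simp [this]
    · rcases h2 with rfl | rfl
      · have := hX.vUnit_side hQ (j := Q.bottom) le_rfl hbt
        rcases h1 with rfl | rfl <;> simp [this]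
      · have := hX.vUnit_side hQ (j := Q.top - 1) (by omega) (by omega)
        rcases h1 with rfl | rfl <;> simp [this]
  · rintro ⟨h1, h2⟩
    obtain ⟨a, ha, h1⟩ : ∃ a, (a = i - 1 ∨ a = i) ∧ X.HUnit a j := by
      rcases h1 with h1 | h1
      exacts [⟨_, .inl rfl, h1⟩, ⟨_, .inr rfl, h1⟩]
    obtain ⟨b, hb, h2⟩ : ∃ b, (b = j - 1 ∨ b = j) ∧ X.VUnit i b := by
      rcases h2 with h2 | h2
      exacts [⟨_, .inl rfl, h2⟩, ⟨_, .inr rfl, h2⟩]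
    obtain ⟨u1, u2, u3, u4, u5⟩ := id h1
    obtain ⟨w1, w2, w3, w4, w5⟩ := id h2
    refine ⟨⟨⟨w1, w2⟩, ⟨u3, u4⟩⟩, ?_⟩
    obtain ⟨Q, hQ, hc⟩ := hX.exists_cell u1 u2 w3 w4
    refine ⟨Q, hQ, ?_⟩
    have n1 := u5 Q hQ
    have n2 := w5 Q hQ
    unfold IntRect.MeetsH at n1
    unfold IntRect.MeetsV at n2
    unfold IntRect.HasCell at hc
    unfold IntRect.IsCorner
    simp only
    omega

theorem IsTMesh.mem_vertices_swap (hX : X.IsTMesh) {i j : ℤ} :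
    (i, j) ∈ X.swap.vertices ↔ (j, i) ∈ X.vertices := by
  rw [hX.mem_vertices, hX.swap.mem_vertices]
  simp only [hUnit_swap, vUnit_swap]
  tauto

/-- From a unit edge one can move right to the next vertex. -/
theorem IsTMesh.exists_next (hX : X.IsTMesh) {i j : ℤ} (h : X.HUnit i j) :
    ∃ k, i < k ∧ (k, j) ∈ X.vertices ∧ (∀ m, i ≤ m → m < k → X.HUnit m j) ∧
      ∀ m, i < m → m < k → (m, j) ∉ X.vertices := by
  obtain ⟨n, hn⟩ : ∃ n : ℕ, (n : ℤ) = X.right - i :=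
    ⟨(X.right - i).toNat, Int.toNat_of_nonneg (by have := h.2.1; omega)⟩
  induction n generalizing i with
  | zero => have := h.2.1; omega
  | succ n ih =>
    by_cases hv : (i + 1, j) ∈ X.vertices
    · refine ⟨i + 1, by omega, hv, fun m h1 h2 => ?_, fun m h1 h2 => by omega⟩
      obtain rfl : m = i := by omega
      exact h
    · have hh : X.HUnit (i + 1) j := by
        by_contra hh
        rw [hX.mem_vertices] at hv
        obtain ⟨u1, u2, u3, u4, -⟩ := id h
        have hbt := hX.2.1
        have hnv : ¬ (X.VUnit (i + 1) (j - 1) ∨ X.VUnit (i + 1) j) := fun hh' =>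
          hv ⟨.inl (by simpa using h), hh'⟩
        rcases eq_or_ne (i + 1) X.right with he | he
        · rw [he] at hnv
          rcases eq_or_ne j X.top with h' | h'
          · exact hnv (.inl (hX.vUnit_left_right (by omega) (by omega)).2)
          · exact hnv (.inr (hX.vUnit_left_right (by omega) (by omega)).2)
        · have hB := hX.hUnit_bottom_top (i := i + 1) (by omega) (by omega)
          have c1 : j ≠ X.bottom := by rintro rfl; exact hh hB.1
          have c2 : j ≠ X.top := by rintro rfl; exact hh hB.2
          exact hnv (.inr (hX.vUnit_of_hUnit_left (by omega) (by omega) (by omega)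
            (by simpa using h) hh).1)
      obtain ⟨k, k1, k2, k3, k4⟩ := ih hh (by omega)
      refine ⟨k, by omega, k2, fun m h1 h2 => ?_, fun m h1 h2 => ?_⟩
      · rcases eq_or_ne m i with rfl | h'
        exacts [h, k3 m (by omega) h2]
      · rcases eq_or_ne m (i + 1) with rfl | h'
        exacts [hv, k4 m (by omega) h2]

/-- From a unit edge one can move left to the previous vertex. -/
theorem IsTMesh.exists_prev (hX : X.IsTMesh) {i j : ℤ} (h : X.HUnit i j) :
    ∃ k, k ≤ i ∧ (k, j) ∈ X.vertices ∧ (∀ m, k ≤ m → m ≤ i → X.HUnit m j) ∧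
      ∀ m, k < m → m ≤ i → (m, j) ∉ X.vertices := by
  obtain ⟨n, hn⟩ : ∃ n : ℕ, (n : ℤ) = i - X.left :=
    ⟨(i - X.left).toNat, Int.toNat_of_nonneg (by have := h.1; omega)⟩
  induction n generalizing i with
  | zero =>
    obtain ⟨u1, u2, u3, u4, -⟩ := id h
    have hbt := hX.2.1
    refine ⟨i, le_rfl, hX.mem_vertices.2 ⟨.inr h, ?_⟩, fun m h1 h2 => ?_, fun m h1 h2 => by omega⟩
    · obtain rfl : i = X.left := by omega
      rcases eq_or_ne j X.top with h' | h'
      · exact .inl (hX.vUnit_left_right (by omega) (by omega)).1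
      · exact .inr (hX.vUnit_left_right (by omega) (by omega)).1
    · obtain rfl : m = i := by omega
      exact h
  | succ n ih =>
    by_cases hv : (i, j) ∈ X.vertices
    · refine ⟨i, by omega, hv, fun m h1 h2 => ?_, fun m h1 h2 => by omega⟩
      obtain rfl : m = i := by omega
      exact h
    · have hh : X.HUnit (i - 1) j := by
        by_contra hh
        rw [hX.mem_vertices] at hv
        obtain ⟨u1, u2, u3, u4, -⟩ := id h
        have hB := hX.hUnit_bottom_top (i := i - 1) (by omega) (by omega)
        have c1 : j ≠ X.bottom := by rintro rfl; exact hh hB.1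
        have c2 : j ≠ X.top := by rintro rfl; exact hh hB.2
        exact hv ⟨.inr h, .inr (hX.vUnit_of_hUnit_right (by omega) (by omega) (by omega) h hh).1⟩
      obtain ⟨k, k1, k2, k3, k4⟩ := ih hh (by omega)
      refine ⟨k, by omega, k2, fun m h1 h2 => ?_, fun m h1 h2 => ?_⟩
      · rcases eq_or_ne m i with rfl | h'
        exacts [h, k3 m h1 (by omega)]
      · rcases eq_or_ne m i with rfl | h'
        exacts [hv, k4 m h1 (by omega)]

theorem mem_box_of_mem_vertices {p : ℤ × ℤ} (h : p ∈ X.vertices) :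
    X.left ≤ p.1 ∧ p.1 ≤ X.right ∧ X.bottom ≤ p.2 ∧ p.2 ≤ X.top := by
  classical
  simp only [vertices, box, Finset.mem_filter, Finset.mem_product, Finset.mem_Icc] at h
  tauto

theorem isHEdge_iff {p q : ℤ × ℤ} :
    X.IsHEdge p q ↔ p ∈ X.vertices ∧ q ∈ X.vertices ∧ p.2 = q.2 ∧ p.1 < q.1 ∧
      (∀ m, p.1 ≤ m → m < q.1 → X.HUnit m p.2) ∧
      ∀ k : ℤ, p.1 < k → k < q.1 → (k, p.2) ∉ X.vertices := by
  unfold IsHEdge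
  refine and_congr_right fun hp => and_congr_right fun hq => and_congr_right fun h =>
    and_congr_right fun hlt => and_congr_left fun _ => ?_
  have b1 := mem_box_of_mem_vertices hp
  have b2 := mem_box_of_mem_vertices hq
  exact hFree_iff b1.1 b2.2.1 b1.2.2.1 b1.2.2.2 hlt

theorem IsTMesh.hasRight_iff (hX : X.IsTMesh) {p : ℤ × ℤ} :
    X.HasRight p ↔ p ∈ X.vertices ∧ X.HUnit p.1 p.2 := by
  constructor
  · rintro ⟨q, hq⟩
    obtain ⟨h1, h2, h3, h4, h5, h6⟩ := isHEdge_iff.1 hq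
    exact ⟨h1, h5 _ le_rfl h4⟩
  · rintro ⟨h1, h2⟩
    obtain ⟨k, k1, k2, k3, k4⟩ := hX.exists_next h2
    exact ⟨(k, p.2), isHEdge_iff.2 ⟨h1, k2, rfl, k1, k3, k4⟩⟩

theorem IsTMesh.hasLeft_iff (hX : X.IsTMesh) {p : ℤ × ℤ} :
    X.HasLeft p ↔ p ∈ X.vertices ∧ X.HUnit (p.1 - 1) p.2 := by
  constructor
  · rintro ⟨q, hq⟩
    obtain ⟨h1, h2, h3, h4, h5, h6⟩ := isHEdge_iff.1 hq
    exact ⟨h2, h3 ▸ h5 _ (by omega) (by omega)⟩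
  · rintro ⟨h1, h2⟩
    obtain ⟨k, k1, k2, k3, k4⟩ := hX.exists_prev h2
    exact ⟨(k, p.2), isHEdge_iff.2 ⟨k2, h1, rfl, by simp only; omega,
      fun m m1 m2 => k3 m m1 (by simp only at *; omega),
      fun m m1 m2 => k4 m m1 (by simp only at *; omega)⟩⟩

theorem IsTMesh.isHEdge_swap (hX : X.IsTMesh) {p q : ℤ × ℤ} :
    X.swap.IsHEdge p q ↔ X.IsVEdge p.swap q.swap := by
  unfold IsHEdge IsVEdge
  simp only [hFree_swap, ← hX.mem_vertices_swap, Prod.swap]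

theorem IsTMesh.hasRight_swap (hX : X.IsTMesh) {p : ℤ × ℤ} :
    X.swap.HasRight p ↔ X.HasUp p.swap := by
  unfold HasRight HasUp
  simp only [hX.isHEdge_swap]
  exact ⟨fun ⟨q, hq⟩ => ⟨_, hq⟩, fun ⟨q, hq⟩ => ⟨q.swap, hq⟩⟩

theorem IsTMesh.hasLeft_swap (hX : X.IsTMesh) {p : ℤ × ℤ} :
    X.swap.HasLeft p ↔ X.HasDown p.swap := by
  unfold HasLeft HasDown
  simp only [hX.isHEdge_swap]
  exact ⟨fun ⟨q, hq⟩ => ⟨_, hq⟩, fun ⟨q, hq⟩ => ⟨q.swap, hq⟩⟩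

theorem IsTMesh.hasUp_iff (hX : X.IsTMesh) {p : ℤ × ℤ} :
    X.HasUp p ↔ p ∈ X.vertices ∧ X.VUnit p.1 p.2 := by
  have := hX.hasRight_swap (p := p.swap)
  rw [Prod.swap_swap] at this
  rw [← this, hX.swap.hasRight_iff, hUnit_swap, ← hX.swap.mem_vertices_swap]
  rfl

theorem IsTMesh.hasDown_iff (hX : X.IsTMesh) {p : ℤ × ℤ} :
    X.HasDown p ↔ p ∈ X.vertices ∧ X.VUnit p.1 (p.2 - 1) := by
  have := hX.hasLeft_swap (p := p.swap)
  rw [Prod.swap_swap] at this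
  rw [← this, hX.swap.hasLeft_iff, hUnit_swap, ← hX.swap.mem_vertices_swap]
  rfl

/-- The integer points of the horizontal skeleton are those with an incident horizontal unit
edge. -/
theorem IsTMesh.mem_hSkel (hX : X.IsTMesh) {i j : ℤ} :
    (i, j) ∈ X.hSkel ↔ X.HUnit (i - 1) j ∨ X.HUnit i j := by
  constructor
  · rintro (h | ⟨u, w, h, h1, h2, h3⟩)
    · exact (hX.mem_vertices.1 h).1
    · simp only at h1 h2 h3
      obtain ⟨-, -, -, -, h5, -⟩ := isHEdge_iff.1 h
      exact .inr (h1 ▸ h5 i (by omega) h3)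
  · intro h
    by_cases hv : (i, j) ∈ X.vertices
    · exact .inl hv
    right
    rcases h with h | h
    · obtain ⟨a, a1, a2, a3, a4⟩ := hX.exists_prev h
      obtain ⟨b, b1, b2, b3, b4⟩ := hX.exists_next h
      have hb : i < b := by
        rcases lt_trichotomy i b with h' | rfl | h'
        · exact h'
        · exact absurd b2 hv
        · omega
      refine ⟨(a, j), (b, j), isHEdge_iff.2 ⟨a2, b2, rfl, by simp only; omega,
        fun m m1 m2 => ?_, fun m m1 m2 => ?_⟩, rfl, by simp only; omega, hb⟩
      · rcases le_or_gt m (i - 1) with h' | h'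
        exacts [a3 m m1 h', b3 m (by omega) m2]
      · rcases le_or_gt m (i - 1) with h' | h'
        exacts [a4 m m1 h', b4 m (by omega) m2]
    · obtain ⟨a, a1, a2, a3, a4⟩ := hX.exists_prev h
      obtain ⟨b, b1, b2, b3, b4⟩ := hX.exists_next h
      have hb : a < i := by
        rcases lt_trichotomy a i with h' | rfl | h'
        · exact h'
        · exact absurd a2 hv
        · omega
      refine ⟨(a, j), (b, j), isHEdge_iff.2 ⟨a2, b2, rfl, by simp only; omega,
        fun m m1 m2 => ?_, fun m m1 m2 => ?_⟩, rfl, hb, b1⟩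
      · rcases le_or_gt m i with h' | h'
        exacts [a3 m m1 h', b3 m (by omega) m2]
      · rcases le_or_gt m i with h' | h'
        exacts [a4 m m1 h', b4 m (by omega) m2]

theorem IsTMesh.mem_hSkel_swap (hX : X.IsTMesh) {i j : ℤ} :
    (i, j) ∈ X.swap.hSkel ↔ (j, i) ∈ X.vSkel := by
  simp only [hSkel, vSkel, Set.mem_ofPred_eq, hX.mem_vertices_swap, hX.isHEdge_swap]
  refine or_congr_right ⟨fun ⟨u, w, h⟩ => ⟨u.swap, w.swap, h⟩, fun ⟨u, w, h⟩ => ⟨u.swap, w.swap, h⟩⟩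

theorem IsTMesh.mem_vSkel (hX : X.IsTMesh) {i j : ℤ} :
    (i, j) ∈ X.vSkel ↔ X.VUnit i (j - 1) ∨ X.VUnit i j := by
  rw [← hX.mem_hSkel_swap, hX.swap.mem_hSkel, hUnit_swap, hUnit_swap]

/-- A vertex is a point common to the horizontal and the vertical skeleton. -/
theorem IsTMesh.mem_vertices_iff_skel (hX : X.IsTMesh) {p : ℤ × ℤ} :
    p ∈ X.vertices ↔ p ∈ X.hSkel ∧ p ∈ X.vSkel := by
  obtain ⟨i, j⟩ := p
  rw [hX.mem_vertices, hX.mem_hSkel, hX.mem_vSkel]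

end RectMesh

/-! ### The extended T-mesh -/

namespace RectMesh

variable {X T : RectMesh}

theorem IsTMesh.hJ_swap (hX : X.IsTMesh) {j : ℤ} : X.swap.hJ j = X.vJ j := by
  ext k
  exact (hX.swap.mem_hSkel_swap (i := j) (j := k)).symm

theorem IsTMesh.missLeft_swap (hX : X.IsTMesh) {p : ℤ × ℤ} :
    X.swap.MissLeft p ↔ X.MissDown p.swap := by
  have h1 := hX.swap.hasRight_swap (p := p.swap)
  have h2 := hX.swap.hasLeft_swap (p := p.swap)
  rw [Prod.swap_swap] at h1 h2
  unfold MissLeft MissDown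
  rw [hX.hasRight_swap, ← h1, ← h2, hX.hasLeft_swap]
  change _ ∧ X.HasRight _ ∧ X.HasLeft _ ∧ _ ↔ _
  tauto

theorem IsTMesh.missRight_swap (hX : X.IsTMesh) {p : ℤ × ℤ} :
    X.swap.MissRight p ↔ X.MissUp p.swap := by
  have h1 := hX.swap.hasRight_swap (p := p.swap)
  have h2 := hX.swap.hasLeft_swap (p := p.swap)
  rw [Prod.swap_swap] at h1 h2
  unfold MissRight MissUp
  rw [hX.hasRight_swap, ← h1, ← h2, hX.hasLeft_swap]
  change _ ∧ X.HasRight _ ∧ X.HasLeft _ ∧ _ ↔ _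
  tauto

theorem inAR_swap {p : ℤ × ℤ} : X.swap.InAR p ↔ X.InAR p.swap := by
  simp only [InAR, swap, Prod.fst_swap, Prod.snd_swap]
  tauto

theorem IsTMesh.hExt_swap (hX : X.IsTMesh) {v : ℤ × ℤ} {a b : ℤ} :
    X.swap.HExt v a b ↔ X.VExt v.swap a b := by
  simp only [HExt, VExt, inAR_swap, hX.hJ_swap, hX.missLeft_swap, hX.missRight_swap,
    Prod.fst_swap, Prod.snd_swap]

theorem IsTMesh.vExt_swap (hX : X.IsTMesh) {v : ℤ × ℤ} {a b : ℤ} :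
    X.swap.VExt v a b ↔ X.HExt v.swap a b := by
  have := hX.swap.hExt_swap (v := v.swap) (a := a) (b := b)
  rw [Prod.swap_swap] at this
  exact this.symm

theorem IsTMesh.onHFace_swap (hX : X.IsTMesh) {v p : ℤ × ℤ} :
    X.swap.OnHFace v p ↔ X.OnVFace v.swap p.swap := by
  simp only [OnHFace, OnVFace, hX.hExt_swap, hX.missLeft_swap, hX.missRight_swap,
    Prod.fst_swap, Prod.snd_swap]

theorem IsTMesh.onVFace_swap (hX : X.IsTMesh) {v p : ℤ × ℤ} :
    X.swap.OnVFace v p ↔ X.OnHFace v.swap p.swap := by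
  have := hX.swap.onHFace_swap (v := v.swap) (p := p.swap)
  rw [Prod.swap_swap, Prod.swap_swap] at this
  exact this.symm

theorem IsTMesh.missesExtended_swap (hX : X.IsTMesh) {Q : IntRect} :
    X.swap.MissesExtended Q ↔ X.MissesExtended Q.swap := by
  unfold MissesExtended
  refine and_congr ?_ ?_
  · constructor
    · rintro ⟨P, hP, a, b, c, d⟩
      exact ⟨P.swap, hP, c, d, a, b⟩
    · rintro ⟨P, hP, a, b, c, d⟩
      exact ⟨P.swap, hP, c, d, a, b⟩
  · simp only [hX.hExt_swap, hX.vExt_swap]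
    rw [and_comm]
    refine and_congr ?_ ?_
    · exact ⟨fun h v a b hv => h v.swap a b hv, fun h v a b hv => h v.swap a b hv⟩
    · exact ⟨fun h v a b hv => h v.swap a b hv, fun h v a b hv => h v.swap a b hv⟩

theorem IsTMesh.extended_swap (hX : X.IsTMesh) : X.swap.extended = X.extended.swap := by
  have : X.swap.extended.faces = X.extended.swap.faces := by
    ext Q
    change (X.swap.MissesExtended Q ∧ ∀ P, X.swap.MissesExtended P → Q.Within P → P = Q) ↔
      (X.MissesExtended Q.swap ∧ ∀ P, X.MissesExtended P → Q.swap.Within P → P = Q.swap)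
    rw [hX.missesExtended_swap]
    refine and_congr_right fun _ => ⟨fun h P hP hw => ?_, fun h P hP hw => ?_⟩
    · obtain ⟨a, b, c, d⟩ := hw
      exact congrArg IntRect.swap
        (h P.swap (hX.missesExtended_swap.2 hP) ⟨c, d, a, b⟩)
    · obtain ⟨a, b, c, d⟩ := hw
      exact congrArg IntRect.swap
        (h P.swap (hX.missesExtended_swap.1 hP) ⟨c, d, a, b⟩)
  exact congrArg (RectMesh.mk X.bottom X.top X.left X.right) this

theorem IsTMesh.mem_hJ (hT : T.IsTMesh) {i j : ℤ} :
    i ∈ T.hJ j ↔ T.VUnit i (j - 1) ∨ T.VUnit i j := hT.mem_vSkel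

theorem IsTMesh.hJ_box (hT : T.IsTMesh) {i j : ℤ} (h : i ∈ T.hJ j) :
    T.left ≤ i ∧ i ≤ T.right ∧ T.bottom ≤ j ∧ j ≤ T.top := by
  rcases hT.mem_hJ.1 h with h | h <;> obtain ⟨a, b, c, d, -⟩ := h <;> omega

/-- An extension that meets a face of the mesh crosses it from side to side. -/
theorem IsTMesh.not_mem_hJ_of_face (hT : T.IsTMesh) {P : IntRect} (hP : P ∈ T.faces) {i j : ℤ}
    (h1 : P.left < i) (h2 : i < P.right) (h3 : P.bottom < j) (h4 : j < P.top) :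
    i ∉ T.hJ j := by
  have hb := hT.2.2.1 P hP
  rw [hT.mem_hJ]
  rintro (h | h) <;> revert h
  · rw [imp_false, not_vUnit_iff (by omega) (by omega) (by omega) (by omega)]
    exact ⟨P, hP, by unfold IntRect.HasCell; omega, by unfold IntRect.HasCell; omega⟩
  · rw [imp_false, not_vUnit_iff (by omega) (by omega) (by omega) (by omega)]
    exact ⟨P, hP, by unfold IntRect.HasCell; omega, by unfold IntRect.HasCell; omega⟩

theorem HExt.mem_hJ {v : ℤ × ℤ} {a b : ℤ} (h : T.HExt v a b) :
    a ∈ T.hJ v.2 ∧ b ∈ T.hJ v.2 ∧ a < b := by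
  obtain ⟨-, k, l, ⟨h1, -, -, h2, h3, h4, h5, -⟩, -⟩ := h
  exact ⟨h1, h2, by omega⟩

theorem IsTMesh.hExt_span (hT : T.IsTMesh) {P : IntRect} (hP : P ∈ T.faces) {v : ℤ × ℤ} {a b : ℤ}
    (hv : T.HExt v a b) (hm : P.MeetsH v.2 a b) : a ≤ P.left ∧ P.right ≤ b := by
  obtain ⟨h1, h2, h3, h4⟩ := hm
  obtain ⟨ha, hb, -⟩ := hv.mem_hJ
  constructor <;> by_contra h
  · exact hT.not_mem_hJ_of_face hP (by omega) h3 h1 h2 ha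
  · exact hT.not_mem_hJ_of_face hP h4 (by omega) h1 h2 hb

theorem IsTMesh.vExt_span (hT : T.IsTMesh) {P : IntRect} (hP : P ∈ T.faces) {v : ℤ × ℤ} {a b : ℤ}
    (hv : T.VExt v a b) (hm : P.MeetsV v.1 a b) : a ≤ P.bottom ∧ P.top ≤ b :=
  hT.swap.hExt_span (P := P.swap) hP (v := v.swap) (hT.hExt_swap.2 hv) hm

end RectMesh

/-- The smallest rectangle that contains `P` and `Q`. -/
def IntRect.hull (P Q : IntRect) : IntRect :=
  ⟨min P.left Q.left, max P.right Q.right, min P.bottom Q.bottom, max P.top Q.top,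
    by have := P.left_lt_right; omega, by have := P.bottom_lt_top; omega⟩

namespace RectMesh

variable {T : RectMesh}

theorem IsTMesh.hull_misses (hT : T.IsTMesh) {R S : IntRect} (hR : T.MissesExtended R)
    (hS : T.MissesExtended S) {i j : ℤ} (h1 : R.HasCell i j) (h2 : S.HasCell i j) :
    T.MissesExtended (R.hull S) := by
  obtain ⟨⟨P, hP, wP⟩, hR1, hR2⟩ := hR
  obtain ⟨⟨P', hP', wP'⟩, hS1, hS2⟩ := hS
  obtain ⟨a1, a2, a3, a4⟩ := h1
  obtain ⟨b1, b2, b3, b4⟩ := h2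
  obtain ⟨c1, c2, c3, c4⟩ := wP
  obtain ⟨d1, d2, d3, d4⟩ := wP'
  obtain rfl := hT.cell_unique hP hP' (i := i) (j := j)
    ⟨by omega, by omega, by omega, by omega⟩ ⟨by omega, by omega, by omega, by omega⟩
  refine ⟨⟨P, hP, ?_⟩, fun v a b hv hm => ?_, fun v a b hv hm => ?_⟩
  · unfold IntRect.Within IntRect.hull
    simp only
    omega
  · have n1 := hR1 v a b hv
    have n2 := hS1 v a b hv
    unfold IntRect.MeetsH IntRect.hull at *
    simp only at *
    have := hT.hExt_span hP hv (by unfold IntRect.MeetsH; omega)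
    omega
  · have n1 := hR2 v a b hv
    have n2 := hS2 v a b hv
    unfold IntRect.MeetsV IntRect.hull at *
    simp only at *
    have := hT.vExt_span hP hv (by unfold IntRect.MeetsV; omega)
    omega

/-- Among the rectangles that contain a given cell and miss the extended skeleton there is a
largest one, since these rectangles are closed under taking hulls. -/
theorem IsTMesh.exists_extended_face (hT : T.IsTMesh) {R : IntRect} (hR : T.MissesExtended R)
    {i j : ℤ} (h : R.HasCell i j) :
    ∃ Q ∈ T.extended.faces, Q.HasCell i j ∧
      ∀ S, T.MissesExtended S → S.HasCell i j → S.Within Q := by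
  obtain ⟨n, ⟨Q, hQ, hc, hn⟩, hmax⟩ := Int.exists_greatest_of_bdd
    (P := fun n => ∃ Q : IntRect, T.MissesExtended Q ∧ Q.HasCell i j ∧
      n = (Q.right - Q.left) + (Q.top - Q.bottom))
    ⟨(T.right - T.left) + (T.top - T.bottom), by
      rintro n ⟨Q, ⟨⟨P, hP, w⟩, -⟩, -, rfl⟩
      have := hT.2.2.1 P hP
      unfold IntRect.Within at w
      omega⟩ ⟨_, R, hR, h, rfl⟩
  have key : ∀ S, T.MissesExtended S → S.HasCell i j → S.Within Q := by
    intro S hS hSc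
    have := hmax _ ⟨Q.hull S, hT.hull_misses hQ hS hc hSc, by
      unfold IntRect.HasCell IntRect.hull at *; simp only; omega, rfl⟩
    unfold IntRect.Within
    unfold IntRect.hull at this
    simp only at this
    omega
  refine ⟨Q, ⟨hQ, fun P hP hw => ?_⟩, hc, key⟩
  have hw' := key P hP (by unfold IntRect.HasCell IntRect.Within at *; omega)
  unfold IntRect.Within at hw hw'
  exact IntRect.ext' (by omega) (by omega) (by omega) (by omega)

theorem IsTMesh.extended (hT : T.IsTMesh) : T.extended.IsTMesh := by
  refine ⟨hT.1, hT.2.1, ?_, fun i j h1 h2 h3 h4 => ?_⟩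
  · rintro Q ⟨⟨⟨P, hP, w⟩, -⟩, -⟩
    have := hT.2.2.1 P hP
    unfold IntRect.Within at w
    change T.left ≤ _ ∧ _ ≤ T.right ∧ T.bottom ≤ _ ∧ _ ≤ T.top
    omega
  · obtain ⟨P, hP, hc⟩ := hT.exists_cell h1 h2 h3 h4
    obtain ⟨Q, hQ, hQc, hQm⟩ := hT.exists_extended_face
      (R := ⟨i, i + 1, j, j + 1, by omega, by omega⟩) (i := i) (j := j)
      ⟨⟨P, hP, by unfold IntRect.Within IntRect.HasCell at *; simp only; omega⟩,
        fun v a b _ hm => by unfold IntRect.MeetsH at hm; simp only at hm; omega,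
        fun v a b _ hm => by unfold IntRect.MeetsV at hm; simp only at hm; omega⟩
      (by unfold IntRect.HasCell; simp only; omega)
    refine ⟨Q, ⟨hQ, hQc⟩, ?_⟩
    rintro S ⟨hS, hSc⟩
    exact (hS.2 Q hQ.1 (hQm S hS.1 hSc)).symm

/-- The skeleton of the extended mesh consists of the skeleton of the mesh and the
extensions. -/
theorem IsTMesh.hUnit_extended (hT : T.IsTMesh) {i j : ℤ} :
    T.extended.HUnit i j ↔
      T.HUnit i j ∨ ∃ v a b, T.HExt v a b ∧ v.2 = j ∧ a ≤ i ∧ i < b := by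
  constructor
  · rintro ⟨h1, h2, h3, h4, h5⟩
    by_contra hn
    rw [not_or] at hn
    obtain ⟨n1, n2⟩ := hn
    obtain ⟨P, hP, p1, p2⟩ := (not_hUnit_iff (X := T) h1 h2 h3 h4).1 n1
    unfold IntRect.HasCell at p1 p2
    obtain ⟨Q, hQ, -, hQm⟩ := hT.exists_extended_face (i := i) (j := j)
      (R := ⟨i, i + 1, j - 1, j + 1, by omega, by omega⟩)
      ⟨⟨P, hP, by unfold IntRect.Within; simp only; omega⟩,
        fun v a b hv hm => n2 ⟨v, a, b, hv, by
          unfold IntRect.MeetsH at hm; simp only at hm; omega⟩,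
        fun v a b _ hm => by unfold IntRect.MeetsV at hm; simp only at hm; omega⟩
      (by unfold IntRect.HasCell; simp only; omega)
    have w := hQm ⟨i, i + 1, j - 1, j + 1, by omega, by omega⟩
      ⟨⟨P, hP, by unfold IntRect.Within; simp only; omega⟩,
        fun v a b hv hm => n2 ⟨v, a, b, hv, by
          unfold IntRect.MeetsH at hm; simp only at hm; omega⟩,
        fun v a b _ hm => by unfold IntRect.MeetsV at hm; simp only at hm; omega⟩
      (by unfold IntRect.HasCell; simp only; omega)
    unfold IntRect.Within at w
    simp only at w
    exact h5 Q hQ (by unfold IntRect.MeetsH; omega)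
  · rintro (⟨h1, h2, h3, h4, h5⟩ | ⟨v, a, b, hv, rfl, ha, hb⟩)
    · refine ⟨h1, h2, h3, h4, ?_⟩
      rintro Q ⟨⟨⟨P, hP, w⟩, -⟩, -⟩ hm
      exact h5 P hP (by unfold IntRect.MeetsH IntRect.Within at *; omega)
    · obtain ⟨ha', hb', hab⟩ := hv.mem_hJ
      have ba := hT.hJ_box ha'
      have bb := hT.hJ_box hb'
      refine ⟨by change T.left ≤ i; omega, by change i < T.right; omega, ba.2.2.1, ba.2.2.2, ?_⟩
      rintro Q ⟨⟨-, hm, -⟩, -⟩ hm'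
      exact hm v a b hv (by unfold IntRect.MeetsH at *; omega)

theorem IsTMesh.vUnit_extended (hT : T.IsTMesh) {i j : ℤ} :
    T.extended.VUnit i j ↔
      T.VUnit i j ∨ ∃ v a b, T.VExt v a b ∧ v.1 = i ∧ a ≤ j ∧ j < b := by
  rw [← hUnit_swap, ← hUnit_swap, ← hT.extended_swap, hT.swap.hUnit_extended]
  refine or_congr_right ⟨?_, ?_⟩
  · rintro ⟨v, a, b, hv, h⟩
    exact ⟨v.swap, a, b, hT.hExt_swap.1 hv, h⟩
  · rintro ⟨v, a, b, hv, h⟩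
    exact ⟨v.swap, a, b, hT.hExt_swap.2 hv, h⟩

theorem IsTMesh.hJ_extended (hT : T.IsTMesh) {i j : ℤ} (h : i ∈ T.hJ j) :
    i ∈ T.extended.hJ j := by
  rw [hT.extended.mem_hJ, hT.vUnit_extended, hT.vUnit_extended]
  exact (hT.mem_hJ.1 h).imp .inl .inl

end RectMesh

/-! ### One row of a mesh and its extensions -/

/-- One row (or column) of a T-mesh: the line runs from `L` to `R`, `J` is the set of indices at
which it meets the perpendicular skeleton, and `E i` says that the unit edge `[i, i + 1]` of the
line belongs to the skeleton. -/
structure Row where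
  L : ℤ
  R : ℤ
  J : Set ℤ
  E : ℤ → Prop

namespace Row

/-- A point with an incident edge; the touched members of `J` are the vertices of the row. -/
def Touched (Y : Row) (x : ℤ) : Prop := Y.E (x - 1) ∨ Y.E x

/-- The axioms satisfied by a row in the active region of an admissible T-mesh. By `hom`, an edge
ends only where the line meets the perpendicular skeleton; by `frame`, no edge ends outside the
active region, apart from the ends of the line; `gap` is the condition that two vertices on the
boundary of one face are joined within the skeleton. -/
structure Valid (Y : Row) : Prop where
  width : Y.L + 4 ≤ Y.R
  J_sub : ∀ x ∈ Y.J, Y.L ≤ x ∧ x ≤ Y.R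
  L_mem : Y.L ∈ Y.J
  L1_mem : Y.L + 1 ∈ Y.J
  R_mem : Y.R ∈ Y.J
  R1_mem : Y.R - 1 ∈ Y.J
  E_sub : ∀ i, Y.E i → Y.L ≤ i ∧ i < Y.R
  hom : ∀ x, x ∉ Y.J → (Y.E (x - 1) ↔ Y.E x)
  frame : ∀ x, Y.L < x → x < Y.R → ¬ (Y.E (x - 1) ↔ Y.E x) → Y.L + 2 ≤ x ∧ x ≤ Y.R - 2
  gap : ∀ k ∈ Y.J, ∀ l ∈ Y.J, k < l → (∀ x, k < x → x < l → x ∉ Y.J) → Y.Touched k →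
    Y.Touched l → Y.E k

/-- A segment starts at the T-junction `x`. -/
def Opens (Y : Row) (x : ℤ) : Prop :=
  Y.E x ∧ ¬ Y.E (x - 1) ∧ Y.L + 2 ≤ x ∧ x ≤ Y.R - 2

/-- A segment ends at the T-junction `x`. -/
def Closes (Y : Row) (x : ℤ) : Prop :=
  Y.E (x - 1) ∧ ¬ Y.E x ∧ Y.L + 2 ≤ x ∧ x ≤ Y.R - 2

/-- A segment starts at the T-junction `x`, whose face extension is `[a, x[`. -/
def ExtL (Y : Row) (x a : ℤ) : Prop := Y.Opens x ∧ ∃ k b, Consecutive4 Y.J a k x b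

/-- A segment ends at the T-junction `x`, whose face extension is `]x, b]`. -/
def ExtR (Y : Row) (x b : ℤ) : Prop := Y.Closes x ∧ ∃ a l, Consecutive4 Y.J a x l b

/-- The unit edges of the extended row. -/
def Ext (Y : Row) (i : ℤ) : Prop :=
  Y.E i ∨ (∃ x a, Y.ExtL x a ∧ a ≤ i ∧ i < x) ∨ ∃ x b, Y.ExtR x b ∧ x ≤ i ∧ i < b

/-- The point `p` is on the face extension of the T-junction `x`. -/
def Face (Y : Row) (x p : ℤ) : Prop :=
  (∃ a, Y.ExtL x a ∧ a ≤ p ∧ p < x) ∨ ∃ b, Y.ExtR x b ∧ x < p ∧ p ≤ b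

/-- The overlap vertices of the row. -/
def Overlap (Y : Row) (p : ℤ) : Prop :=
  p ∈ Y.J ∧ ¬ Y.Touched p ∧ ∃ x y, x ≠ y ∧ Y.Face x p ∧ ∃ q, Y.Face x q ∧ Y.Face y q

/-- `[p, q]` is a maximal nondegenerate interval of edges satisfying `F`. -/
def _root_.IsRun (F : ℤ → Prop) (p q : ℤ) : Prop :=
  p < q ∧ (∀ i, p ≤ i → i < q → F i) ∧ ¬ F (p - 1) ∧ ¬ F q

/-- The condition on a vertex of the extended row to be neither an active nor an overlap vertex. -/
def Bad (Y : Row) (x : ℤ) : Prop :=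
  ¬ (Y.Touched x ∧ Y.L + 2 ≤ x ∧ x ≤ Y.R - 2) ∧ ¬ Y.Overlap x

/-! #### Reflection of a row -/

/-- The reflected row. -/
def neg (Y : Row) : Row := ⟨-Y.R, -Y.L, {x | -x ∈ Y.J}, fun i => Y.E (-i - 1)⟩

variable {Y : Row}

theorem neg_E {i : ℤ} : Y.neg.E i ↔ Y.E (-i - 1) := Iff.rfl

theorem neg_E_pred {i : ℤ} : Y.neg.E (i - 1) ↔ Y.E (-i) := by
  rw [neg_E, show -(i - 1) - 1 = -i by ring]

theorem mem_neg_J {x : ℤ} : x ∈ Y.neg.J ↔ -x ∈ Y.J := Iff.rfl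

theorem touched_neg {x : ℤ} : Y.neg.Touched x ↔ Y.Touched (-x) := by
  unfold Touched
  rw [neg_E_pred, neg_E, or_comm]

theorem Valid.neg (hY : Y.Valid) : Y.neg.Valid where
  width := by have := hY.width; simp only [Row.neg]; omega
  J_sub x hx := by have := hY.J_sub _ hx; simp only [Row.neg]; omega
  L_mem := by rw [mem_neg_J]; simp only [Row.neg, neg_neg]; exact hY.R_mem
  L1_mem := by
    rw [mem_neg_J]; convert hY.R1_mem using 1; simp only [Row.neg]; omega
  R_mem := by rw [mem_neg_J]; simp only [Row.neg, neg_neg]; exact hY.L_mem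
  R1_mem := by
    rw [mem_neg_J]; convert hY.L1_mem using 1; simp only [Row.neg]; omega
  E_sub i hi := by have := hY.E_sub _ hi; simp only [Row.neg]; omega
  hom x hx := by rw [neg_E_pred, neg_E]; exact (hY.hom (-x) hx).symm
  frame x h1 h2 h := by
    rw [neg_E_pred, neg_E] at h
    have := hY.frame (-x) (by simp only [Row.neg] at *; omega) (by simp only [Row.neg] at *; omega)
      (fun h' => h h'.symm)
    simp only [Row.neg]
    omega
  gap k hk l hl hkl hn h1 h2 := by
    rw [touched_neg] at h1 h2
    have h := hY.gap (-l) hl (-k) hk (by omega)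
      (fun x hx hx' hxJ => hn (-x) (by omega) (by omega) (by rw [mem_neg_J, neg_neg]; exact hxJ))
      h2 h1
    have hs : ∀ n : ℕ, -l + n < -k → Y.E (-l + n) := by
      intro n
      induction n with
      | zero => intro _; simpa using h
      | succ n ih =>
        intro hlt
        push_cast at hlt ⊢
        have := ih (by omega)
        rw [show -l + (n : ℤ) = -l + (n + 1) - 1 by ring] at this
        refine (hY.hom _ fun hJ => hn (-(-l + (n + 1))) (by omega) (by omega) ?_).1 this
        rw [mem_neg_J, neg_neg]; exact hJ
    have := hs (l - k - 1).toNat (by rw [Int.toNat_of_nonneg (by omega)]; omega)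
    rw [Int.toNat_of_nonneg (by omega)] at this
    rw [neg_E]
    convert this using 1
    omega

theorem opens_neg {x : ℤ} : Y.neg.Opens x ↔ Y.Closes (-x) := by
  unfold Opens Closes
  rw [neg_E_pred, neg_E]
  simp only [Row.neg]
  have : (-Y.R + 2 ≤ x ∧ x ≤ -Y.L - 2) ↔ (Y.L + 2 ≤ -x ∧ -x ≤ Y.R - 2) := by omega
  rw [this]

theorem neg_neg_row : Y.neg.neg = Y := by
  obtain ⟨L, R, J, E⟩ := Y
  simp only [Row.neg, neg_neg, Row.mk.injEq, true_and]
  refine ⟨?_, ?_⟩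
  · ext x; simp
  · funext i; congr 1; ring

theorem consecutive4_neg {a k l b : ℤ} :
    Consecutive4 Y.neg.J a k l b ↔ Consecutive4 Y.J (-b) (-l) (-k) (-a) := by
  unfold Consecutive4
  simp only [mem_neg_J]
  constructor
  · rintro ⟨h1, h2, h3, h4, h5, h6, h7, h8⟩
    refine ⟨h4, h3, h2, h1, by omega, by omega, by omega, fun x hx h h' => ?_⟩
    have := h8 (-x) (by rwa [neg_neg]) (by omega) (by omega)
    omega
  · rintro ⟨h1, h2, h3, h4, h5, h6, h7, h8⟩
    refine ⟨h4, h3, h2, h1, by omega, by omega, by omega, fun x hx h h' => ?_⟩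
    have := h8 (-x) hx (by omega) (by omega)
    omega

theorem extL_neg {x a : ℤ} : Y.neg.ExtL x a ↔ Y.ExtR (-x) (-a) := by
  unfold ExtL ExtR
  rw [opens_neg]
  simp only [consecutive4_neg]
  refine and_congr_right fun _ => ⟨fun ⟨k, b, h⟩ => ⟨_, _, h⟩, fun ⟨k, b, h⟩ => ⟨-b, -k, ?_⟩⟩
  rw [neg_neg, neg_neg]; exact h

theorem extR_neg {x a : ℤ} : Y.neg.ExtR x a ↔ Y.ExtL (-x) (-a) := by
  have := extL_neg (Y := Y.neg) (x := -x) (a := -a)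
  rw [neg_neg_row, neg_neg, neg_neg] at this
  exact this.symm

theorem ext_neg {i : ℤ} : Y.neg.Ext i ↔ Y.Ext (-i - 1) := by
  unfold Ext
  rw [neg_E]
  refine or_congr_right ?_
  rw [or_comm]
  refine or_congr ?_ ?_
  · simp only [extR_neg]
    constructor
    · rintro ⟨x, b, h, h1, h2⟩
      exact ⟨_, _, h, by omega, by omega⟩
    · rintro ⟨x, b, h, h1, h2⟩
      exact ⟨-x, -b, by rwa [neg_neg, neg_neg], by omega, by omega⟩
  · simp only [extL_neg]
    constructor
    · rintro ⟨x, b, h, h1, h2⟩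
      exact ⟨_, _, h, by omega, by omega⟩
    · rintro ⟨x, b, h, h1, h2⟩
      exact ⟨-x, -b, by rwa [neg_neg, neg_neg], by omega, by omega⟩

theorem face_neg {x p : ℤ} : Y.neg.Face x p ↔ Y.Face (-x) (-p) := by
  unfold Face
  rw [or_comm]
  refine or_congr ?_ ?_
  · simp only [extR_neg]
    constructor
    · rintro ⟨b, h, h1, h2⟩
      exact ⟨_, h, by omega, by omega⟩
    · rintro ⟨b, h, h1, h2⟩
      exact ⟨-b, by rwa [neg_neg], by omega, by omega⟩
  · simp only [extL_neg]
    constructor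
    · rintro ⟨b, h, h1, h2⟩
      exact ⟨_, h, by omega, by omega⟩
    · rintro ⟨b, h, h1, h2⟩
      exact ⟨-b, by rwa [neg_neg], by omega, by omega⟩

theorem overlap_neg {p : ℤ} : Y.neg.Overlap p ↔ Y.Overlap (-p) := by
  unfold Overlap
  rw [mem_neg_J, touched_neg]
  simp only [face_neg]
  refine and_congr_right fun _ => and_congr_right fun _ => ?_
  constructor
  · rintro ⟨x, y, hxy, h, q, h1, h2⟩
    exact ⟨-x, -y, by omega, h, -q, h1, h2⟩
  · rintro ⟨x, y, hxy, h, q, h1, h2⟩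
    exact ⟨-x, -y, by omega, by rwa [neg_neg], -q, by rwa [neg_neg, neg_neg],
      by rwa [neg_neg, neg_neg]⟩

theorem bad_neg {x : ℤ} : Y.neg.Bad x ↔ Y.Bad (-x) := by
  unfold Bad
  rw [overlap_neg, touched_neg]
  simp only [Row.neg]
  have : (-Y.R + 2 ≤ x ∧ x ≤ -Y.L - 2) ↔ (Y.L + 2 ≤ -x ∧ -x ≤ Y.R - 2) := by omega
  rw [this]

theorem isRun_neg {p q : ℤ} (h : IsRun Y.Ext p q) : IsRun Y.neg.Ext (-q) (-p) := by
  obtain ⟨h1, h2, h3, h4⟩ := h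
  refine ⟨by omega, fun i hi hi' => ext_neg.2 (h2 _ (by omega) (by omega)), ?_, ?_⟩
  · rw [ext_neg]; convert h4 using 2; omega
  · rw [ext_neg]; convert h3 using 2; omega

/-! #### The ends of a segment of the extended row -/

theorem Valid.same (hY : Y.Valid) {i i' : ℤ} (h : i ≤ i') (hn : ∀ x, i < x → x ≤ i' → x ∉ Y.J) :
    Y.E i ↔ Y.E i' := by
  induction i', h using Int.leInduction with
  | base => rfl
  | succ n hmn ih =>
    rw [ih fun x h1 h2 => hn x h1 (by omega)]
    have := hY.hom (n + 1) (hn _ (by omega) le_rfl)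
    rwa [add_sub_cancel_right] at this

theorem Valid.exists_prev (hY : Y.Valid) {x : ℤ} (hx : Y.L < x) :
    ∃ k ∈ Y.J, k < x ∧ ∀ m, k < m → m < x → m ∉ Y.J := by
  obtain ⟨k, ⟨hk, hkx⟩, hmax⟩ := Int.exists_greatest_of_bdd (P := fun k => k ∈ Y.J ∧ k < x)
    ⟨x, fun z hz => hz.2.le⟩ ⟨Y.L, hY.L_mem, hx⟩
  exact ⟨k, hk, hkx, fun m h1 h2 h3 => by have := hmax m ⟨h3, h2⟩; omega⟩

theorem Valid.exists_next (hY : Y.Valid) {x : ℤ} (hx : x < Y.R) :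
    ∃ k ∈ Y.J, x < k ∧ ∀ m, x < m → m < k → m ∉ Y.J := by
  obtain ⟨k, ⟨hk, hkx⟩, hmin⟩ := Int.exists_least_of_bdd (P := fun k => k ∈ Y.J ∧ x < k)
    ⟨x, fun z hz => hz.2.le⟩ ⟨Y.R, hY.R_mem, hx⟩
  exact ⟨k, hk, hkx, fun m h1 h2 h3 => by have := hmin m ⟨h3, h1⟩; omega⟩

theorem Opens.mem_J (hY : Y.Valid) {x : ℤ} (h : Y.Opens x) : x ∈ Y.J := by
  by_contra hx
  exact h.2.1 ((hY.hom x hx).2 h.1)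

theorem Opens.exists_extL (hY : Y.Valid) {x : ℤ} (h : Y.Opens x) : ∃ a, Y.ExtL x a := by
  obtain ⟨-, -, h1, h2⟩ := id h
  obtain ⟨k, k1, k2, k3⟩ := hY.exists_prev (x := x) (by omega)
  have hk : Y.L + 1 ≤ k := by
    by_contra hlt
    exact k3 (Y.L + 1) (by omega) (by omega) hY.L1_mem
  obtain ⟨a, a1, a2, a3⟩ := hY.exists_prev (x := k) (by omega)
  obtain ⟨b, b1, b2, b3⟩ := hY.exists_next (x := x) (by omega)
  refine ⟨a, h, k, b, a1, k1, h.mem_J hY, b1, a2, k2, b2, fun m hm hm1 hm2 => ?_⟩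
  by_contra hne
  rcases lt_trichotomy m k with h' | h' | h'
  · exact a3 m (by omega) h' hm
  · omega
  rcases lt_trichotomy m x with h'' | h'' | h''
  · exact k3 m h' h'' hm
  · omega
  · exact b3 m h'' (by omega) hm

theorem Closes.exists_extR (hY : Y.Valid) {x : ℤ} (h : Y.Closes x) : ∃ b, Y.ExtR x b := by
  obtain ⟨a, ha⟩ := Opens.exists_extL hY.neg (x := -x) (by rw [opens_neg, neg_neg]; exact h)
  rw [extL_neg, neg_neg] at ha
  exact ⟨_, ha⟩

/-- A face extension contains no edge and, by the rule that vertices on the boundary of a face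
are joined, no vertex except possibly its far end. -/
theorem ExtL.not_E (hY : Y.Valid) {x a : ℤ} (h : Y.ExtL x a) {i : ℤ} (h1 : a ≤ i) (h2 : i < x) :
    ¬ Y.E i := by
  obtain ⟨ho, k, b, c1, c2, c3, c4, c5, c6, c7, c8⟩ := h
  have e1 : ∀ i, k ≤ i → i < x → ¬ Y.E i := fun i hi hi' =>
    fun hE => ho.2.1 ((hY.same (i := i) (i' := x - 1) (by omega) fun z z1 z2 hz => by
      have := c8 z hz (by omega) (by omega); omega).1 hE)
  rcases le_or_gt k i with hki | hki
  · exact e1 i hki h2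
  · have hk : ¬ Y.Touched k := fun hk => e1 k le_rfl c6 (hY.gap k c2 x c3 c6
      (fun z z1 z2 hz => by have := c8 z hz (by omega) (by omega); omega) hk (.inr ho.1))
    intro hE
    exact hk (.inl ((hY.same (i := i) (i' := k - 1) (by omega) fun z z1 z2 hz => by
      have := c8 z hz (by omega) (by omega); omega).1 hE))

theorem ExtL.lt {x a : ℤ} (h : Y.ExtL x a) : a < x := by
  obtain ⟨ho, k, b, c1, c2, c3, c4, c5, c6, c7, c8⟩ := h
  omega

theorem ExtR.lt {x b : ℤ} (h : Y.ExtR x b) : x < b := by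
  obtain ⟨ho, k, l, c1, c2, c3, c4, c5, c6, c7, c8⟩ := h
  omega

/-- Distinct face extensions of the same orientation are disjoint. -/
theorem ExtL.eq_of_mem (hY : Y.Valid) {x a y c r : ℤ} (h : Y.ExtL x a) (h' : Y.ExtL y c)
    (h1 : a ≤ r) (h2 : r < x) (h3 : c ≤ r) (h4 : r < y) : x = y := by
  rcases lt_trichotomy x y with hxy | hxy | hxy
  · exact absurd h.1.1 (h'.not_E hY (by omega) hxy)
  · exact hxy
  · exact absurd h'.1.1 (h.not_E hY (by omega) hxy)

theorem ExtL.unique {x a c : ℤ} (h : Y.ExtL x a) (h' : Y.ExtL x c) : a = c := by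
  obtain ⟨-, k, b, c1, c2, c3, c4, c5, c6, c7, c8⟩ := h
  obtain ⟨-, k', b', c1', c2', c3', c4', c5', c6', c7', c8'⟩ := h'
  obtain rfl : k = k' := by
    rcases lt_trichotomy k k' with hk | hk | hk
    · have := c8 k' c2' (by omega) (by omega); omega
    · exact hk
    · have := c8' k c2 (by omega) (by omega); omega
  rcases lt_trichotomy a c with hk | hk | hk
  · have := c8 c c1' (by omega) (by omega); omega
  · exact hk
  · have := c8' a c1 (by omega) (by omega); omega

/-- The left end of a segment of the extended row is the left end of the line or the end of the
extension of a T-junction. -/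
theorem Valid.run_left (hY : Y.Valid) {p q : ℤ} (h : IsRun Y.Ext p q) :
    (p = Y.L ∧ Y.E Y.L) ∨ ∃ x, Y.ExtL x p := by
  obtain ⟨h1, h2, h3, h4⟩ := h
  rcases h2 p le_rfl h1 with hE | ⟨x, a, hx, ha, hx'⟩ | ⟨x, b, hx, hx', hb⟩
  · rcases eq_or_ne p Y.L with rfl | hp
    · exact .inl ⟨rfl, hE⟩
    · have hb := hY.E_sub p hE
      have hn : ¬ Y.E (p - 1) := fun h => h3 (.inl h)
      have hf := hY.frame p (by omega) (by omega) (by tauto)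
      have ho : Y.Opens p := ⟨hE, hn, hf⟩
      obtain ⟨a, ha⟩ := ho.exists_extL hY
      have := ha.lt
      exact absurd (.inr (.inl ⟨p, a, ha, by omega, by omega⟩)) h3
  · rcases eq_or_ne a p with rfl | hne
    · exact .inr ⟨x, hx⟩
    · exact absurd (.inr (.inl ⟨x, a, hx, by omega, by omega⟩)) h3
  · rcases eq_or_ne x p with rfl | hne
    · exact absurd (.inl hx.1.1) h3
    · exact absurd (.inr (.inr ⟨x, b, hx, by omega, by omega⟩)) h3

/-- A whole extension belongs to the extended row, including its edge part. -/
theorem ExtL.ext_of_mem (hY : Y.Valid) {x a k b i : ℤ} (h : Y.Opens x)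
    (hc : Consecutive4 Y.J a k x b) (h1 : a ≤ i) (h2 : i < b) : Y.Ext i := by
  rcases lt_or_ge i x with hi | hi
  · exact .inr (.inl ⟨x, a, ⟨h, k, b, hc⟩, h1, hi⟩)
  · obtain ⟨c1, c2, c3, c4, c5, c6, c7, c8⟩ := hc
    exact .inl ((hY.same hi fun z z1 z2 hz => by
      have := c8 z hz (by omega) (by omega); omega).1 h.1)

theorem ExtR.ext_of_mem (hY : Y.Valid) {x a l b i : ℤ} (h : Y.Closes x)
    (hc : Consecutive4 Y.J a x l b) (h1 : a ≤ i) (h2 : i < b) : Y.Ext i := by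
  have := ExtL.ext_of_mem hY.neg (x := -x) (a := -b) (k := -l) (b := -a) (i := -i - 1)
    (by rw [opens_neg, neg_neg]; exact h) (by rw [consecutive4_neg]; simpa using hc)
    (by omega) (by omega)
  rw [ext_neg] at this
  convert this using 1
  ring

theorem Valid.run_left' (hY : Y.Valid) {p q : ℤ} (h : IsRun Y.Ext p q) :
    (p = Y.L ∧ Y.E Y.L) ∨ ∃ k x b, Y.Opens x ∧ Consecutive4 Y.J p k x b ∧ b ≤ q := by
  refine (hY.run_left h).imp id ?_
  rintro ⟨x, ho, k, b, hc⟩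
  refine ⟨k, x, b, ho, hc, ?_⟩
  obtain ⟨h1, h2, h3, h4⟩ := h
  by_contra hlt
  exact h4 (ExtL.ext_of_mem hY ho hc h1.le (by omega))

theorem Valid.run_right' (hY : Y.Valid) {p q : ℤ} (h : IsRun Y.Ext p q) :
    (q = Y.R ∧ Y.E (Y.R - 1)) ∨ ∃ a x l, Y.Closes x ∧ Consecutive4 Y.J a x l q ∧ p ≤ a := by
  rcases hY.neg.run_left' (isRun_neg h) with ⟨h1, h2⟩ | ⟨k, x, b, h1, h2, h3⟩
  · left
    simp only [Row.neg, neg_neg] at h1 h2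
    exact ⟨by omega, h2⟩
  · rw [opens_neg] at h1
    rw [consecutive4_neg, neg_neg] at h2
    exact .inr ⟨_, _, _, h1, h2, by omega⟩

theorem Valid.left_mem_J (hY : Y.Valid) {p q : ℤ} (h : IsRun Y.Ext p q) : p ∈ Y.J := by
  rcases hY.run_left h with ⟨rfl, -⟩ | ⟨x, -, k, b, hc⟩
  exacts [hY.L_mem, hc.1]

theorem Valid.right_mem_J (hY : Y.Valid) {p q : ℤ} (h : IsRun Y.Ext p q) : q ∈ Y.J := by
  have := hY.neg.left_mem_J (isRun_neg h)
  rwa [mem_neg_J, neg_neg] at this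

/-- The first two vertices of a segment of the extended row are bad. -/
theorem Valid.bad_left (hY : Y.Valid) {p q p' r : ℤ} (h : IsRun Y.Ext p q) (hp' : p < p')
    (hp'J : p' ∈ Y.J) (hn : ∀ m, p < m → m < p' → m ∉ Y.J) (hr : r = p ∨ r = p') : Y.Bad r := by
  rcases hY.run_left h with ⟨rfl, hE⟩ | ⟨x, hx⟩
  · have hp'' : p' = Y.L + 1 := by
      by_contra hne
      exact hn (Y.L + 1) (by omega) (by omega) hY.L1_mem
    refine ⟨fun hh => by omega, fun ho => ho.2.1 ?_⟩
    rcases hr with rfl | rfl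
    · exact .inr hE
    · left; rw [hp'', add_sub_cancel_right]; exact hE
  · have hxp := hx.lt
    obtain ⟨ho, k, b, c1, c2, c3, c4, c5, c6, c7, c8⟩ := id hx
    obtain rfl : p' = k := by
      rcases lt_trichotomy p' k with h' | h' | h'
      · have := c8 p' hp'J (by omega) (by omega); omega
      · exact h'
      · exact absurd c2 (hn k c5 h')
    have hE : ¬ Y.E (p - 1) := fun h' => h.2.2.1 (.inl h')
    have hut : ¬ Y.Touched r := by
      rintro (hu | hu) <;> rcases hr with rfl | rfl
      · exact hE hu
      · exact hx.not_E hY (by omega) (by omega) hu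
      · exact hx.not_E hY le_rfl hxp hu
      · exact hx.not_E hY (by omega) (by omega) hu
    -- no other face extension meets the face extension of `x`
    have key : ∀ y s, Y.Face y s → p ≤ s → s < x → y = x := by
      rintro y s (⟨a, ha, h1, h2⟩ | ⟨a, ha, h1, h2⟩) h3 h4
      · exact (hx.eq_of_mem hY ha h3 h4 h1 h2).symm
      · exfalso
        rcases lt_trichotomy y p with hy | rfl | hy
        · exact h.2.2.1 (.inr (.inr ⟨y, a, ha, by omega, by omega⟩))
        · exact hE ha.1.1
        · exact hx.not_E hY (by omega) (by omega) ha.1.1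
    refine ⟨fun hh => hut hh.1, ?_⟩
    rintro ⟨-, -, y, z, hyz, hf, s, hs1, hs2⟩
    obtain rfl := key y r hf (by omega) (by omega)
    refine hyz (key z s hs2 ?_ ?_).symm
    · rcases hs1 with ⟨a, ha, h1, h2⟩ | ⟨a, ha, h1, h2⟩
      · rwa [hx.unique ha]
      · exact absurd ho.1 ha.1.2.1
    · rcases hs1 with ⟨a, ha, h1, h2⟩ | ⟨a, ha, h1, h2⟩
      · exact h2
      · exact absurd ho.1 ha.1.2.1

/-- A new vertex on a face extension that is neither the end nor the second vertex of its segment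
is an overlap vertex: the segment continues beyond because of an opposite T-junction. -/
theorem Valid.overlap_of_extL (hY : Y.Valid) {p q p' r x a : ℤ} (h : IsRun Y.Ext p q)
    (hn : ∀ m, p < m → m < p' → m ∉ Y.J) (hp'J : p' ∈ Y.J) (hp' : p < p')
    (hr : r ∈ Y.J) (hpr : p < r) (hrq : r < q)
    (hut : ¬ Y.Touched r) (hrp : r ≠ p') (hx : Y.ExtL x a) (h1 : a ≤ r) (h2 : r < x) :
    Y.Overlap r := by
  refine ⟨hr, hut, ?_⟩
  obtain ⟨g1, g2, g3, g4⟩ := h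
  have hfx : Y.Face x r := .inl ⟨a, hx, h1, h2⟩
  have hne : ∀ y b, Y.ExtR y b → x ≠ y := by
    rintro y b hb rfl
    exact hb.1.2.1 hx.1.1
  have hpa : p ≤ a := by
    by_contra hlt
    exact g3 (.inr (.inl ⟨x, a, hx, by omega, by omega⟩))
  -- the edge to the left of `a` is present, hence due to an edge or to an opposite extension
  have key : p < a → Y.E (a - 1) ∨ ∃ y b, Y.ExtR y b ∧ y ≤ a - 1 ∧ a - 1 < b := by
    intro hpa'
    rcases g2 (a - 1) (by omega) (by omega) with hE | ⟨y, c, hy, hc, hy'⟩ | hy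
    · exact .inl hE
    · exfalso
      rcases eq_or_ne y a with rfl | hya
      · exact hx.not_E hY le_rfl hx.lt hy.1.1
      · obtain rfl := hx.eq_of_mem hY hy (r := a) le_rfl hx.lt (by omega) (by omega)
        have := hx.unique hy
        omega
    · exact .inr hy
  have hpa' : p < a := by
    rcases eq_or_ne p a with rfl | hne'
    · exfalso
      obtain ⟨ho, k, b, c1, c2, c3, c4, c5, c6, c7, c8⟩ := hx
      have e1 := c8 r hr h1 (by omega)
      obtain rfl : p' = k := by
        rcases lt_trichotomy p' k with h' | h' | h'
        · have := c8 p' hp'J (by omega) (by omega); omega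
        · exact h'
        · exact absurd c2 (hn k c5 h')
      omega
    · omega
  rcases key hpa' with hE | ⟨y, b, hy, hy1, hy2⟩
  · have hlt := hx.lt
    have haE : ¬ Y.E a := hx.not_E hY le_rfl hx.lt
    have hb := hY.E_sub _ hE
    have hxb := hx.1.2.2
    have hf := hY.frame a (by omega) (by omega) (by tauto)
    have hc : Y.Closes a := ⟨hE, haE, hf⟩
    have hra : a < r := by
      rcases eq_or_ne a r with rfl | h'
      · exact absurd (.inl hE) hut
      · omega
    obtain ⟨b, hb⟩ := hc.exists_extR hY
    refine ⟨x, a, by omega, hfx, r, hfx, .inr ⟨b, hb, hra, ?_⟩⟩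
    obtain ⟨-, a', l', d1, d2, d3, d4, d5, d6, d7, d8⟩ := hb
    by_contra hlt
    obtain ⟨ho, k, b', c1, c2, c3, c4, c5, c6, c7, c8⟩ := hx
    have := c8 l' d3 (by omega) (by omega)
    have := c8 b d4 (by omega) (by omega)
    have := c8 r hr (by omega) (by omega)
    omega
  · exact ⟨x, y, hne y b hy, hfx, a, .inl ⟨a, hx, le_rfl, hx.lt⟩, .inr ⟨b, hy, by omega, by omega⟩⟩

/-- Exactly four vertices of a segment of the extended row, the first two and the last two, are
neither active vertices nor overlap vertices. -/
theorem Valid.bad_run (hY : Y.Valid) {p q : ℤ} (h : IsRun Y.Ext p q) :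
    ∃ p' q', p < p' ∧ p' < q' ∧ q' < q ∧
      ∀ r, (r ∈ Y.J ∧ p ≤ r ∧ r ≤ q ∧ Y.Bad r) ↔ (r = p ∨ r = p' ∨ r = q' ∨ r = q) := by
  have hpJ := hY.left_mem_J h
  have hqJ := hY.right_mem_J h
  have hpq := h.1
  have hpb := hY.J_sub p hpJ
  have hqb := hY.J_sub q hqJ
  have hw := hY.width
  obtain ⟨p', p1, p2, p3⟩ := hY.exists_next (x := p) (by omega)
  obtain ⟨q', q1, q2, q3⟩ := hY.exists_prev (x := q) (by omega)
  have hlt : p' < q' := by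
    rcases hY.run_left' h with ⟨e1, -⟩ | ⟨k, x, b, ho, ⟨c1, c2, c3, c4, c5, c6, c7, c8⟩, hb⟩
    · have hp' : p' ≤ Y.L + 1 := by
        by_contra hlt
        exact p3 (Y.L + 1) (by omega) (by omega) hY.L1_mem
      rcases hY.run_right' h with ⟨e2, -⟩ | ⟨a, x, l, ho, ⟨c1, c2, c3, c4, c5, c6, c7, c8⟩, hb⟩
      · by_contra hlt
        exact q3 (Y.R - 1) (by omega) (by omega) hY.R1_mem
      · have e1 : l ≤ q' := by
          by_contra hlt
          exact q3 l (by omega) (by omega) c3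
        omega
    · have e1 : p' ≤ k := by
        by_contra hlt
        exact p3 k (by omega) (by omega) c2
      have e2 : x ≤ q' := by
        by_contra hlt
        exact q3 x (by omega) (by omega) c3
      omega
  refine ⟨p', q', p2, hlt, q2, fun r => ⟨?_, ?_⟩⟩
  · rintro ⟨hr, hr1, hr2, hb1, hb2⟩
    by_contra hne
    have n1 : r ≠ p := by omega
    have n2 : r ≠ q := by omega
    have e1 : p' < r := by
      rcases lt_trichotomy p' r with h' | h' | h'
      · exact h'
      · omega
      · exact absurd hr (p3 r (by omega) h')
    have e2 : r < q' := by
      rcases lt_trichotomy r q' with h' | h' | h'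
      · exact h'
      · omega
      · exact absurd hr (q3 r (by omega) (by omega))
    by_cases ht : Y.Touched r
    · exact hb1 ⟨ht, by omega, by omega⟩
    · have hu := not_or.1 ht
      have left : ∀ x a, Y.ExtL x a → a ≤ r → r < x → False := fun x a hx h1 h2 =>
        hb2 (hY.overlap_of_extL h p3 p1 p2 hr (by omega) (by omega) ht (by omega) hx h1 h2)
      have right : ∀ x b, Y.ExtR x b → x < r → r ≤ b → False := by
        intro x b hx h1 h2
        refine hb2 ?_
        have := hY.neg.overlap_of_extL (isRun_neg h) (p' := -q') (r := -r) (x := -x) (a := -b)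
          (fun m m1 m2 hm => q3 (-m) (by omega) (by omega) hm)
          (by rw [mem_neg_J, neg_neg]; exact q1) (by omega)
          (by rw [mem_neg_J, neg_neg]; exact hr) (by omega) (by omega)
          (by rw [touched_neg, neg_neg]; exact ht) (by omega)
          (by rw [extL_neg, neg_neg, neg_neg]; exact hx) (by omega) (by omega)
        rwa [overlap_neg, neg_neg] at this
      rcases h.2.1 r hr1 (by omega) with hE | ⟨x, a, hx, ha, hx'⟩ | ⟨x, b, hx, hx', hb⟩
      · exact hu.2 hE
      · exact left x a hx ha hx'
      · rcases eq_or_ne x r with rfl | hne'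
        · exact hu.1 hx.1.1
        · exact right x b hx (by omega) (by omega)
  · intro hr
    have hbad : Y.Bad r := by
      by_cases hr' : r = p ∨ r = p'
      · exact hY.bad_left h p2 p1 p3 hr'
      · have := hY.neg.bad_left (isRun_neg h) (p' := -q') (r := -r) (by omega)
          (by rw [mem_neg_J, neg_neg]; exact q1)
          (fun m m1 m2 hm => q3 (-m) (by omega) (by omega) hm) (by omega)
        rwa [bad_neg, neg_neg] at this
    refine ⟨?_, by omega, by omega, hbad⟩
    rcases hr with rfl | rfl | rfl | rfl <;> assumption

end Row

/-! ### Rows of an admissible T-mesh -/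

/-- A bounded set of edges is a union of runs. -/
theorem exists_isRun {F : ℤ → Prop} {L R i : ℤ} (hF : ∀ i, F i → L ≤ i ∧ i < R) (hi : F i) :
    ∃ p q, IsRun F p q ∧ p ≤ i ∧ i < q := by
  have hb := hF i hi
  obtain ⟨q, ⟨q1, q2⟩, qm⟩ := Int.exists_least_of_bdd (P := fun q => i < q ∧ ¬ F q)
    ⟨i, fun z hz => hz.1.le⟩ ⟨R, hb.2, fun h => by have := hF R h; omega⟩
  obtain ⟨p, ⟨p1, p2⟩, pm⟩ := Int.exists_greatest_of_bdd (P := fun p => p ≤ i ∧ ¬ F (p - 1))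
    ⟨i, fun z hz => hz.1⟩ ⟨L, hb.1, fun h => by have := hF _ h; omega⟩
  refine ⟨p, q, ⟨by omega, fun m h1 h2 => ?_, p2, q2⟩, p1, q1⟩
  by_contra hm
  rcases lt_trichotomy m i with h | rfl | h
  · have := pm (m + 1) ⟨by omega, by rwa [add_sub_cancel_right]⟩
    omega
  · exact hm hi
  · have := qm m ⟨h, hm⟩
    omega

theorem IsRun.eq_of_mem {F : ℤ → Prop} {p q p' q' x : ℤ} (h : IsRun F p q) (h' : IsRun F p' q')
    (h1 : p ≤ x) (h2 : x ≤ q) (h3 : p' ≤ x) (h4 : x ≤ q') : p = p' ∧ q = q' := by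
  obtain ⟨a1, a2, a3, a4⟩ := h
  obtain ⟨b1, b2, b3, b4⟩ := h'
  constructor
  · rcases lt_trichotomy p p' with h | h | h
    · exact absurd (a2 (p' - 1) (by omega) (by omega)) b3
    · exact h
    · exact absurd (b2 (p - 1) (by omega) (by omega)) a3
  · rcases lt_trichotomy q q' with h | h | h
    · exact absurd (b2 q (by omega) (by omega)) a4
    · exact h
    · exact absurd (a2 q' (by omega) (by omega)) b4

namespace RectMesh

variable {X T : RectMesh}

/-- The row with index `j` of a mesh. -/
def row (T : RectMesh) (j : ℤ) : Row := ⟨T.left, T.right, T.hJ j, fun i => T.HUnit i j⟩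

theorem IsAdmissible.swap (hT : T.IsTMesh) (h : T.IsAdmissible) : T.swap.IsAdmissible where
  width := h.height
  height := h.width
  columns k h1 h2 := by
    have := h.rows k h1 h2
    exact ⟨hFree_swap (X := T.swap) |>.1 this.1, hFree_swap (X := T.swap) |>.1 this.2⟩
  rows k h1 h2 := by
    have := h.columns k h1 h2
    exact ⟨hFree_swap.2 this.1, hFree_swap.2 this.2⟩
  frame p hp h1 h2 h3 h4 hv := by
    rw [inAR_swap]
    refine h.frame p.swap (hT.mem_vertices_swap.1 hp) h3 h4 h1 h2 ?_
    have e1 := hT.swap.missLeft_swap (p := p.swap)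
    have e2 := hT.swap.missRight_swap (p := p.swap)
    rw [Prod.swap_swap] at e1 e2
    unfold IsValenceThree at hv
    rw [hT.missLeft_swap, hT.missRight_swap, ← e1, ← e2] at hv
    change _ ∨ _ ∨ T.MissLeft p.swap ∨ T.MissRight p.swap at hv
    unfold IsValenceThree
    tauto
  joinV Q hQ p hp q hq h1 h2 h3 h4 :=
    (hFree_swap (X := T.swap)).1 (h.joinH Q.swap hQ p.swap (hT.mem_vertices_swap.1 hp) q.swap
      (hT.mem_vertices_swap.1 hq)
      ⟨⟨h1.1.2.2.1, h1.1.2.2.2, h1.1.1, h1.1.2.1⟩, by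
        have := h1.2; unfold IntRect.swap; simp only [Prod.fst_swap, Prod.snd_swap]; tauto⟩
      ⟨⟨h2.1.2.2.1, h2.1.2.2.2, h2.1.1, h2.1.2.1⟩, by
        have := h2.2; unfold IntRect.swap; simp only [Prod.fst_swap, Prod.snd_swap]; tauto⟩ h3 h4)
  joinH Q hQ p hp q hq h1 h2 h3 h4 :=
    hFree_swap.2 (h.joinV Q.swap hQ p.swap (hT.mem_vertices_swap.1 hp) q.swap
      (hT.mem_vertices_swap.1 hq)
      ⟨⟨h1.1.2.2.1, h1.1.2.2.2, h1.1.1, h1.1.2.1⟩, by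
        have := h1.2; unfold IntRect.swap; simp only [Prod.fst_swap, Prod.snd_swap]; tauto⟩
      ⟨⟨h2.1.2.2.1, h2.1.2.2.2, h2.1.1, h2.1.2.1⟩, by
        have := h2.2; unfold IntRect.swap; simp only [Prod.fst_swap, Prod.snd_swap]; tauto⟩ h3 h4)

/-- The four outermost columns on each side belong entirely to the skeleton. -/
theorem IsAdmissible.vUnit (hT : T.IsTMesh) (h : T.IsAdmissible) {k j : ℤ} (h1 : 0 ≤ k) (h2 : k ≤ 3)
    (h3 : T.bottom ≤ j) (h4 : j < T.top) : T.VUnit (T.left + k) j ∧ T.VUnit (T.right - k) j := by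
  obtain ⟨c1, c2⟩ := h.columns k h1 h2
  have hw := h.width
  exact ⟨(vFree_iff le_rfl le_rfl (by omega) (by omega) hT.2.1).1 c1 j h3 h4,
    (vFree_iff le_rfl le_rfl (by omega) (by omega) hT.2.1).1 c2 j h3 h4⟩

theorem IsAdmissible.hUnit (hT : T.IsTMesh) (h : T.IsAdmissible) {k i : ℤ} (h1 : 0 ≤ k) (h2 : k ≤ 3)
    (h3 : T.left ≤ i) (h4 : i < T.right) : T.HUnit i (T.bottom + k) ∧ T.HUnit i (T.top - k) := by
  have := (h.swap hT).vUnit hT.swap h1 h2 h3 h4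
  simp only [vUnit_swap] at this
  exact this

theorem IsTMesh.row_touched (hT : T.IsTMesh) {i j : ℤ} :
    (T.row j).Touched i ↔ (i, j) ∈ T.hSkel := hT.mem_hSkel.symm

/-- The rows through the active region satisfy the axioms. -/
theorem IsAdmissible.row_valid (hT : T.IsTMesh) (h : T.IsAdmissible) {j : ℤ} (hj : T.bottom + 2 ≤ j)
    (hj' : j ≤ T.top - 2) : (T.row j).Valid where
  width := h.width
  J_sub x hx := by have := hT.hJ_box hx; exact ⟨this.1, this.2.1⟩
  L_mem := hT.mem_hJ.2 (.inr (hT.vUnit_left_right (by omega) (by omega)).1)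
  L1_mem := hT.mem_hJ.2
    (.inr (h.vUnit hT (k := 1) (by omega) (by omega) (by omega) (by omega)).1)
  R_mem := hT.mem_hJ.2 (.inr (hT.vUnit_left_right (by omega) (by omega)).2)
  R1_mem := hT.mem_hJ.2
    (.inr (h.vUnit hT (k := 1) (by omega) (by omega) (by omega) (by omega)).2)
  E_sub i hi := ⟨hi.1, hi.2.1⟩
  hom x hx := by
    have hx' : ¬ (T.VUnit x (j - 1) ∨ T.VUnit x j) := fun hh => hx (hT.mem_hJ.2 hh)
    constructor <;> intro hE <;> by_contra hE'
    · rcases lt_or_ge x T.right with hlt | hge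
      · exact hx' (.inr (hT.vUnit_of_hUnit_left hlt (by omega) (by omega) hE hE').1)
      · have := hE.2.1
        obtain rfl : x = T.right := by omega
        exact hx' (.inr (hT.vUnit_left_right (by omega) (by omega)).2)
    · rcases lt_or_ge T.left x with hlt | hge
      · exact hx' (.inr (hT.vUnit_of_hUnit_right hlt (by omega) (by omega) hE hE').1)
      · have := hE.1
        obtain rfl : x = T.left := by omega
        exact hx' (.inr (hT.vUnit_left_right (by omega) (by omega)).1)
  frame x h1 h2 hne := by
    change T.left < x at h1
    change x < T.right at h2
    change ¬ (T.HUnit (x - 1) j ↔ T.HUnit x j) at hne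
    suffices hs : T.InAR (x, j) from ⟨hs.1, hs.2.1⟩
    by_cases hE : T.HUnit x j
    · have hE' : ¬ T.HUnit (x - 1) j := by tauto
      obtain ⟨v1, v2⟩ := hT.vUnit_of_hUnit_right h1 (by omega) (by omega) hE hE'
      have hv : (x, j) ∈ T.vertices := hT.mem_vertices.2 ⟨.inr hE, .inr v1⟩
      refine h.frame _ hv h1 h2 (by simp only; omega) (by simp only; omega) (.inl ?_)
      unfold MissLeft
      rw [hT.hasRight_iff, hT.hasUp_iff, hT.hasDown_iff, hT.hasLeft_iff]
      tauto
    · have hE' : T.HUnit (x - 1) j := by tauto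
      obtain ⟨v1, v2⟩ := hT.vUnit_of_hUnit_left h2 (by omega) (by omega) hE' hE
      have hv : (x, j) ∈ T.vertices := hT.mem_vertices.2 ⟨.inl hE', .inr v1⟩
      refine h.frame _ hv h1 h2 (by simp only; omega) (by simp only; omega) (.inr (.inl ?_))
      unfold MissRight
      rw [hT.hasRight_iff, hT.hasUp_iff, hT.hasDown_iff, hT.hasLeft_iff]
      tauto
  gap k hk l hl hkl hn h1 h2 := by
    change k ∈ T.hJ j at hk
    change l ∈ T.hJ j at hl
    change ∀ x, k < x → x < l → x ∉ T.hJ j at hn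
    have bk := hT.hJ_box hk
    have bl := hT.hJ_box hl
    by_contra hE
    change ¬ T.HUnit k j at hE
    obtain ⟨Q, hQ, q1, q2⟩ := (not_hUnit_iff (by omega) (by omega) (by omega) (by omega)).1 hE
    unfold IntRect.HasCell at q1 q2
    have hbQ := hT.2.2.1 Q hQ
    have m1 := fun hh hh' =>
      hT.not_mem_hJ_of_face hQ (i := k) (j := j) hh hh' (by omega) (by omega) hk
    have m2 := fun hh hh' =>
      hT.not_mem_hJ_of_face hQ (i := l) (j := j) hh hh' (by omega) (by omega) hl
    have m3 : Q.right ∈ T.hJ j :=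
      hT.mem_hJ.2 (.inr (hT.vUnit_side hQ (j := j) (by omega) (by omega)).2)
    have m4 := fun hh hh' => hn _ hh hh' m3
    have v1 : (k, j) ∈ T.vertices := hT.mem_vertices_iff_skel.2 ⟨hT.row_touched.1 h1, hk⟩
    have v2 : (l, j) ∈ T.vertices := hT.mem_vertices_iff_skel.2 ⟨hT.row_touched.1 h2, hl⟩
    have e1 : Q.left = k := by by_contra hne; exact m1 (by omega) (by omega)
    have e2 : Q.right = l := by
      rcases lt_trichotomy Q.right l with hh | hh | hh
      · exact absurd hh (fun hh => m4 (by omega) hh)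
      · exact hh
      · exact absurd hh (fun hh => m2 (by omega) hh)
    refine h.joinH Q hQ _ v1 _ v2 ⟨?_, .inl e1.symm⟩ ⟨?_, .inr (.inl e2.symm)⟩ rfl hkl Q hQ ?_
    · simp only; omega
    · simp only; omega
    · unfold IntRect.MeetsH; simp only; omega

theorem IsTMesh.row_opens (hT : T.IsTMesh) {i j : ℤ}
    (hj : T.bottom + 2 ≤ j) (hj' : j ≤ T.top - 2) :
    (T.row j).Opens i ↔ T.MissLeft (i, j) ∧ T.InAR (i, j) := by
  unfold MissLeft
  rw [hT.hasRight_iff, hT.hasUp_iff, hT.hasDown_iff, hT.hasLeft_iff]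
  unfold InAR Row.Opens
  change T.HUnit i j ∧ ¬ T.HUnit (i - 1) j ∧ T.left + 2 ≤ i ∧ i ≤ T.right - 2 ↔ _
  simp only
  constructor
  · rintro ⟨h1, h2, h3, h4⟩
    obtain ⟨v1, v2⟩ := hT.vUnit_of_hUnit_right (by omega) (by omega) (by omega) h1 h2
    have hv : (i, j) ∈ T.vertices := hT.mem_vertices.2 ⟨.inr h1, .inr v1⟩
    tauto
  · tauto

theorem IsTMesh.row_closes (hT : T.IsTMesh) {i j : ℤ}
    (hj : T.bottom + 2 ≤ j) (hj' : j ≤ T.top - 2) :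
    (T.row j).Closes i ↔ T.MissRight (i, j) ∧ T.InAR (i, j) := by
  unfold MissRight
  rw [hT.hasRight_iff, hT.hasUp_iff, hT.hasDown_iff, hT.hasLeft_iff]
  unfold InAR Row.Closes
  change T.HUnit (i - 1) j ∧ ¬ T.HUnit i j ∧ T.left + 2 ≤ i ∧ i ≤ T.right - 2 ↔ _
  simp only
  constructor
  · rintro ⟨h1, h2, h3, h4⟩
    obtain ⟨v1, v2⟩ := hT.vUnit_of_hUnit_left (by omega) (by omega) (by omega) h1 h2
    have hv : (i, j) ∈ T.vertices := hT.mem_vertices.2 ⟨.inl h1, .inr v1⟩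
    tauto
  · tauto

theorem IsTMesh.hExt_iff (hT : T.IsTMesh) {v : ℤ × ℤ} {a b : ℤ} :
    T.HExt v a b ↔ (T.bottom + 2 ≤ v.2 ∧ v.2 ≤ T.top - 2) ∧
      ((∃ k, (T.row v.2).Opens v.1 ∧ Consecutive4 (T.row v.2).J a k v.1 b) ∨
        ∃ l, (T.row v.2).Closes v.1 ∧ Consecutive4 (T.row v.2).J a v.1 l b) := by
  constructor
  · rintro ⟨har, k, l, hc, hm⟩
    refine ⟨har.2.2, ?_⟩
    rw [hT.row_opens har.2.2.1 har.2.2.2, hT.row_closes har.2.2.1 har.2.2.2]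
    rcases hm with ⟨hm, rfl⟩ | ⟨hm, rfl⟩
    · exact .inl ⟨k, ⟨hm, har⟩, hc⟩
    · exact .inr ⟨l, ⟨hm, har⟩, hc⟩
  · rintro ⟨⟨h1, h2⟩, hh⟩
    rw [hT.row_opens h1 h2, hT.row_closes h1 h2] at hh
    rcases hh with ⟨k, ⟨hm, har⟩, hc⟩ | ⟨l, ⟨hm, har⟩, hc⟩
    · exact ⟨har, k, v.1, hc, .inl ⟨hm, rfl⟩⟩
    · exact ⟨har, v.1, l, hc, .inr ⟨hm, rfl⟩⟩

theorem IsAdmissible.row_ext (hT : T.IsTMesh) (h : T.IsAdmissible) {i j : ℤ}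
    (hj : T.bottom + 2 ≤ j) (hj' : j ≤ T.top - 2) :
    (T.row j).Ext i ↔ T.extended.HUnit i j := by
  have hV := h.row_valid hT hj hj'
  rw [hT.hUnit_extended]
  constructor
  · rintro (hE | ⟨x, a, ⟨ho, k, b, hc⟩, h1, h2⟩ | ⟨x, b, ⟨ho, k, l, hc⟩, h1, h2⟩)
    · exact .inl hE
    · refine .inr ⟨(x, j), a, b, (hT.hExt_iff).2 ⟨⟨hj, hj'⟩, .inl ⟨k, ho, hc⟩⟩, rfl, h1, ?_⟩
      exact h2.trans hc.2.2.2.2.2.2.1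
    · refine .inr ⟨(x, j), k, b, (hT.hExt_iff).2 ⟨⟨hj, hj'⟩, .inr ⟨l, ho, hc⟩⟩, rfl, ?_, h2⟩
      exact hc.2.2.2.2.1.le.trans h1
  · rintro (hE | ⟨v, a, b, hv, rfl, h1, h2⟩)
    · exact .inl hE
    · obtain ⟨-, ⟨k, ho, hc⟩ | ⟨l, ho, hc⟩⟩ := (hT.hExt_iff).1 hv
      · exact Row.ExtL.ext_of_mem hV ho hc h1 h2
      · exact Row.ExtR.ext_of_mem hV ho hc h1 h2

theorem IsTMesh.onHFace_iff (hT : T.IsTMesh) {v p : ℤ × ℤ} :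
    T.OnHFace v p ↔ p.2 = v.2 ∧ (T.bottom + 2 ≤ v.2 ∧ v.2 ≤ T.top - 2) ∧
      (T.row v.2).Face v.1 p.1 := by
  unfold OnHFace
  refine and_congr_right fun _ => ?_
  constructor
  · rintro ⟨a, b, ⟨har, k, l, hc, hh⟩, hm⟩
    refine ⟨har.2.2, ?_⟩
    have n1 : T.MissLeft v → ¬ T.MissRight v := fun h1 h2 => h2.2.2.2 h1.1
    rcases hh with ⟨hh, rfl⟩ | ⟨hh, rfl⟩
    · rcases hm with ⟨-, h1, h2⟩ | ⟨hm, -⟩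
      · exact .inl ⟨a, ⟨(hT.row_opens har.2.2.1 har.2.2.2).2 ⟨hh, har⟩, k, b, hc⟩, h1, h2⟩
      · exact absurd hm (n1 hh)
    · rcases hm with ⟨hm, -⟩ | ⟨-, h1, h2⟩
      · exact absurd hh (n1 hm)
      · exact .inr ⟨b, ⟨(hT.row_closes har.2.2.1 har.2.2.2).2 ⟨hh, har⟩, a, l, hc⟩, h1, h2⟩
  · rintro ⟨⟨h1, h2⟩, ⟨a, ⟨ho, k, b, hc⟩, h3, h4⟩ | ⟨b, ⟨ho, a, l, hc⟩, h3, h4⟩⟩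
    · exact ⟨a, b, (hT.hExt_iff).2 ⟨⟨h1, h2⟩, .inl ⟨k, ho, hc⟩⟩,
        .inl ⟨((hT.row_opens h1 h2).1 ho).1, h3, h4⟩⟩
    · exact ⟨a, b, (hT.hExt_iff).2 ⟨⟨h1, h2⟩, .inr ⟨l, ho, hc⟩⟩,
        .inr ⟨((hT.row_closes h1 h2).1 ho).1, h3, h4⟩⟩

/-- Only rows through the active region carry extensions. -/
theorem IsTMesh.inner_of_ext (hT : T.IsTMesh) {i j : ℤ} (h1 : T.extended.HUnit i j)
    (h2 : ¬ T.HUnit i j) : T.bottom + 2 ≤ j ∧ j ≤ T.top - 2 := by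
  rcases hT.hUnit_extended.1 h1 with h | ⟨v, a, b, hv, rfl, -⟩
  · exact absurd h h2
  · exact hv.1.2.2

theorem IsTMesh.hUnit_extended_of (hT : T.IsTMesh) {i j : ℤ} (h : T.HUnit i j) :
    T.extended.HUnit i j := hT.hUnit_extended.2 (.inl h)

theorem IsTMesh.vUnit_extended_of (hT : T.IsTMesh) {i j : ℤ} (h : T.VUnit i j) :
    T.extended.VUnit i j := hT.vUnit_extended.2 (.inl h)

theorem IsTMesh.vertices_extended_of (hT : T.IsTMesh) {p : ℤ × ℤ} (h : p ∈ T.vertices) :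
    p ∈ T.extended.vertices := by
  obtain ⟨i, j⟩ := p
  rw [hT.mem_vertices] at h
  rw [hT.extended.mem_vertices]
  exact ⟨h.1.imp hT.hUnit_extended_of hT.hUnit_extended_of,
    h.2.imp hT.vUnit_extended_of hT.vUnit_extended_of⟩

/-! ### Segments as runs of unit edges -/

/-- The horizontal segments are the maximal runs of horizontal unit edges. -/
theorem IsTMesh.isHSegment_iff (hX : X.IsTMesh) {p q : ℤ × ℤ} :
    (p ∈ X.vertices ∧ q ∈ X.vertices ∧ X.IsHSegment p q) ↔
      p.2 = q.2 ∧ IsRun (fun i => X.HUnit i p.2) p.1 q.1 := by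
  constructor
  · rintro ⟨hp, hq, h1, h2, h3, h4, h5⟩
    have b1 := mem_box_of_mem_vertices hp
    have b2 := mem_box_of_mem_vertices hq
    refine ⟨h1, h2, (hFree_iff b1.1 b2.2.1 b1.2.2.1 b1.2.2.2 h2).1 h3, fun h => ?_, fun h => ?_⟩
    · exact h4 (hX.hasLeft_iff.2 ⟨hp, h⟩)
    · exact h5 (hX.hasRight_iff.2 ⟨hq, h1 ▸ h⟩)
  · rintro ⟨h1, h2, h3, h4, h5⟩
    have u1 := h3 p.1 le_rfl h2
    have u2 := h3 (q.1 - 1) (by omega) (by omega)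
    have hp : p ∈ X.vertices := by
      obtain ⟨k, k1, k2, k3, -⟩ := hX.exists_prev u1
      rcases eq_or_ne k p.1 with rfl | hne
      · exact k2
      · exact absurd (k3 (p.1 - 1) (by omega) (by omega)) h4
    have hq : q ∈ X.vertices := by
      obtain ⟨k, k1, k2, k3, -⟩ := hX.exists_next u2
      rcases eq_or_ne k q.1 with rfl | hne
      · rw [h1] at k2; exact k2
      · exact absurd (k3 q.1 (by omega) (by omega)) h5
    refine ⟨hp, hq, h1, h2,
      (hFree_iff u1.1 (by have := u2.2.1; omega) u1.2.2.1 u1.2.2.2.1 h2).2 h3, fun h => ?_,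
      fun h => ?_⟩
    · exact h4 (hX.hasLeft_iff.1 h).2
    · exact h5 (h1 ▸ (hX.hasRight_iff.1 h).2)

end RectMesh

/-! ### Counting the vertices of the simplified extended T-mesh -/

namespace Row

variable {Y : Row}

theorem Face.not_E (hY : Y.Valid) {x p : ℤ} (h : Y.Face x p) : ¬ (Y.E (p - 1) ∧ Y.E p) := by
  rintro ⟨e1, e2⟩
  rcases h with ⟨a, ha, h1, h2⟩ | ⟨b, hb, h1, h2⟩
  · exact ha.not_E hY h1 h2 e2
  · have ha : Y.neg.ExtL (-x) (-b) := by rw [extL_neg, neg_neg, neg_neg]; exact hb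
    refine ha.not_E hY.neg (i := -p) (by omega) (by omega) ?_
    rw [neg_E, neg_neg]; exact e1

theorem Face.ext {x p : ℤ} (h : Y.Face x p) : Y.Ext (p - 1) ∨ Y.Ext p := by
  rcases h with ⟨a, ha, h1, h2⟩ | ⟨b, hb, h1, h2⟩
  · exact .inr (.inr (.inl ⟨x, a, ha, h1, h2⟩))
  · exact .inl (.inr (.inr ⟨x, b, hb, by omega, by omega⟩))

theorem exists_face {p : ℤ} (h : Y.Ext (p - 1) ∨ Y.Ext p) (hn : ¬ Y.Touched p) :
    ∃ x, Y.Face x p := by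
  obtain ⟨n1, n2⟩ := not_or.1 hn
  rcases h with (h | ⟨x, a, hx, h1, h2⟩ | ⟨x, b, hx, h1, h2⟩) |
    (h | ⟨x, a, hx, h1, h2⟩ | ⟨x, b, hx, h1, h2⟩)
  · exact absurd h n1
  · rcases eq_or_ne x p with rfl | hne
    · exact absurd hx.1.1 n2
    · exact ⟨x, .inl ⟨a, hx, by omega, by omega⟩⟩
  · exact ⟨x, .inr ⟨b, hx, by omega, by omega⟩⟩
  · exact absurd h n2
  · exact ⟨x, .inl ⟨a, hx, h1, h2⟩⟩
  · rcases eq_or_ne x p with rfl | hne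
    · exact absurd hx.1.1 n1
    · exact ⟨x, .inr ⟨b, hx, by omega, by omega⟩⟩

end Row

namespace RectMesh

variable {X T : RectMesh}

open scoped Classical in
/-- The horizontal segments of the simplified extended T-mesh. -/
noncomputable def hSegs (T : RectMesh) : Finset ((ℤ × ℤ) × (ℤ × ℤ)) :=
  T.reducedSegments.filter fun s => s.1.2 = s.2.2

open scoped Classical in
/-- The vertices of the extended T-mesh that lie on the vertical skeleton of `T` in a row through
the active region and are neither active nor overlap vertices. There are four on each horizontal
segment of the simplified extended T-mesh. -/
noncomputable def badVertices (T : RectMesh) : Finset (ℤ × ℤ) :=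
  T.extended.vertices.filter fun v => T.bottom + 2 ≤ v.2 ∧ v.2 ≤ T.top - 2 ∧
    v.1 ∈ T.hJ v.2 ∧ (T.row v.2).Bad v.1

theorem mem_segments {s : (ℤ × ℤ) × (ℤ × ℤ)} : s ∈ X.segments ↔
    (s.1 ∈ X.vertices ∧ s.2 ∈ X.vertices) ∧ (X.IsHSegment s.1 s.2 ∨ X.IsVSegment s.1 s.2) := by
  classical
  simp only [segments, Finset.mem_filter, Finset.mem_product]

theorem mem_reducedSegments {s : (ℤ × ℤ) × (ℤ × ℤ)} : s ∈ T.reducedSegments ↔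
    s ∈ T.extended.segments ∧
    ¬ (s.1.2 = s.2.2 ∧ T.IsOuterRow s.1.2) ∧ ¬ (s.1.1 = s.2.1 ∧ T.IsOuterColumn s.1.1) := by
  classical
  simp only [reducedSegments, Finset.mem_filter]

theorem mem_reducedVertices {v : ℤ × ℤ} : v ∈ T.reducedVertices ↔
    v ∈ T.extended.vertices ∧ ¬ (T.IsOuterColumn v.1 ∧ T.IsOuterRow v.2) := by
  classical
  simp only [reducedVertices, Finset.mem_filter]

theorem IsTMesh.mem_hSegs (hT : T.IsTMesh) {s : (ℤ × ℤ) × (ℤ × ℤ)} : s ∈ T.hSegs ↔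
    s.1.2 = s.2.2 ∧ (T.bottom + 2 ≤ s.1.2 ∧ s.1.2 ≤ T.top - 2) ∧
      IsRun (fun i => T.extended.HUnit i s.1.2) s.1.1 s.2.1 := by
  classical
  simp only [hSegs, Finset.mem_filter, mem_reducedSegments, mem_segments]
  constructor
  · rintro ⟨⟨⟨⟨h1, h2⟩, h3⟩, h4, -⟩, h5⟩
    have hH : T.extended.IsHSegment s.1 s.2 := h3.resolve_right fun h => by have := h.2.1; omega
    have hb := mem_box_of_mem_vertices h1
    change T.left ≤ _ ∧ _ ≤ T.right ∧ T.bottom ≤ _ ∧ _ ≤ T.top at hb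
    refine ⟨h5, ?_, (hT.extended.isHSegment_iff.1 ⟨h1, h2, hH⟩).2⟩
    unfold IsOuterRow at h4
    omega
  · rintro ⟨h1, h2, h3⟩
    obtain ⟨v1, v2, hH⟩ := hT.extended.isHSegment_iff.2 ⟨h1, h3⟩
    refine ⟨⟨⟨⟨v1, v2⟩, .inl hH⟩, ?_, ?_⟩, h1⟩
    · unfold IsOuterRow; omega
    · have := hH.2.1; omega

theorem IsTMesh.mem_badVertices (hT : T.IsTMesh) {i j : ℤ} : (i, j) ∈ T.badVertices ↔
    (T.bottom + 2 ≤ j ∧ j ≤ T.top - 2) ∧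
      (T.extended.HUnit (i - 1) j ∨ T.extended.HUnit i j) ∧ i ∈ T.hJ j ∧ (T.row j).Bad i := by
  classical
  simp only [badVertices, Finset.mem_filter, hT.extended.mem_vertices]
  constructor
  · tauto
  · rintro ⟨⟨h1, h2⟩, h3, h4, h5⟩
    exact ⟨⟨h3, hT.extended.mem_hJ.1 (hT.hJ_extended h4)⟩, h1, h2, h4, h5⟩

/-- Every horizontal segment of the simplified extended T-mesh carries four bad vertices. -/
theorem IsAdmissible.card_badVertices (hT : T.IsTMesh) (h : T.IsAdmissible) :
    T.badVertices.card = 4 * T.hSegs.card := by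
  classical
  have := Finset.card_mul_eq_card_mul (s := T.badVertices) (t := T.hSegs) (m := 1) (n := 4)
    (fun v s => OnSegment s v) ?_ ?_
  · omega
  · rintro ⟨i, j⟩ hv
    obtain ⟨⟨hj, hj'⟩, hE, -, -⟩ := hT.mem_badVertices.1 hv
    obtain ⟨m, hm, hmi⟩ : ∃ m, T.extended.HUnit m j ∧ (m = i - 1 ∨ m = i) := by
      rcases hE with hE | hE
      exacts [⟨_, hE, .inl rfl⟩, ⟨_, hE, .inr rfl⟩]
    obtain ⟨p, q, hr, h1, h2⟩ := exists_isRun (F := fun i => T.extended.HUnit i j)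
      (fun i hi => ⟨hi.1, hi.2.1⟩) hm
    rw [Finset.card_eq_one]
    refine ⟨((p, j), (q, j)), ?_⟩
    ext s
    simp only [Finset.mem_bipartiteAbove, Finset.mem_singleton, hT.mem_hSegs]
    constructor
    · rintro ⟨⟨s1, s2, s3⟩, o1, o2, o3, o4⟩
      obtain ⟨⟨a, c⟩, ⟨b, d⟩⟩ := s
      simp only at *
      obtain rfl : c = j := by omega
      subst s1
      obtain ⟨rfl, rfl⟩ := s3.eq_of_mem hr o1 o2 (by omega) (by omega)
      rfl
    · rintro rfl
      exact ⟨⟨rfl, ⟨hj, hj'⟩, hr⟩, by unfold OnSegment; simp only; omega⟩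
  · rintro ⟨⟨p, j⟩, ⟨q, j'⟩⟩ hs
    obtain ⟨h1, h2, h3⟩ := hT.mem_hSegs.1 hs
    simp only at h1 h2 h3
    subst h1
    have hV := h.row_valid hT h2.1 h2.2
    have hrun : IsRun (T.row j).Ext p q := by
      convert h3 using 1
      funext i
      exact propext (h.row_ext hT h2.1 h2.2)
    obtain ⟨p', q', c1, c2, c3, hb⟩ := hV.bad_run hrun
    have : Finset.bipartiteBelow (fun v s => OnSegment s v) T.badVertices ((p, j), (q, j)) =
        ({p, p', q', q} : Finset ℤ).image fun r => (r, j) := by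
      ext ⟨r, j'⟩
      simp only [Finset.mem_bipartiteBelow, Finset.mem_image, Finset.mem_insert,
        Finset.mem_singleton, ← hb, Prod.mk.injEq]
      constructor
      · rintro ⟨hv, o1, o2, o3, o4⟩
        simp only at o1 o2 o3 o4
        obtain rfl : j = j' := by omega
        obtain ⟨-, -, b1, b2⟩ := hT.mem_badVertices.1 hv
        exact ⟨r, ⟨b1, o1, o2, b2⟩, rfl, rfl⟩
      · rintro ⟨r', ⟨b1, o1, o2, b2⟩, rfl, rfl⟩
        refine ⟨hT.mem_badVertices.2 ⟨h2, ?_, b1, b2⟩, by unfold OnSegment; simp only; omega⟩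
        rcases eq_or_ne r' q with rfl | hne
        · exact .inl (h3.2.1 _ (by omega) (by omega))
        · exact .inr (h3.2.1 _ (by omega) (by omega))
    rw [this, Finset.card_image_of_injective _ fun a b hab => by simpa using hab]
    rw [Finset.card_insert_of_notMem, Finset.card_insert_of_notMem, Finset.card_pair] <;>
    first
      | omega
      | simp only [Finset.mem_insert, Finset.mem_singleton]; omega

/-! The vertical counterparts, by transposition. -/

/-- The transpose of a segment. -/
def segSwap (s : (ℤ × ℤ) × (ℤ × ℤ)) : (ℤ × ℤ) × (ℤ × ℤ) := (s.1.swap, s.2.swap)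

theorem IsTMesh.isHSegment_swap (hX : X.IsTMesh) {p q : ℤ × ℤ} :
    X.swap.IsHSegment p q ↔ X.IsVSegment p.swap q.swap := by
  unfold IsHSegment IsVSegment
  rw [hFree_swap, hX.hasLeft_swap, hX.hasRight_swap]
  rfl

theorem IsTMesh.isVSegment_swap (hX : X.IsTMesh) {p q : ℤ × ℤ} :
    X.swap.IsVSegment p q ↔ X.IsHSegment p.swap q.swap := by
  have := hX.swap.isHSegment_swap (p := p.swap) (q := q.swap)
  rw [Prod.swap_swap, Prod.swap_swap] at this
  exact this.symm

theorem IsTMesh.mem_segments_swap (hX : X.IsTMesh) {s : (ℤ × ℤ) × (ℤ × ℤ)} :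
    s ∈ X.swap.segments ↔ segSwap s ∈ X.segments := by
  obtain ⟨⟨a, b⟩, ⟨c, d⟩⟩ := s
  simp only [mem_segments, hX.isHSegment_swap, hX.isVSegment_swap, hX.mem_vertices_swap, segSwap]
  rw [or_comm]
  rfl

theorem IsTMesh.mem_reducedSegments_swap (hT : T.IsTMesh) {s : (ℤ × ℤ) × (ℤ × ℤ)} :
    s ∈ T.swap.reducedSegments ↔ segSwap s ∈ T.reducedSegments := by
  rw [mem_reducedSegments, mem_reducedSegments, hT.extended_swap, hT.extended.mem_segments_swap]
  refine and_congr_right fun _ => ?_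
  rw [and_comm]
  rfl

theorem IsTMesh.mem_reducedVertices_swap (hT : T.IsTMesh) {i j : ℤ} :
    (i, j) ∈ T.swap.reducedVertices ↔ (j, i) ∈ T.reducedVertices := by
  rw [mem_reducedVertices, mem_reducedVertices, hT.extended_swap, hT.extended.mem_vertices_swap]
  refine and_congr_right fun _ => ?_
  rw [and_comm]
  rfl

theorem IsTMesh.mem_reducedSegments_iff (hT : T.IsTMesh) {s : (ℤ × ℤ) × (ℤ × ℤ)} :
    s ∈ T.reducedSegments ↔ s ∈ T.hSegs ∨ segSwap s ∈ T.swap.hSegs := by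
  classical
  simp only [hSegs, Finset.mem_filter, hT.mem_reducedSegments_swap]
  change _ ↔ _ ∨ (s ∈ T.reducedSegments ∧ s.1.1 = s.2.1)
  constructor
  · intro hs
    rcases (mem_segments.1 (mem_reducedSegments.1 hs).1).2 with h | h
    · exact .inl ⟨hs, h.1⟩
    · exact .inr ⟨hs, h.1⟩
  · tauto

theorem IsTMesh.not_both_segs (hT : T.IsTMesh) {s : (ℤ × ℤ) × (ℤ × ℤ)} (h : s ∈ T.hSegs)
    (h' : segSwap s ∈ T.swap.hSegs) : False := by
  have h1 := (hT.mem_hSegs.1 h).2.2.1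
  have h2 := (hT.swap.mem_hSegs.1 h').1
  change s.1.1 = s.2.1 at h2
  omega

theorem IsTMesh.card_reducedSegments (hT : T.IsTMesh) :
    T.reducedSegments.card = T.hSegs.card + T.swap.hSegs.card := by
  classical
  have hinj : Function.Injective segSwap := fun s t hst => by
    have := congrArg segSwap hst
    simpa only [segSwap, Prod.swap_swap] using this
  have : T.reducedSegments = T.hSegs ∪ T.swap.hSegs.image segSwap := by
    ext s
    rw [hT.mem_reducedSegments_iff, Finset.mem_union, Finset.mem_image]
    refine or_congr_right ⟨fun h => ⟨_, h, rfl⟩, ?_⟩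
    rintro ⟨t, ht, rfl⟩
    exact ht
  rw [this, Finset.card_union_of_disjoint, Finset.card_image_of_injective _ hinj]
  rw [Finset.disjoint_left]
  intro s hs hs'
  obtain ⟨t, ht, rfl⟩ := Finset.mem_image.1 hs'
  exact hT.not_both_segs hs ht

/-! #### Classification of the vertices -/

theorem mem_activeVertices {v : ℤ × ℤ} :
    v ∈ T.activeVertices ↔ v ∈ T.vertices ∧ T.InAR v := by
  classical
  simp only [activeVertices, Finset.mem_filter]

theorem mem_box {v : ℤ × ℤ} : v ∈ T.box ↔
    (T.left ≤ v.1 ∧ v.1 ≤ T.right) ∧ T.bottom ≤ v.2 ∧ v.2 ≤ T.top := by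
  simp only [box, Finset.mem_product, Finset.mem_Icc]

theorem mem_box_of_mem_extended {v : ℤ × ℤ} (h : v ∈ T.extended.vertices) : v ∈ T.box := by
  have := mem_box_of_mem_vertices h
  change T.left ≤ _ ∧ _ ≤ T.right ∧ T.bottom ≤ _ ∧ _ ≤ T.top at this
  rw [mem_box]
  tauto

/-- A vertex of the extended mesh off the horizontal skeleton is on a horizontal face
extension. -/
theorem IsAdmissible.exists_onHFace (hT : T.IsTMesh) (h : T.IsAdmissible) {v : ℤ × ℤ}
    (hv : v ∈ T.extended.vertices) (hn : v ∉ T.hSkel) :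
    (T.bottom + 2 ≤ v.2 ∧ v.2 ≤ T.top - 2) ∧ ∃ w, T.OnHFace w v := by
  obtain ⟨i, j⟩ := v
  rw [hT.mem_hSkel, not_or] at hn
  have hE := (hT.extended.mem_vertices.1 hv).1
  have hj : T.bottom + 2 ≤ j ∧ j ≤ T.top - 2 := by
    rcases hE with hE | hE
    exacts [hT.inner_of_ext hE hn.1, hT.inner_of_ext hE hn.2]
  refine ⟨hj, ?_⟩
  rw [← h.row_ext hT hj.1 hj.2, ← h.row_ext hT hj.1 hj.2] at hE
  obtain ⟨x, hx⟩ := Row.exists_face hE (not_or.2 hn)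
  exact ⟨(x, j), (hT.onHFace_iff).2 ⟨rfl, hj, hx⟩⟩

theorem IsTMesh.onHFace_inner (hT : T.IsTMesh) {w v : ℤ × ℤ}
    (hw : T.OnHFace w v) : T.bottom + 2 ≤ v.2 ∧ v.2 ≤ T.top - 2 := by
  obtain ⟨h1, h2, -⟩ := (hT.onHFace_iff).1 hw
  omega

theorem IsAdmissible.onHFace_hSkel (hT : T.IsTMesh) (h : T.IsAdmissible) {w v : ℤ × ℤ}
    (hw : T.OnHFace w v) : v ∈ T.extended.hSkel := by
  obtain ⟨i, j⟩ := v
  obtain ⟨h1, h2, h3⟩ := (hT.onHFace_iff).1 hw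
  simp only at h1 h3
  rw [← h1] at h2 h3
  rw [hT.extended.mem_hSkel, ← h.row_ext hT h2.1 h2.2, ← h.row_ext hT h2.1 h2.2]
  exact h3.ext

/-- A point on face extensions of both directions is not on the skeleton. -/
theorem IsAdmissible.not_mem_hSkel_of_crossing (hT : T.IsTMesh) (h : T.IsAdmissible)
    {v w w' : ℤ × ℤ} (hw : T.OnHFace w v) (hw' : T.OnVFace w' v) : v ∉ T.hSkel := by
  obtain ⟨i, j⟩ := v
  obtain ⟨h1, h2, h3⟩ := (hT.onHFace_iff).1 hw
  simp only at h1 h3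
  rw [← h1] at h2 h3
  have hw'' : T.swap.OnHFace w'.swap (j, i) := hT.onHFace_swap.2 hw'
  obtain ⟨h1', h2', h3'⟩ := hT.swap.onHFace_iff.1 hw''
  rw [← h1'] at h2' h3'
  change T.left + 2 ≤ i ∧ i ≤ T.right - 2 at h2'
  have n1 := h3.not_E (h.row_valid hT h2.1 h2.2)
  have n2 := h3'.not_E ((h.swap hT).row_valid hT.swap h2'.1 h2'.2)
  change ¬ (T.HUnit (i - 1) j ∧ T.HUnit i j) at n1
  change ¬ (T.swap.HUnit (j - 1) i ∧ T.swap.HUnit j i) at n2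
  rw [hUnit_swap, hUnit_swap] at n2
  rw [hT.mem_hSkel]
  rintro (hE | hE)
  · have := hT.vUnit_of_hUnit_left (i := i) (j := j) (by omega) (by omega) (by omega) hE
    tauto
  · have := hT.vUnit_of_hUnit_right (i := i) (j := j) (by omega) (by omega) (by omega) hE
    tauto

theorem mem_crossingVertices {v : ℤ × ℤ} : v ∈ T.crossingVertices ↔
    v ∈ T.box ∧ (∃ w, T.OnHFace w v) ∧ ∃ w, T.OnVFace w v := by
  classical
  simp only [crossingVertices, Finset.mem_filter]

theorem mem_overlapVertices {p : ℤ × ℤ} : p ∈ T.overlapVertices ↔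
    p ∈ T.box ∧ p ∉ T.vertices ∧
    ((p ∈ T.vSkel ∧ ∃ v w, v ≠ w ∧ T.OnHFace v p ∧ ∃ q, T.OnHFace v q ∧ T.OnHFace w q) ∨
     (p ∈ T.hSkel ∧ ∃ v w, v ≠ w ∧ T.OnVFace v p ∧ ∃ q, T.OnVFace v q ∧ T.OnVFace w q)) := by
  classical
  simp only [overlapVertices, Finset.mem_filter]

theorem exists_overlap_swap {F G : ℤ × ℤ → ℤ × ℤ → Prop} (hFG : ∀ v p, G v p ↔ F v.swap p.swap)
    {p : ℤ × ℤ} : (∃ v w, v ≠ w ∧ G v p ∧ ∃ q, G v q ∧ G w q) ↔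
      ∃ v w, v ≠ w ∧ F v p.swap ∧ ∃ q, F v q ∧ F w q := by
  simp only [hFG]
  constructor
  · rintro ⟨v, w, h1, h2, q, h3, h4⟩
    exact ⟨v.swap, w.swap, fun h => h1 (Prod.swap_injective h), h2, q.swap, h3, h4⟩
  · rintro ⟨v, w, h1, h2, q, h3, h4⟩
    exact ⟨v.swap, w.swap, fun h => h1 (Prod.swap_injective h), by rwa [Prod.swap_swap], q.swap,
      by rwa [Prod.swap_swap, Prod.swap_swap], by rwa [Prod.swap_swap, Prod.swap_swap]⟩

theorem IsTMesh.mem_overlapVertices_swap (hT : T.IsTMesh) {i j : ℤ} :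
    (i, j) ∈ T.swap.overlapVertices ↔ (j, i) ∈ T.overlapVertices := by
  rw [mem_overlapVertices, mem_overlapVertices, mem_box, mem_box, hT.mem_vertices_swap]
  exact and_congr and_comm (and_congr_right fun _ => or_comm.trans
    (or_congr (and_congr hT.mem_hSkel_swap (exists_overlap_swap fun v p => hT.onVFace_swap))
      (and_congr hT.swap.mem_hSkel_swap.symm (exists_overlap_swap fun v p => hT.onHFace_swap))))

/-- On the vertical skeleton, the overlap vertices are those of the rows. -/
theorem IsTMesh.mem_overlap_iff (hT : T.IsTMesh) {i j : ℤ}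
    (hj : T.bottom + 2 ≤ j ∧ j ≤ T.top - 2) (hv : i ∈ T.hJ j) :
    (i, j) ∈ T.overlapVertices ↔ (T.row j).Overlap i := by
  have hb := hT.hJ_box hv
  rw [mem_overlapVertices, mem_box, hT.mem_vertices_iff_skel]
  unfold Row.Overlap
  rw [hT.row_touched]
  have hv' : (i, j) ∈ T.vSkel := hv
  constructor
  · rintro ⟨-, h1, ⟨-, v, w, hvw, h2, q, h3, h4⟩ | ⟨h2, -⟩⟩
    · rw [hT.onHFace_iff] at h2 h3 h4
      obtain ⟨v1, v2⟩ := v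
      obtain ⟨w1, w2⟩ := w
      obtain ⟨q1, q2⟩ := q
      simp only at h2 h3 h4
      obtain ⟨rfl, -, h2⟩ := h2
      obtain ⟨rfl, -, h3⟩ := h3
      obtain ⟨rfl, -, h4⟩ := h4
      refine ⟨hv, fun hh => h1 ⟨hh, hv⟩, v1, w1, ?_, h2, q1, h3, h4⟩
      rintro rfl
      exact hvw rfl
    · exact absurd ⟨h2, hv⟩ h1
  · rintro ⟨-, h1, x, y, hxy, h2, q, h3, h4⟩
    refine ⟨⟨⟨hb.1, hb.2.1⟩, hb.2.2⟩, fun hh => h1 hh.1, .inl ⟨hv, (x, j), (y, j), ?_, ?_, (q, j),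
      ?_, ?_⟩⟩
    · simpa using hxy
    all_goals exact (hT.onHFace_iff).2 ⟨rfl, hj, by assumption⟩

theorem IsTMesh.mem_badVertices_iff (hT : T.IsTMesh) {v : ℤ × ℤ} :
    v ∈ T.badVertices ↔ (T.bottom + 2 ≤ v.2 ∧ v.2 ≤ T.top - 2) ∧ v ∈ T.extended.vertices ∧
      v ∈ T.vSkel ∧ v ∉ T.activeVertices ∧ v ∉ T.overlapVertices := by
  classical
  obtain ⟨i, j⟩ := v
  simp only [badVertices, Finset.mem_filter]
  constructor
  · rintro ⟨h1, h2, h3, h4, h5, h6⟩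
    refine ⟨⟨h2, h3⟩, h1, h4, ?_, ?_⟩
    · rw [mem_activeVertices]
      rintro ⟨h7, h8⟩
      exact h5 ⟨hT.row_touched.2 (hT.mem_vertices_iff_skel.1 h7).1, h8.1, h8.2.1⟩
    · rwa [hT.mem_overlap_iff ⟨h2, h3⟩ h4]
  · rintro ⟨⟨h2, h3⟩, h1, h4, h5, h6⟩
    rw [hT.mem_overlap_iff ⟨h2, h3⟩ h4] at h6
    refine ⟨h1, h2, h3, h4, ?_, h6⟩
    rintro ⟨h7, h8, h9⟩
    exact h5 (mem_activeVertices.2 ⟨hT.mem_vertices_iff_skel.2 ⟨hT.row_touched.1 h7, h4⟩,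
      h8, h9, h2, h3⟩)

theorem IsTMesh.mem_activeVertices_swap (hT : T.IsTMesh) {i j : ℤ} :
    (i, j) ∈ T.swap.activeVertices ↔ (j, i) ∈ T.activeVertices := by
  rw [mem_activeVertices, mem_activeVertices, hT.mem_vertices_swap, inAR_swap]
  rfl

theorem IsTMesh.mem_badVertices_swap (hT : T.IsTMesh) {v : ℤ × ℤ} :
    v.swap ∈ T.swap.badVertices ↔ (T.left + 2 ≤ v.1 ∧ v.1 ≤ T.right - 2) ∧
      v ∈ T.extended.vertices ∧
      v ∈ T.hSkel ∧ v ∉ T.activeVertices ∧ v ∉ T.overlapVertices := by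
  obtain ⟨i, j⟩ := v
  rw [hT.swap.mem_badVertices_iff, hT.extended_swap]
  simp only [Prod.swap_prod_mk, hT.extended.mem_vertices_swap, hT.mem_activeVertices_swap,
    hT.mem_overlapVertices_swap, ← hT.swap.mem_hSkel_swap]
  rfl

theorem IsTMesh.active_subset (hT : T.IsTMesh) {v : ℤ × ℤ} (hv : v ∈ T.activeVertices) :
    v ∈ T.reducedVertices := by
  obtain ⟨h1, h2⟩ := mem_activeVertices.1 hv
  refine mem_reducedVertices.2 ⟨hT.vertices_extended_of h1, ?_⟩
  unfold InAR at h2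
  unfold IsOuterColumn
  omega

theorem IsAdmissible.crossing_iff (hT : T.IsTMesh) (h : T.IsAdmissible) {v : ℤ × ℤ} :
    v ∈ T.crossingVertices ↔ v ∈ T.extended.vertices ∧ v ∉ T.hSkel ∧ v ∉ T.vSkel := by
  obtain ⟨i, j⟩ := v
  constructor
  · intro hv
    obtain ⟨h1, ⟨w, hw⟩, ⟨w', hw'⟩⟩ := mem_crossingVertices.1 hv
    have a1 : T.swap.OnHFace w'.swap (j, i) := hT.onHFace_swap.2 hw'
    have a2 : T.swap.OnVFace w.swap (j, i) := hT.onVFace_swap.2 hw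
    have b1 := h.onHFace_hSkel hT hw
    have b2 := (h.swap hT).onHFace_hSkel hT.swap a1
    rw [hT.extended_swap, hT.extended.mem_hSkel_swap] at b2
    refine ⟨hT.extended.mem_vertices_iff_skel.2 ⟨b1, b2⟩,
      h.not_mem_hSkel_of_crossing hT hw hw', ?_⟩
    have := (h.swap hT).not_mem_hSkel_of_crossing hT.swap a1 a2
    rwa [hT.mem_hSkel_swap] at this
  · rintro ⟨h1, h2, h3⟩
    obtain ⟨-, hw⟩ := h.exists_onHFace hT h1 h2
    obtain ⟨-, w, hw'⟩ := (h.swap hT).exists_onHFace hT.swap (v := (j, i))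
      (by rwa [hT.extended_swap, hT.extended.mem_vertices_swap])
      (by rwa [hT.mem_hSkel_swap])
    rw [hT.onHFace_swap] at hw'
    exact mem_crossingVertices.2 ⟨mem_box_of_mem_extended h1, hw, _, hw'⟩

theorem IsAdmissible.crossing_subset (hT : T.IsTMesh) (h : T.IsAdmissible) {v : ℤ × ℤ}
    (hv : v ∈ T.crossingVertices) : v ∈ T.reducedVertices := by
  obtain ⟨-, ⟨w, hw⟩, -⟩ := mem_crossingVertices.1 hv
  refine mem_reducedVertices.2 ⟨((h.crossing_iff hT).1 hv).1, ?_⟩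
  have := hT.onHFace_inner hw
  unfold IsOuterRow
  omega

theorem IsAdmissible.overlap_subset (hT : T.IsTMesh) (h : T.IsAdmissible) {v : ℤ × ℤ}
    (hv : v ∈ T.overlapVertices) : v ∈ T.reducedVertices := by
  -- by transposition only the overlap of horizontal face extensions has to be considered
  have key : ∀ (T : RectMesh) (hT : T.IsTMesh) (h : T.IsAdmissible) (v w : ℤ × ℤ),
      v ∈ T.vSkel → T.OnHFace w v → v ∈ T.reducedVertices := by
    intro T hT h v w h1 h2
    obtain ⟨i, j⟩ := v
    have := hT.onHFace_inner h2
    refine mem_reducedVertices.2 ⟨hT.extended.mem_vertices_iff_skel.2 ⟨h.onHFace_hSkel hT h2,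
      hT.hJ_extended h1⟩, ?_⟩
    unfold IsOuterRow
    omega
  obtain ⟨-, -, ⟨h1, w, -, -, h2, -⟩ | ⟨h1, w, -, -, h2, -⟩⟩ := mem_overlapVertices.1 hv
  · exact key T hT h v w h1 h2
  · obtain ⟨i, j⟩ := v
    rw [← hT.mem_reducedVertices_swap]
    refine key T.swap hT.swap (h.swap hT) (j, i) w.swap ?_ (hT.onHFace_swap.2 h2)
    rwa [← hT.swap.mem_hSkel_swap]

/-- The vertices of the simplified extended T-mesh are the active, the crossing and the overlap
vertices together with four vertices for each segment. -/
theorem IsAdmissible.card_reducedVertices (hT : T.IsTMesh) (h : T.IsAdmissible) :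
    T.reducedVertices.card =
      T.activeVertices.card + T.crossingVertices.card + T.overlapVertices.card +
        4 * T.reducedSegments.card := by
  classical
  have hB := h.card_badVertices hT
  have hB' := (h.swap hT).card_badVertices hT.swap
  rw [hT.card_reducedSegments]
  have hunion : T.reducedVertices = T.activeVertices ∪ (T.crossingVertices ∪ (T.overlapVertices ∪
      (T.badVertices ∪ T.swap.badVertices.image Prod.swap))) := by
    ext v
    have himg : v ∈ T.swap.badVertices.image Prod.swap ↔ v.swap ∈ T.swap.badVertices := by
      rw [Finset.mem_image]
      exact ⟨by rintro ⟨w, hw, rfl⟩; rwa [Prod.swap_swap], fun hv => ⟨_, hv, Prod.swap_swap v⟩⟩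
    simp only [Finset.mem_union, himg, hT.mem_badVertices_iff, hT.mem_badVertices_swap]
    constructor
    · intro hv
      by_contra hn
      simp only [not_or] at hn
      obtain ⟨n1, n2, n3, n4, n5⟩ := hn
      obtain ⟨m1, m2⟩ := mem_reducedVertices.1 hv
      have hbox := mem_box.1 (mem_box_of_mem_extended m1)
      by_cases hs : v ∈ T.hSkel <;> by_cases hs' : v ∈ T.vSkel
      · have hvT : v ∈ T.vertices := hT.mem_vertices_iff_skel.2 ⟨hs, hs'⟩
        have n1' : ¬ T.InAR v := fun hh => n1 (mem_activeVertices.2 ⟨hvT, hh⟩)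
        have n4' : ¬ (T.bottom + 2 ≤ v.2 ∧ v.2 ≤ T.top - 2) := fun hh => n4 ⟨hh, m1, hs', n1, n3⟩
        have n5' : ¬ (T.left + 2 ≤ v.1 ∧ v.1 ≤ T.right - 2) := fun hh => n5 ⟨hh, m1, hs, n1, n3⟩
        unfold IsOuterColumn IsOuterRow at m2
        omega
      · obtain ⟨i, j⟩ := v
        have := ((h.swap hT).exists_onHFace hT.swap (v := (j, i))
          (by rwa [hT.extended_swap, hT.extended.mem_vertices_swap])
          (by rwa [hT.mem_hSkel_swap])).1
        exact n5 ⟨this, m1, hs, n1, n3⟩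
      · exact n4 ⟨(h.exists_onHFace hT m1 hs).1, m1, hs', n1, n3⟩
      · exact n2 ((h.crossing_iff hT).2 ⟨m1, hs, hs'⟩)
    · rintro (hv | hv | hv | hv | hv)
      · exact hT.active_subset hv
      · exact h.crossing_subset hT hv
      · exact h.overlap_subset hT hv
      · refine mem_reducedVertices.2 ⟨hv.2.1, ?_⟩
        have := hv.1
        unfold IsOuterRow
        omega
      · refine mem_reducedVertices.2 ⟨hv.2.1, ?_⟩
        have := hv.1
        unfold IsOuterColumn
        omega
  have d4 : Disjoint T.badVertices (T.swap.badVertices.image Prod.swap) := by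
    rw [Finset.disjoint_left]
    intro v h1 h2
    obtain ⟨w, hw, rfl⟩ := Finset.mem_image.1 h2
    have e := (hT.mem_badVertices_swap (v := w.swap)).1 (by rwa [Prod.swap_swap])
    have e' := (hT.mem_badVertices_iff).1 h1
    exact e.2.2.2.1 (mem_activeVertices.2 ⟨hT.mem_vertices_iff_skel.2 ⟨e.2.2.1, e'.2.2.1⟩,
      e.1.1, e.1.2, e'.1⟩)
  have hbadT : ∀ v, v ∈ T.badVertices ∪ T.swap.badVertices.image Prod.swap →
      v ∉ T.activeVertices ∧ v ∉ T.overlapVertices ∧ (v ∈ T.hSkel ∨ v ∈ T.vSkel) := by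
    intro v hv
    rcases Finset.mem_union.1 hv with hv | hv
    · have e' := (hT.mem_badVertices_iff).1 hv
      tauto
    · obtain ⟨w, hw, rfl⟩ := Finset.mem_image.1 hv
      have e := (hT.mem_badVertices_swap (v := w.swap)).1 (by rwa [Prod.swap_swap])
      tauto
  have d3 : Disjoint T.overlapVertices
      (T.badVertices ∪ T.swap.badVertices.image Prod.swap) := by
    rw [Finset.disjoint_left]
    exact fun v h1 h2 => (hbadT v h2).2.1 h1
  have d2 : Disjoint T.crossingVertices (T.overlapVertices ∪
      (T.badVertices ∪ T.swap.badVertices.image Prod.swap)) := by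
    rw [Finset.disjoint_left]
    intro v h1 h2
    have e := (h.crossing_iff hT).1 h1
    rcases Finset.mem_union.1 h2 with h2 | h2
    · have := (mem_overlapVertices.1 h2).2.2
      tauto
    · have := (hbadT v h2).2.2
      tauto
  have d1 : Disjoint T.activeVertices (T.crossingVertices ∪ (T.overlapVertices ∪
      (T.badVertices ∪ T.swap.badVertices.image Prod.swap))) := by
    rw [Finset.disjoint_left]
    intro v h1 h2
    have e := (mem_activeVertices.1 h1).1
    rcases Finset.mem_union.1 h2 with h2 | h2
    · exact ((h.crossing_iff hT).1 h2).2.1 (hT.mem_vertices_iff_skel.1 e).1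
    rcases Finset.mem_union.1 h2 with h2 | h2
    · exact (mem_overlapVertices.1 h2).2.1 e
    · exact (hbadT v h2).1 h1
  rw [hunion, Finset.card_union_of_disjoint d1, Finset.card_union_of_disjoint d2,
    Finset.card_union_of_disjoint d3, Finset.card_union_of_disjoint d4,
    Finset.card_image_of_injective _ Prod.swap_injective, hB, hB']
  ring

end RectMesh

/-! ### Analysis-suitable meshes are diagonalizable -/

/-- If in every nonempty subset of `S` some element is good relative to the others, then `S` can be
enumerated such that each element is good relative to its predecessors. -/
theorem exists_list_of_forall_exists {α : Type*} [DecidableEq α] {P : Finset α → α → Prop}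
    (S : Finset α) (h : ∀ A ⊆ S, A.Nonempty → ∃ G ∈ A, P (A.erase G) G) :
    ∃ l : List α, l.Nodup ∧ l.toFinset = S ∧
      ∀ (i : ℕ) (hi : i < l.length), P (l.take i).toFinset l[i] := by
  obtain ⟨n, hn⟩ : ∃ n, S.card = n := ⟨_, rfl⟩
  induction n generalizing S with
  | zero =>
    rw [Finset.card_eq_zero] at hn
    subst hn
    exact ⟨[], List.nodup_nil, rfl, fun i hi => by simp at hi⟩
  | succ n ih =>
    obtain ⟨G, hG, hP⟩ := h S subset_rfl (Finset.card_pos.1 (by omega))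
    obtain ⟨l, l1, l2, l3⟩ := ih (S.erase G) (fun A hA => h A (hA.trans (Finset.erase_subset _ _)))
      (by rw [Finset.card_erase_of_mem hG]; omega)
    have hGl : G ∉ l := fun hm => by
      have : G ∈ S.erase G := l2 ▸ List.mem_toFinset.2 hm
      simp at this
    refine ⟨l ++ [G], ?_, ?_, fun i hi => ?_⟩
    · rw [List.nodup_append]
      refine ⟨l1, List.nodup_singleton _, fun a ha b hb => ?_⟩
      rw [List.mem_singleton] at hb
      subst hb
      rintro rfl
      exact hGl ha
    · rw [List.toFinset_append, l2]
      ext x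
      simp only [Finset.mem_union, Finset.mem_erase, List.toFinset_cons, List.toFinset_nil,
        insert_empty_eq, Finset.mem_singleton]
      constructor
      · rintro (hx | rfl)
        exacts [hx.2, hG]
      · intro hx
        by_cases hxG : x = G
        exacts [.inr hxG, .inl ⟨hxG, hx⟩]
    · rw [List.length_append, List.length_singleton] at hi
      rcases Nat.lt_succ_iff_lt_or_eq.1 hi with hlt | rfl
      · rw [List.take_append_of_le_length hlt.le, List.getElem_append_left hlt]
        exact l3 i hlt
      · rw [List.take_left, l2, List.getElem_append_right le_rfl]
        simpa using hP

/-- A segment that starts at the left end of the line crosses the fourth column. -/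
theorem Row.Valid.left_add_three_le {Y : Row} (hY : Y.Valid) {p q : ℤ} (h : IsRun Y.Ext p q)
    (hp : p = Y.L) (hE : Y.E Y.L) : Y.L + 3 ≤ q := by
  have hw := hY.width
  have h1 : Y.E (Y.L + 1) := by
    by_contra hn
    have := hY.frame (Y.L + 1) (by omega) (by omega) (by rw [add_sub_cancel_right]; tauto)
    omega
  have h2 : Y.Ext (Y.L + 2) := by
    by_cases h2 : Y.E (Y.L + 2)
    · exact .inl h2
    · have hc : Y.Closes (Y.L + 2) := ⟨by
        rw [show Y.L + 2 - 1 = Y.L + 1 by ring]; exact h1, h2, le_rfl, by omega⟩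
      obtain ⟨b, hb⟩ := hc.exists_extR hY
      exact .inr (.inr ⟨_, b, hb, le_rfl, hb.lt⟩)
  have hpq := h.1
  by_contra hlt
  rcases (by omega : q = Y.L + 1 ∨ q = Y.L + 2) with rfl | rfl
  · exact h.2.2.2 (.inl h1)
  · exact h.2.2.2 h2

namespace RectMesh

variable {T : RectMesh}

/-- The segment `G` has four vertices in the simplified extended T-mesh that are on no other
segment in `A`. -/
def HasPrivate (T : RectMesh) (A : Set ((ℤ × ℤ) × (ℤ × ℤ))) (G : (ℤ × ℤ) × (ℤ × ℤ)) : Prop :=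
  ∃ S : Finset (ℤ × ℤ), S.card = 4 ∧ ∀ v ∈ S, v ∈ T.reducedVertices ∧ OnSegment G v ∧
    ∀ H ∈ A, H ≠ G → ¬ OnSegment H v

/-- The transposed set of segments. -/
def swapSegs (A : Set ((ℤ × ℤ) × (ℤ × ℤ))) : Set ((ℤ × ℤ) × (ℤ × ℤ)) := {s | segSwap s ∈ A}

theorem onSegment_swap {s : (ℤ × ℤ) × (ℤ × ℤ)} {v : ℤ × ℤ} :
    OnSegment (segSwap s) v.swap ↔ OnSegment s v := by
  unfold OnSegment segSwap
  simp only [Prod.fst_swap, Prod.snd_swap]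
  tauto

theorem IsTMesh.hasPrivate_of_swap (hT : T.IsTMesh) {A : Set ((ℤ × ℤ) × (ℤ × ℤ))}
    {G : (ℤ × ℤ) × (ℤ × ℤ)} (h : T.swap.HasPrivate (swapSegs A) (segSwap G)) :
    T.HasPrivate A G := by
  classical
  obtain ⟨S, h1, h2⟩ := h
  refine ⟨S.image Prod.swap, by rw [Finset.card_image_of_injective _ Prod.swap_injective, h1], ?_⟩
  intro v hv
  obtain ⟨w, hw, rfl⟩ := Finset.mem_image.1 hv
  obtain ⟨a, b, c⟩ := h2 w hw
  refine ⟨hT.mem_reducedVertices_swap.1 a, onSegment_swap.1 (by rwa [Prod.swap_swap]), ?_⟩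
  intro H hH hne ho
  refine c (segSwap H) hH (fun he => hne ?_) ?_
  · exact congrArg segSwap he
  · rw [← onSegment_swap]; exact ho

/-- The subset `A` contains no complete vertical line. -/
def NoFullColumn (T : RectMesh) (A : Set ((ℤ × ℤ) × (ℤ × ℤ))) : Prop :=
  ∀ H ∈ A, segSwap H ∈ T.swap.hSegs → ¬ (H.1.2 = T.bottom ∧ H.2.2 = T.top)

/-- Four points of a horizontal segment are private to it if no vertical segment in `A` passes
through them. -/
theorem IsTMesh.hasPrivate_of_four (hT : T.IsTMesh) {A : Set ((ℤ × ℤ) × (ℤ × ℤ))}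
    (hA : ∀ s ∈ A, s ∈ T.reducedSegments) {p q j x₁ x₂ x₃ x₄ : ℤ}
    (hG : ((p, j), (q, j)) ∈ T.hSegs) (h1 : p ≤ x₁) (h12 : x₁ < x₂) (h23 : x₂ < x₃)
    (h34 : x₃ < x₄) (h4 : x₄ ≤ q)
    (hx : ∀ x, x = x₁ ∨ x = x₂ ∨ x = x₃ ∨ x = x₄ → x ∈ T.hJ j ∧
      ∀ H ∈ A, segSwap H ∈ T.swap.hSegs → ¬ OnSegment H (x, j)) :
    T.HasPrivate A ((p, j), (q, j)) := by
  classical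
  obtain ⟨-, hj, hr⟩ := hT.mem_hSegs.1 hG
  simp only at hj hr
  refine ⟨({x₁, x₂, x₃, x₄} : Finset ℤ).image fun x => (x, j), ?_, fun v hv => ?_⟩
  · rw [Finset.card_image_of_injective _ fun a b hab => by simpa using hab]
    rw [Finset.card_insert_of_notMem, Finset.card_insert_of_notMem, Finset.card_pair] <;>
    first
      | omega
      | simp only [Finset.mem_insert, Finset.mem_singleton]; omega
  · obtain ⟨x, hxm, rfl⟩ := Finset.mem_image.1 hv
    simp only [Finset.mem_insert, Finset.mem_singleton] at hxm
    obtain ⟨hJ, hpriv⟩ := hx x hxm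
    have hpx : p ≤ x ∧ x ≤ q := by omega
    have hvert : (x, j) ∈ T.extended.vertices := by
      refine hT.extended.mem_vertices.2 ⟨?_, hT.extended.mem_hJ.1 (hT.hJ_extended hJ)⟩
      rcases eq_or_ne x q with rfl | hne
      · exact .inl (hr.2.1 _ (by omega) (by omega))
      · exact .inr (hr.2.1 _ (by omega) (by omega))
    refine ⟨mem_reducedVertices.2 ⟨hvert, ?_⟩, ⟨hpx.1, hpx.2, le_rfl, le_rfl⟩, ?_⟩
    · unfold IsOuterRow; simp only; omega
    · intro H hH hne ho
      rcases hT.mem_reducedSegments_iff.1 (hA H hH) with hH' | hH'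
      · obtain ⟨e1, -, e2⟩ := hT.mem_hSegs.1 hH'
        obtain ⟨⟨a, c⟩, ⟨b, d⟩⟩ := H
        obtain ⟨o1, o2, o3, o4⟩ := ho
        simp only at e1 e2 o1 o2 o3 o4
        subst e1
        obtain rfl : c = j := by omega
        obtain ⟨rfl, rfl⟩ := e2.eq_of_mem hr o1 o2 hpx.1 hpx.2
        exact hne rfl
      · exact hpriv H hH hH' ho

/-- A vertical segment of the simplified mesh lies in an inner column. -/
theorem IsTMesh.vSeg_column (hT : T.IsTMesh) {H : (ℤ × ℤ) × (ℤ × ℤ)} {x j : ℤ}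
    (hH : segSwap H ∈ T.swap.hSegs) (ho : OnSegment H (x, j)) :
    (H.1.1 = x ∧ H.2.1 = x) ∧ (T.left + 2 ≤ x ∧ x ≤ T.right - 2) ∧
      IsRun (fun j => T.extended.VUnit x j) H.1.2 H.2.2 ∧ H.1.2 ≤ j ∧ j ≤ H.2.2 := by
  obtain ⟨e1, e2, e3⟩ := hT.swap.mem_hSegs.1 hH
  obtain ⟨⟨a, c⟩, ⟨b, d⟩⟩ := H
  obtain ⟨o1, o2, o3, o4⟩ := ho
  simp only [segSwap, Prod.swap_prod_mk, hT.extended_swap, hUnit_swap] at *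
  change T.left + 2 ≤ _ ∧ _ ≤ T.right - 2 at e2
  subst e1
  obtain rfl : a = x := by omega
  exact ⟨⟨rfl, rfl⟩, e2, e3, o3, o4⟩

theorem IsAdmissible.hasPrivate_full (hT : T.IsTMesh) (h : T.IsAdmissible)
    {A : Set ((ℤ × ℤ) × (ℤ × ℤ))} (hA : ∀ s ∈ A, s ∈ T.reducedSegments) {j : ℤ}
    (hG : ((T.left, j), (T.right, j)) ∈ T.hSegs) :
    T.HasPrivate A ((T.left, j), (T.right, j)) := by
  have hj := (hT.mem_hSegs.1 hG).2.1
  simp only at hj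
  have hV := h.row_valid hT hj.1 hj.2
  have hw := h.width
  refine hT.hasPrivate_of_four hA hG (x₁ := T.left) (x₂ := T.left + 1) (x₃ := T.right - 1)
    (x₄ := T.right) le_rfl (by omega) (by omega) (by omega) le_rfl fun x hx => ⟨?_, ?_⟩
  · rcases hx with rfl | rfl | rfl | rfl
    exacts [hV.L_mem, hV.L1_mem, hV.R1_mem, hV.R_mem]
  · intro H _ hH' ho
    have := (hT.vSeg_column hH' ho).2.1
    omega

/-- A horizontal segment either has four private vertices, or it starts with the extension of a
T-junction that is crossed by a vertical segment in `A`. -/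
theorem IsAdmissible.hasPrivate_or (hT : T.IsTMesh) (h : T.IsAdmissible)
    {A : Set ((ℤ × ℤ) × (ℤ × ℤ))} (hA : ∀ s ∈ A, s ∈ T.reducedSegments) (hfull : T.NoFullColumn A)
    {p q j : ℤ} (hG : ((p, j), (q, j)) ∈ T.hSegs) :
    T.HasPrivate A ((p, j), (q, j)) ∨ ∃ v b x, T.HExt v p b ∧ v.2 = j ∧ p ≤ x ∧ x ≤ b ∧
      ∃ H ∈ A, segSwap H ∈ T.swap.hSegs ∧ OnSegment H (x, j) := by
  obtain ⟨-, hj, hr⟩ := hT.mem_hSegs.1 hG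
  simp only at hj hr
  have hV := h.row_valid hT hj.1 hj.2
  have hw := h.width
  have hrun : IsRun (T.row j).Ext p q := by
    convert hr using 1
    funext i
    exact propext (h.row_ext hT hj.1 hj.2)
  rcases hV.run_left' hrun with ⟨hp, hE⟩ | ⟨k, x, b, ho, hc, hb⟩
  · left
    have hq := hV.left_add_three_le hrun hp hE
    change p = T.left at hp
    change T.left + 3 ≤ q at hq
    refine hT.hasPrivate_of_four hA hG (x₁ := T.left) (x₂ := T.left + 1) (x₃ := T.left + 2)
      (x₄ := T.left + 3) hp.le (by omega) (by omega) (by omega) hq fun x hx => ?_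
    obtain ⟨m, rfl, hm0, hm3⟩ : ∃ m, x = T.left + m ∧ 0 ≤ m ∧ m ≤ 3 :=
      ⟨x - T.left, by omega, by omega, by omega⟩
    refine ⟨hT.mem_hJ.2 (.inr (h.vUnit hT hm0 hm3 (by omega) (by omega)).1), ?_⟩
    -- such a segment would fill the column
    intro H hH hH' ho
    obtain ⟨-, -, hrH, h1, h2⟩ := hT.vSeg_column hH' ho
    have hfullrun : IsRun (fun j => T.extended.VUnit (T.left + m) j) T.bottom T.top :=
      ⟨hT.2.1, fun i hi hi' => hT.vUnit_extended_of (h.vUnit hT hm0 hm3 hi hi').1,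
        fun hh => by have := hh.2.2.1; change T.bottom ≤ _ at this; omega,
        fun hh => by have := hh.2.2.2.1; change _ < T.top at this; omega⟩
    exact hfull H hH hH' (hrH.eq_of_mem hfullrun h1 h2 (by omega) (by omega))
  · obtain ⟨c1, c2, c3, c4, c5, c6, c7, c8⟩ := id hc
    by_cases hall : ∀ y, y = p ∨ y = k ∨ y = x ∨ y = b →
        ∀ H ∈ A, segSwap H ∈ T.swap.hSegs → ¬ OnSegment H (y, j)
    · left
      refine hT.hasPrivate_of_four hA hG le_rfl c5 c6 c7 hb fun y hy => ⟨?_, hall y hy⟩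
      rcases hy with rfl | rfl | rfl | rfl <;> assumption
    · right
      push Not at hall
      obtain ⟨y, hy, H, hH, hH', ho'⟩ := hall
      exact ⟨(x, j), b, y, hT.hExt_iff.2 ⟨hj, .inl ⟨k, ho, hc⟩⟩, rfl, by omega, by omega,
        H, hH, hH', ho'⟩

/-- In every nonempty set of segments one has four vertices that are on none of the others: if
there is no complete line in the set, consider its lowest horizontal segment and the vertical
segments that cross the extension at its left end. -/
theorem IsAnalysisSuitable.exists_hasPrivate (hT : T.IsTMesh) (h : T.IsAnalysisSuitable)
    {A : Finset ((ℤ × ℤ) × (ℤ × ℤ))} (hA : A ⊆ T.reducedSegments) (hne : A.Nonempty) :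
    ∃ G ∈ A, T.HasPrivate A G := by
  obtain ⟨h, has⟩ := h
  by_contra hcon
  push Not at hcon
  have hAT : ∀ s ∈ (A : Set _), s ∈ T.reducedSegments := fun s hs => hA hs
  have hAT' : ∀ s ∈ swapSegs (A : Set _), s ∈ T.swap.reducedSegments :=
    fun s hs => hT.mem_reducedSegments_swap.2 (hA hs)
  have nfR : T.swap.NoFullColumn (swapSegs A) := by
    rintro H hH hH' ⟨h1, h2⟩
    refine hcon (segSwap H) hH ?_
    change segSwap H ∈ T.hSegs at hH'
    have e := (hT.mem_hSegs.1 hH').1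
    obtain ⟨⟨a, c⟩, ⟨b, d⟩⟩ := H
    simp only [segSwap, Prod.swap_prod_mk] at *
    change c = T.left at h1
    change d = T.right at h2
    subst h1 h2 e
    exact h.hasPrivate_full hT hAT hH'
  have nfC : T.NoFullColumn (A : Set _) := by
    rintro H hH hH' ⟨h1, h2⟩
    refine hcon H hH (hT.hasPrivate_of_swap ?_)
    have e := (hT.swap.mem_hSegs.1 hH').1
    obtain ⟨⟨a, c⟩, ⟨b, d⟩⟩ := H
    simp only [segSwap, Prod.swap_prod_mk] at *
    subst h1 h2 e
    exact (h.swap hT).hasPrivate_full hT.swap hAT' hH'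
  have stepH : ∀ p q j, ((p, j), (q, j)) ∈ A → ((p, j), (q, j)) ∈ T.hSegs →
      ∃ v b x, T.HExt v p b ∧ v.2 = j ∧ p ≤ x ∧ x ≤ b ∧
        ∃ H ∈ A, segSwap H ∈ T.swap.hSegs ∧ OnSegment H (x, j) := fun p q j hG hG' =>
    (h.hasPrivate_or hT hAT nfC hG').resolve_left (hcon _ hG)
  have stepV : ∀ p q i, ((i, p), (i, q)) ∈ A → ((p, i), (q, i)) ∈ T.swap.hSegs →
      ∃ v b y, T.VExt v p b ∧ v.1 = i ∧ p ≤ y ∧ y ≤ b ∧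
        ∃ K ∈ A, K ∈ T.hSegs ∧ OnSegment K (i, y) := by
    intro p q i hG hG'
    obtain ⟨v, b, y, h1, h2, h3, h4, K, hK, hK', ho⟩ :=
      ((h.swap hT).hasPrivate_or hT.swap hAT' nfR hG').resolve_left
        fun hp => hcon _ hG (hT.hasPrivate_of_swap hp)
    exact ⟨v.swap, b, y, hT.hExt_swap.1 h1, h2, h3, h4, segSwap K, hK, hK',
      onSegment_swap.2 ho⟩
  -- a horizontal segment in `A`
  have hex : ∃ G ∈ A, G ∈ T.hSegs := by
    obtain ⟨G, hG⟩ := hne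
    rcases hT.mem_reducedSegments_iff.1 (hA hG) with hG' | hG'
    · exact ⟨G, hG, hG'⟩
    · have e := (hT.swap.mem_hSegs.1 hG').1
      obtain ⟨⟨a, c⟩, ⟨b, d⟩⟩ := G
      simp only [segSwap, Prod.swap_prod_mk] at *
      subst e
      obtain ⟨-, -, -, -, -, -, -, K, hK, hK', -⟩ := stepV _ _ _ hG hG'
      exact ⟨K, hK, hK'⟩
  classical
  obtain ⟨G, hG, hmin⟩ := Finset.exists_min_image (A.filter fun G => G ∈ T.hSegs)
    (fun G => G.1.2) (by obtain ⟨G, h1, h2⟩ := hex; exact ⟨G, Finset.mem_filter.2 ⟨h1, h2⟩⟩)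
  rw [Finset.mem_filter] at hG
  obtain ⟨hG, hG'⟩ := hG
  have e := (hT.mem_hSegs.1 hG').1
  obtain ⟨⟨p, j⟩, ⟨q, j'⟩⟩ := G
  simp only at e hmin
  subst e
  obtain ⟨v, b, x, hv, rfl, h1, h2, H, hH, hH', ho⟩ := stepH _ _ _ hG hG'
  obtain ⟨⟨e1, e2⟩, -, -, h3, h4⟩ := hT.vSeg_column hH' ho
  obtain ⟨⟨x', c⟩, ⟨x'', d⟩⟩ := H
  simp only [segSwap, Prod.swap_prod_mk] at *
  subst e1 e2
  obtain ⟨w, b', y, hw, rfl, h5, h6, K, hK, hK', ho'⟩ := stepV _ _ _ hH hH'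
  -- The vertical segment `H` starts with an extension that reaches the row of `K`. As `K` is not
  -- below `G`, this extension meets the one at the left end of `G`.
  have hm := hmin K (Finset.mem_filter.2 ⟨hK, hK'⟩)
  have e' := (hT.mem_hSegs.1 hK').1
  obtain ⟨-, -, o3, o4⟩ := ho'
  simp only at o3 o4
  exact has v w p b c b' hv hw ⟨h1, h2, h3, by omega⟩

theorem IsAnalysisSuitable.isDiagonalizable (hT : T.IsTMesh) (h : T.IsAnalysisSuitable) :
    T.IsDiagonalizable := by
  classical
  obtain ⟨l, l1, l2, l3⟩ := exists_list_of_forall_exists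
    (P := fun B G => 4 ≤ (T.reducedVertices.filter fun v =>
      OnSegment G v ∧ ∀ H ∈ B, ¬ OnSegment H v).card) T.reducedSegments fun A hA hne => by
    obtain ⟨G, hG, S, hS, hS'⟩ := h.exists_hasPrivate hT hA hne
    refine ⟨G, hG, ?_⟩
    rw [← hS]
    refine Finset.card_le_card fun v hv => ?_
    obtain ⟨a, b, c⟩ := hS' v hv
    refine Finset.mem_filter.2 ⟨a, b, fun H hH => ?_⟩
    rw [Finset.mem_erase] at hH
    exact c H hH.2 hH.1
  have hlen : T.reducedSegments.card = l.length := by rw [← l2, List.toFinset_card_of_nodup l1]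
  refine ⟨(finCongr hlen).trans ((List.Nodup.getEquiv l l1).trans
    (Equiv.subtypeEquivRight fun s => by rw [← l2, List.mem_toFinset])), fun j => ?_⟩
  refine (l3 j (by have := j.2; omega)).trans (Finset.card_le_card fun v hv => ?_)
  rw [Finset.mem_filter] at hv ⊢
  refine ⟨hv.1, hv.2.1, fun i hi => hv.2.2 _ ?_⟩
  rw [List.mem_toFinset, List.mem_take_iff_getElem]
  exact ⟨i, by have := i.2; have : (i : ℕ) < j := hi; omega, rfl⟩

end RectMesh

/-! ### Diagonalizable meshes have full rank -/

open Polynomial in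
/-- A linear functional on cubic polynomials that vanishes on `(X - t)³` for four values of `t`
is zero. -/
theorem cubic_functional_eq_zero {g : Fin 4 → ℝ} {S : Finset ℝ} (hS : 4 ≤ S.card)
    (h : ∀ t ∈ S, ∑ k : Fin 4, g k * ((X - C t) ^ 3 : ℝ[X]).coeff k = 0) : g = 0 := by
  have hsum : ∀ t : ℝ, ∑ k : Fin 4, g k * ((X - C t) ^ 3 : ℝ[X]).coeff k =
      (Cubic.toPoly ⟨-g 0, 3 * g 1, -3 * g 2, g 3⟩).eval t := by
    intro t
    simp only [sub_eq_add_neg X, ← C_neg, coeff_X_add_C_pow, Fin.sum_univ_four, Cubic.toPoly,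
      eval_add, eval_mul, eval_C,
      eval_pow, eval_X]
    norm_num [Nat.choose]
    ring
  have hp : (Cubic.toPoly ⟨-g 0, 3 * g 1, -3 * g 2, g 3⟩ : ℝ[X]) = 0 := by
    refine eq_zero_of_natDegree_lt_card_of_eval_eq_zero' _ S (fun t ht => ?_) ?_
    · rw [← hsum, h t ht]
    · exact lt_of_le_of_lt natDegree_cubic_le (by omega)
  have hc : (⟨-g 0, 3 * g 1, -3 * g 2, g 3⟩ : Cubic ℝ) = 0 := (Cubic.toPoly_eq_zero_iff _).1 hp
  have h0 : -g 0 = 0 := congrArg Cubic.a hc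
  have h1 : 3 * g 1 = 0 := congrArg Cubic.b hc
  have h2 : -3 * g 2 = 0 := congrArg Cubic.c hc
  have h3 : g 3 = 0 := congrArg Cubic.d hc
  funext k
  fin_cases k <;> simp only [Pi.zero_apply, Fin.zero_eta, Fin.mk_one, Fin.reduceFinMk] <;> linarith

namespace RectMesh

variable {T : RectMesh}

open scoped Classical in
theorem reducedMatrix_apply {ξ η : ℤ → ℝ} (s : {s // s ∈ T.reducedSegments}) (k : Fin 4)
    (v : {v // v ∈ T.reducedVertices}) : T.reducedMatrix ξ η (s, k) v =
      if OnSegment s.1 v.1 then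
        if s.1.1.2 = s.1.2.2 then
          ((Polynomial.X - Polynomial.C (ξ v.1.1)) ^ 3).coeff (k : ℕ)
        else ((Polynomial.X - Polynomial.C (η v.1.2)) ^ 3).coeff (k : ℕ)
      else 0 := rfl

theorem mem_box_of_mem_reduced {v : ℤ × ℤ} (h : v ∈ T.reducedVertices) :
    v.1 ∈ Set.Icc T.left T.right ∧ v.2 ∈ Set.Icc T.bottom T.top := by
  have := mem_box.1 (mem_box_of_mem_extended (mem_reducedVertices.1 h).1)
  exact this

theorem IsDiagonalizable.rank (hd : T.IsDiagonalizable) {ξ η : ℤ → ℝ}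
    (hξ : StrictMonoOn ξ (Set.Icc T.left T.right)) (hη : StrictMonoOn η (Set.Icc T.bottom T.top)) :
    (T.reducedMatrix ξ η).rank = 4 * T.reducedSegments.card := by
  classical
  obtain ⟨G, hG⟩ := hd
  have hli : LinearIndependent ℝ (T.reducedMatrix ξ η).row := by
    rw [Fintype.linearIndependent_iff]
    intro g hg
    have hcol : ∀ v, ∑ s, ∑ k, g (s, k) * T.reducedMatrix ξ η (s, k) v = 0 := by
      intro v
      have := congrFun hg v
      rw [Finset.sum_apply, Fintype.sum_prod_type] at this
      exact this
    -- the coefficients vanish for one segment after the other, beginning with the last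
    have key : ∀ n : ℕ, ∀ j : Fin T.reducedSegments.card, T.reducedSegments.card - j ≤ n →
        (fun k => g (G j, k)) = 0 := by
      intro n
      induction n with
      | zero => intro j hj; have := j.2; omega
      | succ n ih =>
        intro j hj
        set F := T.reducedVertices.filter fun v =>
          OnSegment (G j).1 v ∧ ∀ i < j, ¬ OnSegment (G i).1 v with hF
        have hrow : ∀ v (hv : v ∈ F), ∑ k, g (G j, k) *
            T.reducedMatrix ξ η (G j, k) ⟨v, (Finset.mem_filter.1 hv).1⟩ = 0 := by
          intro v hv
          have hv' := Finset.mem_filter.1 hv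
          rw [← hcol ⟨v, hv'.1⟩, ← Equiv.sum_comp G]
          symm
          refine Finset.sum_eq_single j (fun i _ hij => ?_) fun h => absurd (Finset.mem_univ _) h
          refine Finset.sum_eq_zero fun k _ => ?_
          rcases lt_or_gt_of_ne hij with hlt | hgt
          · rw [reducedMatrix_apply, if_neg (hv'.2.2 i hlt), mul_zero]
          · have := congrFun (ih i (by have : (j : ℕ) < i := hgt; omega)) k
            exact this ▸ zero_mul _
        by_cases hor : (G j).1.1.2 = (G j).1.2.2
        · refine cubic_functional_eq_zero (S := F.image fun v => ξ v.1) ?_ ?_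
          · rw [Finset.card_image_of_injOn]
            · exact hG j
            · intro v hv w hw hvw
              have hv' := Finset.mem_filter.1 hv
              have hw' := Finset.mem_filter.1 hw
              have h1 := hξ.injOn (mem_box_of_mem_reduced hv'.1).1
                (mem_box_of_mem_reduced hw'.1).1 hvw
              have h2 := hv'.2.1.2.2
              have h3 := hw'.2.1.2.2
              exact Prod.ext h1 (by omega)
          · intro t ht
            obtain ⟨v, hv, rfl⟩ := Finset.mem_image.1 ht
            rw [← hrow v hv]
            refine Finset.sum_congr rfl fun k _ => ?_
            rw [reducedMatrix_apply, if_pos (Finset.mem_filter.1 hv).2.1, if_pos hor]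
        · refine cubic_functional_eq_zero (S := F.image fun v => η v.2) ?_ ?_
          · rw [Finset.card_image_of_injOn]
            · exact hG j
            · intro v hv w hw hvw
              have hv' := Finset.mem_filter.1 hv
              have hw' := Finset.mem_filter.1 hw
              have h1 := hη.injOn (mem_box_of_mem_reduced hv'.1).2
                (mem_box_of_mem_reduced hw'.1).2 hvw
              have h2 := hv'.2.1
              have h3 := hw'.2.1
              have h4 := (mem_segments.1 (mem_reducedSegments.1 (G j).2).1).2
              have h5 : (G j).1.1.1 = (G j).1.2.1 := by
                rcases h4 with h4 | h4
                exacts [absurd h4.1 hor, h4.1]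
              unfold OnSegment at h2 h3
              exact Prod.ext (by omega) h1
          · intro t ht
            obtain ⟨v, hv, rfl⟩ := Finset.mem_image.1 ht
            rw [← hrow v hv]
            refine Finset.sum_congr rfl fun k _ => ?_
            rw [reducedMatrix_apply, if_pos (Finset.mem_filter.1 hv).2.1, if_neg hor]
    rintro ⟨s, k⟩
    have := congrFun (key _ (G.symm s) le_rfl) k
    rwa [Equiv.apply_symm_apply] at this
  rw [hli.rank_matrix]
  simp [Fintype.card_prod, mul_comm]

end RectMesh

/-! ### Univariate cubic splines and truncated powers -/

open Polynomial in
/-- The functions that agree with a cubic polynomial along the filter `l`. -/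
def cubics (l : Filter ℝ) : Submodule ℝ (ℝ → ℝ) where
  carrier := {g | ∃ q : ℝ[X], q.natDegree ≤ 3 ∧ ∀ᶠ x in l, g x = q.eval x}
  zero_mem' := ⟨0, by simp, by simp⟩
  add_mem' := by
    rintro f g ⟨p, hp, hp'⟩ ⟨q, hq, hq'⟩
    refine ⟨p + q, (natDegree_add_le _ _).trans (max_le hp hq), ?_⟩
    filter_upwards [hp', hq'] with x h1 h2
    simp [h1, h2]
  smul_mem' := by
    rintro a f ⟨p, hp, hp'⟩
    refine ⟨C a * p, (natDegree_C_mul_le _ _).trans hp, ?_⟩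
    filter_upwards [hp'] with x h1
    simp [h1]

theorem cubics_mono {l l' : Filter ℝ} (h : l ≤ l') : cubics l' ≤ cubics l := by
  rintro g ⟨q, hq, hq'⟩
  exact ⟨q, hq, h hq'⟩

theorem cubics_congr {l : Filter ℝ} {f g : ℝ → ℝ} (h : ∀ᶠ x in l, f x = g x) (hg : g ∈ cubics l) :
    f ∈ cubics l := by
  obtain ⟨q, hq, hq'⟩ := hg
  refine ⟨q, hq, ?_⟩
  filter_upwards [h, hq'] with x h1 h2
  rw [h1, h2]

/-- The truncated cubic power `(x - t)₊³`. -/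
noncomputable def truncPow (t x : ℝ) : ℝ := max (x - t) 0 ^ 3

theorem truncPow_of_le {t x : ℝ} (h : x ≤ t) : truncPow t x = 0 := by
  rw [truncPow, max_eq_right (by linarith)]
  norm_num

theorem truncPow_of_ge {t x : ℝ} (h : t ≤ x) : truncPow t x = (x - t) ^ 3 := by
  rw [truncPow, max_eq_left (by linarith)]

theorem hasDerivAt_max_pow (t : ℝ) (n : ℕ) (x : ℝ) :
    HasDerivAt (fun x => max (x - t) 0 ^ (n + 2)) ((n + 2) * max (x - t) 0 ^ (n + 1)) x := by
  have hpoly : ∀ x, HasDerivAt (fun x => (x - t) ^ (n + 2)) ((n + 2) * (x - t) ^ (n + 1)) x := by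
    intro x
    have := ((hasDerivAt_id' x).sub_const t).fun_pow (n + 2)
    simpa using this
  rcases lt_trichotomy x t with h | rfl | h
  · rw [max_eq_right (by linarith), zero_pow (by omega), mul_zero]
    refine (hasDerivAt_const x 0).congr_of_eventuallyEq ?_
    filter_upwards [Iio_mem_nhds h] with y hy
    rw [max_eq_right (by simp only [Set.mem_Iio] at hy; linarith), zero_pow (by omega)]
  · have h0 : ((n : ℝ) + 2) * max (x - x) 0 ^ (n + 1) = 0 := by simp
    rw [h0, ← hasDerivWithinAt_univ, ← Set.Iic_union_Ici (a := x)]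
    refine HasDerivWithinAt.union ?_ ?_
    · refine (hasDerivWithinAt_const x _ 0).congr (fun y hy => ?_) (by simp)
      rw [max_eq_right (by simp only [Set.mem_Iic] at hy; linarith), zero_pow (by omega)]
    · have := (hpoly x).hasDerivWithinAt (s := Set.Ici x)
      rw [sub_self, zero_pow (by omega), mul_zero] at this
      refine this.congr (fun y hy => ?_) (by simp)
      rw [max_eq_left (by simp only [Set.mem_Ici] at hy; linarith)]
  · rw [max_eq_left (by linarith)]
    refine (hpoly x).congr_of_eventuallyEq ?_
    filter_upwards [Ioi_mem_nhds h] with y hy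
    rw [max_eq_left (by simp only [Set.mem_Ioi] at hy; linarith)]

theorem contDiff_truncPow (t : ℝ) : ContDiff ℝ 2 (truncPow t) := by
  have h1 : ∀ x, HasDerivAt (truncPow t) (3 * max (x - t) 0 ^ 2) x := fun x => by
    have := hasDerivAt_max_pow t 1 x
    norm_num at this
    exact this
  have h2 : ∀ x, HasDerivAt (fun x => 3 * max (x - t) 0 ^ 2) (3 * (2 * max (x - t) 0)) x :=
    fun x => by
      have := (hasDerivAt_max_pow t 0 x).const_mul 3
      norm_num at this
      exact this
  rw [show (2 : WithTop ℕ∞) = 1 + 1 by norm_num, contDiff_succ_iff_deriv]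
  refine ⟨fun x => (h1 x).differentiableAt, by simp, ?_⟩
  rw [show deriv (truncPow t) = fun x => 3 * max (x - t) 0 ^ 2 from funext fun x => (h1 x).deriv,
    show (1 : WithTop ℕ∞) = 0 + 1 by norm_num, contDiff_succ_iff_deriv]
  refine ⟨fun x => (h2 x).differentiableAt, by simp, ?_⟩
  rw [show deriv (fun x => 3 * max (x - t) 0 ^ 2) = fun x => 3 * (2 * max (x - t) 0) from
    funext fun x => (h2 x).deriv, contDiff_zero]
  fun_prop

open Polynomial in
theorem truncPow_mem_cubics_of_ge {t : ℝ} {l : Filter ℝ} (h : ∀ᶠ x in l, t ≤ x) :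
    truncPow t ∈ cubics l := by
  refine ⟨(X - C t) ^ 3, ?_, ?_⟩
  · rw [natDegree_pow, natDegree_X_sub_C]
  · filter_upwards [h] with x hx
    rw [truncPow_of_ge hx]
    simp

theorem truncPow_mem_cubics_of_le {t : ℝ} {l : Filter ℝ} (h : ∀ᶠ x in l, x ≤ t) :
    truncPow t ∈ cubics l := by
  refine cubics_congr (g := 0) ?_ (Submodule.zero_mem _)
  filter_upwards [h] with x hx
  rw [truncPow_of_le hx, Pi.zero_apply]

open Polynomial Filter Topology in
/-- A `C²` function that vanishes to the left of `t` and is a cubic polynomial to the right of `t`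
is a multiple of `(x - t)³` there. -/
theorem exists_eq_mul_cube {h : ℝ → ℝ} (hh : ContDiff ℝ 2 h) {t : ℝ} {S : Set ℝ}
    (hS : S ∈ 𝓝[>] t) (h0 : ∀ x ≤ t, h x = 0) (hc : h ∈ cubics (𝓟 S)) :
    ∃ α : ℝ, ∀ x ∈ S, h x = α * (x - t) ^ 3 := by
  obtain ⟨q, hq, hq'⟩ := hc
  rw [eventually_principal] at hq'
  obtain ⟨s, hs, hsS⟩ := (mem_nhdsGT_iff_exists_Ioo_subset).1 hS
  have c1 : ContDiff ℝ 1 (deriv h) := by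
    rw [show (2 : WithTop ℕ∞) = 1 + 1 by norm_num, contDiff_succ_iff_deriv] at hh
    exact hh.2.2
  have c2 : ContDiff ℝ 0 (deriv (deriv h)) := by
    rw [show (1 : WithTop ℕ∞) = 0 + 1 by norm_num, contDiff_succ_iff_deriv] at c1
    exact c1.2.2
  have l0 : Set.EqOn h (fun _ => 0) (Set.Iio t) := fun x hx => h0 x (le_of_lt hx)
  have l1 : Set.EqOn (deriv h) (fun _ => 0) (Set.Iio t) := fun x hx => by
    rw [l0.deriv isOpen_Iio hx, deriv_const]
  have l2 : Set.EqOn (deriv (deriv h)) (fun _ => 0) (Set.Iio t) := fun x hx => by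
    rw [l1.deriv isOpen_Iio hx, deriv_const]
  have r0 : Set.EqOn h (fun x => q.eval x) (Set.Ioo t s) := fun x hx => hq' x (hsS hx)
  have r1 : Set.EqOn (deriv h) (fun x => (derivative q).eval x) (Set.Ioo t s) := fun x hx => by
    rw [r0.deriv isOpen_Ioo hx, Polynomial.deriv]
  have r2 : Set.EqOn (deriv (deriv h)) (fun x => (derivative (derivative q)).eval x)
      (Set.Ioo t s) := fun x hx => by
    rw [r1.deriv isOpen_Ioo hx, Polynomial.deriv]
  have mem1 : t ∈ closure (Set.Iio t) := by rw [closure_Iio]; exact Set.self_mem_Iic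
  have mem2 : t ∈ closure (Set.Ioo t s) := by
    rw [closure_Ioo (ne_of_lt hs)]; exact Set.left_mem_Icc.2 (le_of_lt hs)
  have e0 : q.eval t = 0 :=
    (r0.closure hh.continuous q.continuous mem2).symm.trans (h0 t le_rfl)
  have e1 : (derivative q).eval t = 0 :=
    (r1.closure c1.continuous (derivative q).continuous mem2).symm.trans
      (l1.closure c1.continuous continuous_const mem1)
  have e2 : (derivative (derivative q)).eval t = 0 :=
    (r2.closure c2.continuous (derivative (derivative q)).continuous mem2).symm.trans
      (l2.closure c2.continuous continuous_const mem1)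
  have hqe : q = C (q.coeff 3) * X ^ 3 + C (q.coeff 2) * X ^ 2 + C (q.coeff 1) * X
      + C (q.coeff 0) := by
    conv_lhs => rw [q.as_sum_range_C_mul_X_pow' (n := 4) (by omega)]
    simp only [Finset.sum_range_succ, Finset.sum_range_zero]
    ring
  generalize q.coeff 3 = a at hqe
  generalize q.coeff 2 = b at hqe
  generalize q.coeff 1 = c at hqe
  generalize q.coeff 0 = d at hqe
  rw [hqe] at e0 e1 e2
  simp at e0 e1 e2
  refine ⟨a, fun x hx => ?_⟩
  rw [hq' x hx, hqe]
  simp only [eval_add, eval_mul, eval_C, eval_pow, eval_X]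
  have hb : b = -3 * a * t := by linarith
  have hc' : c = 3 * a * t ^ 2 := by rw [hb] at e1; linarith
  have hd : d = -a * t ^ 3 := by rw [hb, hc'] at e0; linarith
  rw [hb, hc', hd]
  ring

open Filter Topology in
/-- A linear combination of truncated powers that is a polynomial near a knot does not involve
that knot. -/
theorem coeff_eq_zero_of_cubic {s : Finset ℤ} {ξ : ℤ → ℝ} (hξ : Set.InjOn ξ s) {α : ℤ → ℝ} {i : ℤ}
    (hi : i ∈ s) (h : (fun x => ∑ k ∈ s, α k * truncPow (ξ k) x) ∈ cubics (𝓝 (ξ i))) :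
    α i = 0 := by
  have h1 : (fun x => α i * truncPow (ξ i) x) ∈ cubics (𝓝 (ξ i)) := by
    have : (fun x => α i * truncPow (ξ i) x) = (fun x => ∑ k ∈ s, α k * truncPow (ξ k) x) -
        ∑ k ∈ s.erase i, α k • truncPow (ξ k) := by
      funext x
      simp only [Pi.sub_apply, Finset.sum_apply, Pi.smul_apply, smul_eq_mul]
      rw [← Finset.add_sum_erase s _ hi]
      ring
    rw [this]
    refine Submodule.sub_mem _ h (Submodule.sum_mem _ fun k hk => Submodule.smul_mem _ _ ?_)
    rw [Finset.mem_erase] at hk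
    have hne : ξ k ≠ ξ i := fun he => hk.1 (hξ hk.2 hi he)
    rcases lt_or_gt_of_ne hne with hlt | hgt
    · exact truncPow_mem_cubics_of_ge (eventually_ge_nhds hlt)
    · exact truncPow_mem_cubics_of_le (eventually_le_nhds hgt)
  obtain ⟨q, -, hq⟩ := h1
  have hq0 : q = 0 := by
    refine q.eq_zero_of_infinite_isRoot (Set.Infinite.mono (s := {x | x ∈ Set.Iio (ξ i) ∧
      α i * truncPow (ξ i) x = q.eval x}) ?_ ?_)
    · rintro x ⟨hx, hx'⟩
      rw [truncPow_of_le (le_of_lt hx), mul_zero] at hx'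
      exact hx'.symm
    · have : ∀ᶠ x in 𝓝[<] ξ i, x ∈ Set.Iio (ξ i) ∧ α i * truncPow (ξ i) x = q.eval x :=
        (eventually_mem_nhdsWithin).and (hq.filter_mono nhdsWithin_le_nhds)
      obtain ⟨r, hr, hrs⟩ := mem_nhdsLT_iff_exists_Ioo_subset.1 this
      exact (Set.Ioo_infinite hr).mono hrs
  have : ∀ᶠ x in 𝓝[>] ξ i, x ∈ Set.Ioi (ξ i) ∧ α i * truncPow (ξ i) x = q.eval x :=
    (eventually_mem_nhdsWithin).and (hq.filter_mono nhdsWithin_le_nhds)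
  obtain ⟨x, hx, hx'⟩ := this.exists
  rw [hq0, Polynomial.eval_zero, truncPow_of_ge (le_of_lt hx)] at hx'
  have : (x - ξ i) ^ 3 ≠ 0 := pow_ne_zero _ (sub_ne_zero.2 (ne_of_gt hx))
  exact (mul_eq_zero.1 hx').resolve_right this

/-- The univariate cubic splines with knots `ξ L < ⋯ < ξ R` that vanish outside
`[ξ L, ξ R]`. -/
def splines (ξ : ℤ → ℝ) (L R : ℤ) : Submodule ℝ (ℝ → ℝ) where
  carrier := {g | ContDiff ℝ 2 g ∧
    (∀ i, L ≤ i → i < R → g ∈ cubics (Filter.principal (Set.Ioo (ξ i) (ξ (i + 1))))) ∧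
    ∀ x, x ∉ Set.Icc (ξ L) (ξ R) → g x = 0}
  zero_mem' := ⟨contDiff_const, fun _ _ _ => Submodule.zero_mem _, fun _ _ => rfl⟩
  add_mem' := by
    rintro f g ⟨f1, f2, f3⟩ ⟨g1, g2, g3⟩
    exact ⟨f1.add g1, fun i h h' => Submodule.add_mem _ (f2 i h h') (g2 i h h'),
      fun x hx => by rw [Pi.add_apply, f3 x hx, g3 x hx, add_zero]⟩
  smul_mem' := by
    rintro a f ⟨f1, f2, f3⟩
    exact ⟨f1.const_smul a, fun i h h' => Submodule.smul_mem _ _ (f2 i h h'),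
      fun x hx => by rw [Pi.smul_apply, f3 x hx, smul_zero]⟩

/-- The linear functionals that are linear combinations of point evaluations. -/
def evalSpan : Submodule ℝ ((ℝ → ℝ) →ₗ[ℝ] ℝ) :=
  Submodule.span ℝ (Set.range fun x : ℝ => LinearMap.proj x)

theorem proj_mem_evalSpan (x : ℝ) : (LinearMap.proj x : (ℝ → ℝ) →ₗ[ℝ] ℝ) ∈ evalSpan :=
  Submodule.subset_span ⟨x, rfl⟩

open Filter Topology in
/-- Splines are linear combinations of truncated powers, with coefficients that are linear
combinations of values of the spline. The form of the coefficients makes it possible to apply the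
expansion to one of the variables of a bivariate spline. -/
theorem exists_coeff_functional {ξ : ℤ → ℝ} {L R : ℤ} (hLR : L ≤ R)
    (hξ : StrictMonoOn ξ (Set.Icc L R)) :
    ∃ Λ : ℤ → (ℝ → ℝ) →ₗ[ℝ] ℝ, (∀ i, Λ i ∈ evalSpan) ∧
      ∀ g ∈ splines ξ L R, ∀ x, g x = ∑ i ∈ Finset.Icc L R, Λ i g * truncPow (ξ i) x := by
  have hIco : ∀ m, L ≤ m → Finset.Ico L (m + 1) = insert m (Finset.Ico L m) := by
    intro m hm
    ext x
    simp only [Finset.mem_Ico, Finset.mem_insert]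
    omega
  have hnot : ∀ m, m ∉ Finset.Ico L m := fun m => by simp
  -- the difference of the spline and the part of the expansion found so far
  have hrest : ∀ (Λ : ℤ → (ℝ → ℝ) →ₗ[ℝ] ℝ) (g : ℝ → ℝ) (m : ℤ), g ∈ splines ξ L R →
      ContDiff ℝ 2 (g - ∑ i ∈ Finset.Ico L m, Λ i g • truncPow (ξ i)) := by
    intro Λ g m hg
    refine hg.1.sub ?_
    rw [show (∑ i ∈ Finset.Ico L m, Λ i g • truncPow (ξ i)) =
      fun x => ∑ i ∈ Finset.Ico L m, (Λ i g • truncPow (ξ i)) x by funext x; simp]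
    exact ContDiff.sum fun i _ => (contDiff_truncPow (ξ i)).const_smul (Λ i g)
  have hrest' : ∀ (Λ : ℤ → (ℝ → ℝ) →ₗ[ℝ] ℝ) (g : ℝ → ℝ) (m : ℤ) (S : Set ℝ), m ≤ R →
      L ≤ m → S ⊆ Set.Ici (ξ m) → g ∈ cubics (𝓟 S) →
      (g - ∑ i ∈ Finset.Ico L m, Λ i g • truncPow (ξ i)) ∈ cubics (𝓟 S) := by
    intro Λ g m S hmR hLm hS hg
    refine Submodule.sub_mem _ hg (Submodule.sum_mem _ fun i hi => Submodule.smul_mem _ _ ?_)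
    rw [Finset.mem_Ico] at hi
    refine truncPow_mem_cubics_of_ge (eventually_principal.2 fun x hx => ?_)
    exact (hξ ⟨hi.1, by omega⟩ ⟨hLm, hmR⟩ hi.2).le.trans (hS hx)
  have main : ∀ m, L ≤ m → m ≤ R → ∃ Λ : ℤ → (ℝ → ℝ) →ₗ[ℝ] ℝ, (∀ i, Λ i ∈ evalSpan) ∧
      ∀ g ∈ splines ξ L R, ∀ x ≤ ξ m,
        (g - ∑ i ∈ Finset.Ico L m, Λ i g • truncPow (ξ i)) x = 0 := by
    intro m hm
    induction m, hm using Int.leInduction with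
    | base =>
      refine fun _ => ⟨0, fun i => Submodule.zero_mem _, fun g hg x hx => ?_⟩
      have hE : Set.EqOn g (fun _ => 0) (Set.Iio (ξ L)) := fun y hy =>
        hg.2.2 y fun hy' => absurd hy'.1 (not_le.2 hy)
      have := hE.closure hg.1.continuous continuous_const
      rw [closure_Iio] at this
      simpa using this hx
    | succ m hm ih =>
      intro hmR
      obtain ⟨Λ, h1, h2⟩ := ih (by omega)
      have hlt : ξ m < ξ (m + 1) := hξ ⟨hm, by omega⟩ ⟨by omega, hmR⟩ (by omega)
      -- the new coefficient is read off at the next knot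
      set N : (ℝ → ℝ) →ₗ[ℝ] ℝ := ((ξ (m + 1) - ξ m) ^ 3)⁻¹ •
        (LinearMap.proj (ξ (m + 1)) -
          ∑ i ∈ Finset.Ico L m, truncPow (ξ i) (ξ (m + 1)) • Λ i) with hN
      refine ⟨Function.update Λ m N, fun i => ?_, fun g hg x hx => ?_⟩
      · rcases eq_or_ne i m with rfl | hne
        · rw [Function.update_self]
          exact Submodule.smul_mem _ _ (Submodule.sub_mem _ (proj_mem_evalSpan _)
            (Submodule.sum_mem _ fun i _ => Submodule.smul_mem _ _ (h1 i)))
        · rw [Function.update_of_ne hne]; exact h1 i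
      · have hsum : ∑ i ∈ Finset.Ico L (m + 1), (Function.update Λ m N) i g • truncPow (ξ i) =
            N g • truncPow (ξ m) + ∑ i ∈ Finset.Ico L m, Λ i g • truncPow (ξ i) := by
          rw [hIco m hm, Finset.sum_insert (hnot m), Function.update_self]
          congr 1
          refine Finset.sum_congr rfl fun i hi => ?_
          rw [Function.update_of_ne]
          rintro rfl
          exact hnot _ hi
        set h := g - ∑ i ∈ Finset.Ico L m, Λ i g • truncPow (ξ i) with hh
        obtain ⟨α, hα⟩ := exists_eq_mul_cube (hrest Λ g m hg) (S := Set.Ioo (ξ m) (ξ (m + 1)))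
          (Ioo_mem_nhdsGT hlt) (h2 g hg)
          (hrest' Λ g m _ (by omega) hm (fun x hx => hx.1.le) (hg.2.1 m hm (by omega)))
        have hα' : Set.EqOn h (fun x => α * (x - ξ m) ^ 3) (Set.Icc (ξ m) (ξ (m + 1))) := by
          have := Set.EqOn.closure (s := Set.Ioo (ξ m) (ξ (m + 1))) (f := h)
            (g := fun x => α * (x - ξ m) ^ 3) hα (hrest Λ g m hg).continuous (by fun_prop)
          rwa [closure_Ioo hlt.ne] at this
        have hNα : N g = α := by
          have e := hα' (Set.right_mem_Icc.2 hlt.le)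
          have hne : (ξ (m + 1) - ξ m) ^ 3 ≠ 0 := pow_ne_zero _ (sub_ne_zero.2 hlt.ne')
          have : N g = ((ξ (m + 1) - ξ m) ^ 3)⁻¹ * h (ξ (m + 1)) := by
            rw [hN, hh]
            simp only [LinearMap.smul_apply, LinearMap.sub_apply, LinearMap.proj_apply,
              LinearMap.sum_apply, smul_eq_mul, Pi.sub_apply, Finset.sum_apply, Pi.smul_apply]
            congr 2
            exact Finset.sum_congr rfl fun i _ => mul_comm _ _
          rw [this, e]
          simp only
          rw [mul_comm α, inv_mul_cancel_left₀ hne]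
        rw [hsum, hNα]
        have : (g - (α • truncPow (ξ m) + ∑ i ∈ Finset.Ico L m, Λ i g • truncPow (ξ i))) x =
            h x - α * truncPow (ξ m) x := by
          rw [hh]
          simp only [Pi.sub_apply, Pi.add_apply, Pi.smul_apply, smul_eq_mul]
          ring
        rw [this]
        rcases le_total x (ξ m) with hx' | hx'
        · have h0 := h2 g hg x hx'
          rw [← hh] at h0
          rw [h0, truncPow_of_le hx']
          ring
        · rw [hα' ⟨hx', hx⟩, truncPow_of_ge hx']
          simp
  obtain ⟨Λ, h1, h2⟩ := main R hLR le_rfl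
  -- beyond the last knot the spline vanishes, and the coefficient can be read off anywhere
  set N : (ℝ → ℝ) →ₗ[ℝ] ℝ := LinearMap.proj (ξ R + 1) -
    ∑ i ∈ Finset.Ico L R, truncPow (ξ i) (ξ R + 1) • Λ i with hN
  refine ⟨Function.update Λ R N, fun i => ?_, fun g hg x => ?_⟩
  · rcases eq_or_ne i R with rfl | hne
    · rw [Function.update_self]
      exact Submodule.sub_mem _ (proj_mem_evalSpan _)
        (Submodule.sum_mem _ fun i _ => Submodule.smul_mem _ _ (h1 i))
    · rw [Function.update_of_ne hne]; exact h1 i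
  · have hIcc : Finset.Icc L R = insert R (Finset.Ico L R) := by
      ext x
      simp only [Finset.mem_Icc, Finset.mem_Ico, Finset.mem_insert]
      omega
    have hsum : ∑ i ∈ Finset.Icc L R, (Function.update Λ R N) i g * truncPow (ξ i) x =
        N g * truncPow (ξ R) x + ∑ i ∈ Finset.Ico L R, Λ i g * truncPow (ξ i) x := by
      rw [hIcc, Finset.sum_insert (hnot R), Function.update_self]
      congr 1
      refine Finset.sum_congr rfl fun i hi => ?_
      rw [Function.update_of_ne]
      rintro rfl
      exact hnot _ hi
    set h := g - ∑ i ∈ Finset.Ico L R, Λ i g • truncPow (ξ i) with hh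
    have hhx : ∀ x, h x = g x - ∑ i ∈ Finset.Ico L R, Λ i g * truncPow (ξ i) x := by
      intro x
      rw [hh]
      simp only [Pi.sub_apply, Finset.sum_apply, Pi.smul_apply, smul_eq_mul]
    obtain ⟨α, hα⟩ := exists_eq_mul_cube (hrest Λ g R hg) (S := Set.Ioi (ξ R))
      self_mem_nhdsWithin (h2 g hg)
      (hrest' Λ g R _ le_rfl hLR (fun x hx => le_of_lt (Set.mem_Ioi.1 hx))
        (cubics_congr (g := 0) (eventually_principal.2 fun x hx =>
          hg.2.2 x fun hx' => absurd hx'.2 (not_le.2 hx)) (Submodule.zero_mem _)))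
    have hNα : N g = α := by
      have e := hα (ξ R + 1) (by simp)
      rw [← hh, hhx] at e
      have : N g = g (ξ R + 1) - ∑ i ∈ Finset.Ico L R, Λ i g * truncPow (ξ i) (ξ R + 1) := by
        rw [hN]
        simp only [LinearMap.smul_apply, LinearMap.sub_apply, LinearMap.proj_apply,
          LinearMap.sum_apply, smul_eq_mul]
        congr 1
        exact Finset.sum_congr rfl fun i _ => mul_comm _ _
      rw [this, e]
      ring
    rw [hsum, hNα]
    have hx1 := hhx x
    rcases le_or_gt x (ξ R) with hx' | hx'
    · have := h2 g hg x hx'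
      rw [← hh] at this
      rw [truncPow_of_le hx', mul_zero, zero_add]
      linarith
    · have := hα x hx'
      rw [← hh] at this
      rw [truncPow_of_ge hx'.le]
      linarith

/-- A functional made of point evaluations can be applied to one variable without leaving a
given linear space of functions in the other. -/
theorem evalSpan_apply_mem {V : Submodule ℝ (ℝ → ℝ)} {f : ℝ × ℝ → ℝ}
    (h : ∀ x, (fun y => f (x, y)) ∈ V) {Λ : (ℝ → ℝ) →ₗ[ℝ] ℝ} (hΛ : Λ ∈ evalSpan) :
    (fun y => Λ fun x => f (x, y)) ∈ V := by
  induction hΛ using Submodule.span_induction with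
  | mem Λ hΛ =>
    obtain ⟨x, rfl⟩ := hΛ
    exact h x
  | zero => exact Submodule.zero_mem _
  | add Λ M _ _ h1 h2 => exact Submodule.add_mem _ h1 h2
  | smul a Λ _ h1 => exact Submodule.smul_mem _ a h1

/-! ### Bicubic splines and smoothing cofactors -/

theorem IsC22.mul_of_contDiff {g h : ℝ → ℝ} (hg : ContDiff ℝ 2 g) (hh : ContDiff ℝ 2 h) :
    IsC22 fun p => g p.1 * h p.2 := by
  refine ⟨fun y => hg.mul (contDiff_const (c := h y)),
    fun x => (contDiff_const (c := g x)).mul hh, fun k hk => ?_⟩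
  have hk' : ((k : ℕ∞) : WithTop ℕ∞) ≤ 2 :=
    WithTop.coe_le_coe.mpr ((Nat.cast_le (α := ℕ∞) (n := 2)).mpr hk)
  have e1 : ∀ p : ℝ × ℝ, iteratedDeriv k (fun x => g x * h p.2) p.1 =
      h p.2 * iteratedDeriv k g p.1 := fun p => by
    simp only [mul_comm _ (h p.2)]
    exact iteratedDeriv_const_mul_field (h p.2) g
  have e2 : ∀ p : ℝ × ℝ, iteratedDeriv k (fun y => g p.1 * h y) p.2 =
      g p.1 * iteratedDeriv k h p.2 := fun p => iteratedDeriv_const_mul_field (g p.1) h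
  refine ⟨?_, ?_⟩
  · simp only [e1]
    exact (hh.continuous.comp continuous_snd).mul
      ((hg.continuous_iteratedDeriv k hk').comp continuous_fst)
  · simp only [e2]
    exact (hg.continuous.comp continuous_fst).mul
      ((hh.continuous_iteratedDeriv k hk').comp continuous_snd)

theorem IsC22.sum {ι : Type*} {s : Finset ι} {f : ι → ℝ × ℝ → ℝ} (h : ∀ i ∈ s, IsC22 (f i)) :
    IsC22 (∑ i ∈ s, f i) := by
  classical
  induction s using Finset.induction_on with
  | empty => exact IsC22.zero
  | insert a s ha ih =>
    rw [Finset.sum_insert ha]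
    exact (h a (Finset.mem_insert_self a s)).add
      (ih fun i hi => h i (Finset.mem_insert_of_mem hi))

open Polynomial in
theorem sub_cube_eq_sum (t x : ℝ) :
    (x - t) ^ 3 = ∑ k : Fin 4, ((X - C t) ^ 3 : ℝ[X]).coeff k * x ^ (k : ℕ) := by
  have h : (x - t) ^ 3 = ((X - C t) ^ 3 : ℝ[X]).eval x := by simp
  rw [h, eval_eq_sum_range' (n := 4) (by rw [natDegree_pow, natDegree_X_sub_C]; norm_num),
    Finset.sum_range]

theorem isBicubicOn_sum {s : Finset (ℤ × ℤ)} {d : ℤ × ℤ → ℝ} {ξ η : ℤ → ℝ} {f : ℝ × ℝ → ℝ}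
    {A : Set (ℝ × ℝ)}
    (h : ∀ p ∈ A, f p = ∑ v ∈ s, d v * (p.1 - ξ v.1) ^ 3 * (p.2 - η v.2) ^ 3) :
    IsBicubicOn f A := by
  refine ⟨fun k l => ∑ v ∈ s, d v * ((Polynomial.X - Polynomial.C (ξ v.1)) ^ 3).coeff k *
    ((Polynomial.X - Polynomial.C (η v.2)) ^ 3).coeff l, fun p hp => ?_⟩
  rw [h p hp]
  simp only [sub_cube_eq_sum, Finset.sum_mul, Finset.mul_sum]
  rw [Finset.sum_comm' (t' := Finset.univ) (s' := fun _ => s) (by simp)]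
  refine (Finset.sum_congr rfl fun l _ => ?_).trans Finset.sum_comm
  rw [Finset.sum_comm]
  refine Finset.sum_congr rfl fun k _ => Finset.sum_congr rfl fun v _ => ?_
  ring

theorem isBicubicOn_swap {f : ℝ × ℝ → ℝ} {A : Set (ℝ × ℝ)} (h : IsBicubicOn f A) :
    IsBicubicOn (fun p => f p.swap) (Prod.swap ⁻¹' A) := by
  obtain ⟨c, hc⟩ := h
  refine ⟨fun i j => c j i, fun p hp => ?_⟩
  refine (hc _ hp).trans ?_
  rw [Finset.sum_comm]
  refine Finset.sum_congr rfl fun i _ => Finset.sum_congr rfl fun j _ => ?_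
  simp only [Prod.fst_swap, Prod.snd_swap]
  ring

open Polynomial Filter in
theorem IsBicubicOn.mem_cubics {f : ℝ × ℝ → ℝ} {A B : Set ℝ} (h : IsBicubicOn f (A ×ˢ B)) {y : ℝ}
    (hy : y ∈ B) : (fun x => f (x, y)) ∈ cubics (𝓟 A) := by
  obtain ⟨c, hc⟩ := h
  refine ⟨∑ i : Fin 4, C (∑ j : Fin 4, c i j * y ^ (j : ℕ)) * X ^ (i : ℕ), ?_, ?_⟩
  · refine natDegree_sum_le_of_forall_le _ _ fun i _ => ?_
    exact (natDegree_C_mul_X_pow_le _ _).trans (by have := i.2; omega)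
  · rw [eventually_principal]
    intro x hx
    refine (hc (x, y) ⟨hx, hy⟩).trans ?_
    rw [eval_finsetSum]
    refine Finset.sum_congr rfl fun i _ => ?_
    simp only [eval_mul, eval_C, eval_pow, eval_X, Finset.sum_mul]
    refine Finset.sum_congr rfl fun j _ => ?_
    ring

/-- A combination of cubes that vanishes on a nonempty open interval vanishes identically. -/
theorem sum_cubes_eq_zero {s : Finset ℤ} {α η : ℤ → ℝ} {a b : ℝ} (hab : a < b)
    (h : ∀ y ∈ Set.Ioo a b, ∑ j ∈ s, α j * (y - η j) ^ 3 = 0) (y : ℝ) :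
    ∑ j ∈ s, α j * (y - η j) ^ 3 = 0 := by
  set q : Polynomial ℝ :=
    ∑ j ∈ s, Polynomial.C (α j) * (Polynomial.X - Polynomial.C (η j)) ^ 3 with hq
  have hev : ∀ y, q.eval y = ∑ j ∈ s, α j * (y - η j) ^ 3 := fun y => by
    rw [hq, Polynomial.eval_finsetSum]
    simp
  have : q = 0 := q.eq_zero_of_infinite_isRoot ((Set.Ioo_infinite hab).mono fun y hy => by
    rw [Set.mem_ofPred_eq, Polynomial.IsRoot, hev, h y hy])
  rw [← hev, this, Polynomial.eval_zero]

/-- Between two consecutive knots only the truncated powers of the knots to the left count. -/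
theorem sum_truncPow_eq {η α : ℤ → ℝ} {B T b : ℤ} (hη : StrictMonoOn η (Set.Icc B T)) (hb : B ≤ b)
    (hb' : b ≤ T) {y : ℝ} (h1 : η b ≤ y) (h2 : b < T → y ≤ η (b + 1)) :
    ∑ j ∈ Finset.Icc B T, α j * truncPow (η j) y = ∑ j ∈ Finset.Icc B b, α j * (y - η j) ^ 3 := by
  have hsub : Finset.Icc B b ⊆ Finset.Icc B T := Finset.Icc_subset_Icc_right hb'
  rw [← Finset.sum_subset hsub]
  · refine Finset.sum_congr rfl fun j hj => ?_
    rw [Finset.mem_Icc] at hj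
    rw [truncPow_of_ge]
    exact (hη.monotoneOn ⟨hj.1, by omega⟩ ⟨hb, hb'⟩ hj.2).trans h1
  · intro j hj hj'
    rw [Finset.mem_Icc] at hj hj'
    rw [truncPow_of_le, mul_zero]
    exact (h2 (by omega)).trans (hη.monotoneOn ⟨by omega, by omega⟩ ⟨hj.1, hj.2⟩ (by omega))

theorem exists_knot_interval {η : ℤ → ℝ} {b t : ℤ} {y : ℝ} (hbt : b < t) (h1 : η b ≤ y)
    (h2 : y ≤ η t) : ∃ m, b ≤ m ∧ m < t ∧ η m ≤ y ∧ y ≤ η (m + 1) := by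
  obtain ⟨m, ⟨m1, m2, m3⟩, hm⟩ := Int.exists_greatest_of_bdd
    (P := fun m => b ≤ m ∧ m < t ∧ η m ≤ y) ⟨t, fun z hz => hz.2.1.le⟩ ⟨b, le_rfl, hbt, h1⟩
  refine ⟨m, m1, m2, m3, ?_⟩
  rcases eq_or_ne (m + 1) t with he | he
  · rwa [he]
  · by_contra hlt
    have := hm (m + 1) ⟨by omega, by omega, (not_le.1 hlt).le⟩
    omega

namespace RectMesh

variable {X T : RectMesh}

/-- The cofactors along the columns cancel across every vertical unit edge that is not in the
skeleton. -/
def ColCond (X : RectMesh) (η : ℤ → ℝ) (d : ℤ × ℤ → ℝ) : Prop :=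
  ∀ i b, X.left ≤ i → i ≤ X.right → X.bottom ≤ b → b ≤ X.top → ¬ X.VUnit i b →
    ∀ y : ℝ, ∑ j ∈ Finset.Icc X.bottom b, d (i, j) * (y - η j) ^ 3 = 0

/-- The cofactors along the rows cancel across every horizontal unit edge that is not in the
skeleton. -/
def RowCond (X : RectMesh) (ξ : ℤ → ℝ) (d : ℤ × ℤ → ℝ) : Prop :=
  ∀ j a, X.bottom ≤ j → j ≤ X.top → X.left ≤ a → a ≤ X.right → ¬ X.HUnit a j →
    ∀ x : ℝ, ∑ i ∈ Finset.Icc X.left a, d (i, j) * (x - ξ i) ^ 3 = 0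

theorem colCond_swap {ξ : ℤ → ℝ} {d : ℤ × ℤ → ℝ} :
    X.swap.ColCond ξ (fun p => d p.swap) ↔ X.RowCond ξ d := by
  unfold ColCond RowCond
  simp only [vUnit_swap, Prod.swap_prod_mk]
  rfl

/-- The vertex cofactors of the splines on the mesh `X`: the functions that vanish off the index
domain and satisfy the smoothness conditions across all unit edges. -/
def cofactorSpace (X : RectMesh) (ξ η : ℤ → ℝ) : Submodule ℝ (ℤ × ℤ → ℝ) where
  carrier := {d | (∀ p ∉ X.box, d p = 0) ∧ X.RowCond ξ d ∧ X.ColCond η d}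
  zero_mem' := ⟨fun _ _ => rfl, fun _ _ _ _ _ _ _ _ => by simp, fun _ _ _ _ _ _ _ _ => by simp⟩
  add_mem' := by
    rintro d e ⟨d1, d2, d3⟩ ⟨e1, e2, e3⟩
    refine ⟨fun p hp => by rw [Pi.add_apply, d1 p hp, e1 p hp, add_zero],
      fun j a h1 h2 h3 h4 h5 x => ?_, fun i b h1 h2 h3 h4 h5 y => ?_⟩
    · simp only [Pi.add_apply, add_mul, Finset.sum_add_distrib]
      rw [d2 j a h1 h2 h3 h4 h5, e2 j a h1 h2 h3 h4 h5, add_zero]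
    · simp only [Pi.add_apply, add_mul, Finset.sum_add_distrib]
      rw [d3 i b h1 h2 h3 h4 h5, e3 i b h1 h2 h3 h4 h5, add_zero]
  smul_mem' := by
    rintro r d ⟨d1, d2, d3⟩
    refine ⟨fun p hp => by rw [Pi.smul_apply, d1 p hp, smul_zero],
      fun j a h1 h2 h3 h4 h5 x => ?_, fun i b h1 h2 h3 h4 h5 y => ?_⟩
    · simp only [Pi.smul_apply, smul_eq_mul, mul_assoc]
      rw [← Finset.mul_sum, d2 j a h1 h2 h3 h4 h5, mul_zero]
    · simp only [Pi.smul_apply, smul_eq_mul, mul_assoc]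
      rw [← Finset.mul_sum, d3 i b h1 h2 h3 h4 h5, mul_zero]

/-- The function with given vertex cofactors. -/
noncomputable def ofCofactors (X : RectMesh) (ξ η : ℤ → ℝ) :
    (ℤ × ℤ → ℝ) →ₗ[ℝ] (ℝ × ℝ → ℝ) where
  toFun d p := ∑ v ∈ X.box, d v * (truncPow (ξ v.1) p.1 * truncPow (η v.2) p.2)
  map_add' d e := by
    funext p
    simp only [Pi.add_apply, add_mul, Finset.sum_add_distrib]
  map_smul' r d := by
    funext p
    simp only [Pi.smul_apply, smul_eq_mul, RingHom.id_apply, Finset.mul_sum, mul_assoc]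

theorem ofCofactors_apply {ξ η : ℤ → ℝ} {d : ℤ × ℤ → ℝ} {x y : ℝ} : X.ofCofactors ξ η d (x, y) =
    ∑ i ∈ Finset.Icc X.left X.right,
      (∑ j ∈ Finset.Icc X.bottom X.top, d (i, j) * truncPow (η j) y) * truncPow (ξ i) x := by
  change ∑ v ∈ X.box, _ = _
  rw [box, Finset.sum_product]
  refine Finset.sum_congr rfl fun i _ => ?_
  rw [Finset.sum_mul]
  refine Finset.sum_congr rfl fun j _ => ?_
  ring

theorem ofCofactors_swap {ξ η : ℤ → ℝ} {d : ℤ × ℤ → ℝ} {x y : ℝ} :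
    X.swap.ofCofactors η ξ (fun p => d p.swap) (y, x) = X.ofCofactors ξ η d (x, y) := by
  change ∑ v ∈ X.swap.box, _ = ∑ v ∈ X.box, _
  rw [box, box, Finset.sum_product, Finset.sum_product, Finset.sum_comm]
  refine Finset.sum_congr rfl fun i _ => Finset.sum_congr rfl fun j _ => ?_
  simp only [Prod.swap_prod_mk]
  ring

theorem isC22_ofCofactors {ξ η : ℤ → ℝ} {d : ℤ × ℤ → ℝ} : IsC22 (X.ofCofactors ξ η d) := by
  have : X.ofCofactors ξ η d =
      ∑ v ∈ X.box, d v • fun p : ℝ × ℝ => truncPow (ξ v.1) p.1 * truncPow (η v.2) p.2 := by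
    funext p
    simp only [Finset.sum_apply, Pi.smul_apply, smul_eq_mul]
    rfl
  rw [this]
  exact IsC22.sum fun v _ =>
    (IsC22.mul_of_contDiff (contDiff_truncPow _) (contDiff_truncPow _)).smul _

/-- A column that crosses a face contributes nothing there. -/
theorem ColCond.sum_eq_zero {η : ℤ → ℝ} (hη : StrictMonoOn η (Set.Icc X.bottom X.top))
    {d : ℤ × ℤ → ℝ} (hd : X.ColCond η d) {Q : IntRect} (hQ : Q ∈ X.faces) (hX : X.IsTMesh) {i : ℤ}
    (h1 : Q.left < i) (h2 : i < Q.right) {y : ℝ} (hy : y ∈ Set.Ioo (η Q.bottom) (η Q.top)) :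
    ∑ j ∈ Finset.Icc X.bottom X.top, d (i, j) * truncPow (η j) y = 0 := by
  have hb := hX.2.2.1 Q hQ
  obtain ⟨m, m1, m2, m3, m4⟩ := exists_knot_interval Q.bottom_lt_top hy.1.le hy.2.le
  rw [sum_truncPow_eq (α := fun j => d (i, j)) hη (b := m) (by omega) (by omega) m3 fun _ => m4]
  refine hd i m (by omega) (by omega) (by omega) (by omega) ?_ y
  rw [not_vUnit_iff (by omega) (by omega) (by omega) (by omega)]
  exact ⟨Q, hQ, by unfold IntRect.HasCell; omega, by unfold IntRect.HasCell; omega⟩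

theorem isBicubicOn_ofCofactors (hX : X.IsTMesh) {ξ η : ℤ → ℝ}
    (hξ : StrictMonoOn ξ (Set.Icc X.left X.right)) (hη : StrictMonoOn η (Set.Icc X.bottom X.top))
    {d : ℤ × ℤ → ℝ} (hr : X.RowCond ξ d) (hc : X.ColCond η d) {Q : IntRect} (hQ : Q ∈ X.faces) :
    IsBicubicOn (X.ofCofactors ξ η d)
      (Set.Ioo (ξ Q.left) (ξ Q.right) ×ˢ Set.Ioo (η Q.bottom) (η Q.top)) := by
  have hb := hX.2.2.1 Q hQ
  have hlr := Q.left_lt_right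
  have hbt := Q.bottom_lt_top
  refine isBicubicOn_sum (s := Finset.Icc X.left Q.left ×ˢ Finset.Icc X.bottom Q.bottom) (d := d)
    (ξ := ξ) (η := η) ?_
  rintro ⟨x, y⟩ ⟨hx, hy⟩
  simp only at hx hy
  have e1 : X.ofCofactors ξ η d (x, y) = ∑ i ∈ Finset.Icc X.left Q.left,
      (∑ j ∈ Finset.Icc X.bottom X.top, d (i, j) * truncPow (η j) y) * (x - ξ i) ^ 3 := by
    rw [ofCofactors_apply,
      ← Finset.sum_subset (Finset.Icc_subset_Icc_right (by omega : Q.left ≤ X.right))]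
    · refine Finset.sum_congr rfl fun i hi => ?_
      rw [Finset.mem_Icc] at hi
      rw [truncPow_of_ge]
      exact (hξ.monotoneOn ⟨hi.1, by omega⟩ ⟨by omega, by omega⟩ hi.2).trans hx.1.le
    · intro i hi hi'
      rw [Finset.mem_Icc] at hi hi'
      rcases lt_or_ge i Q.right with h | h
      · rw [hc.sum_eq_zero hη hQ hX (by omega) h hy, zero_mul]
      · rw [truncPow_of_le, mul_zero]
        exact hx.2.le.trans (hξ.monotoneOn ⟨by omega, by omega⟩ ⟨hi.1, hi.2⟩ h)
  have e2 : X.ofCofactors ξ η d (x, y) = ∑ j ∈ Finset.Icc X.bottom X.top,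
      (∑ i ∈ Finset.Icc X.left Q.left, d (i, j) * (x - ξ i) ^ 3) * truncPow (η j) y := by
    rw [e1]
    simp only [Finset.sum_mul]
    rw [Finset.sum_comm]
    refine Finset.sum_congr rfl fun j _ => Finset.sum_congr rfl fun i _ => ?_
    ring
  rw [e2, ← Finset.sum_subset (Finset.Icc_subset_Icc_right (by omega : Q.bottom ≤ X.top)),
    Finset.sum_product, Finset.sum_comm]
  · refine Finset.sum_congr rfl fun j hj => ?_
    rw [Finset.mem_Icc] at hj
    rw [truncPow_of_ge, Finset.sum_mul]
    exact (hη.monotoneOn ⟨hj.1, by omega⟩ ⟨by omega, by omega⟩ hj.2).trans hy.1.le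
  · intro j hj hj'
    rw [Finset.mem_Icc] at hj hj'
    rcases lt_or_ge j Q.top with h | h
    · rw [hr j Q.left (by omega) (by omega) (by omega) (by omega) ?_ x, zero_mul]
      rw [not_hUnit_iff (by omega) (by omega) (by omega) (by omega)]
      exact ⟨Q, hQ, by unfold IntRect.HasCell; omega, by unfold IntRect.HasCell; omega⟩
    · rw [truncPow_of_le, mul_zero]
      exact hy.2.le.trans (hη.monotoneOn ⟨by omega, by omega⟩ ⟨hj.1, hj.2⟩ h)

theorem ofCofactors_eq_zero_of_col (hX : X.IsTMesh) {ξ η : ℤ → ℝ}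
    (hη : StrictMonoOn η (Set.Icc X.bottom X.top)) {d : ℤ × ℤ → ℝ} (hc : X.ColCond η d) {x y : ℝ}
    (hy : y ∉ Set.Icc (η X.bottom) (η X.top)) : X.ofCofactors ξ η d (x, y) = 0 := by
  have hbt := hX.2.1
  rw [ofCofactors_apply]
  refine Finset.sum_eq_zero fun i hi => ?_
  rw [Finset.mem_Icc] at hi
  rcases lt_or_ge y (η X.bottom) with h | h
  · rw [Finset.sum_eq_zero, zero_mul]
    intro j hj
    rw [Finset.mem_Icc] at hj
    rw [truncPow_of_le, mul_zero]
    exact h.le.trans (hη.monotoneOn ⟨le_rfl, hbt.le⟩ ⟨hj.1, hj.2⟩ hj.1)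
  · have hlt : η X.top < y := not_le.1 fun h' => hy ⟨h, h'⟩
    rw [sum_truncPow_eq (α := fun j => d (i, j)) hη hbt.le le_rfl hlt.le
        fun h => absurd h (lt_irrefl _),
      hc i X.top hi.1 hi.2 hbt.le le_rfl (fun h => absurd h.2.2.2.1 (lt_irrefl _)) y, zero_mul]

theorem ofCofactors_eq_zero (hX : X.IsTMesh) {ξ η : ℤ → ℝ}
    (hξ : StrictMonoOn ξ (Set.Icc X.left X.right)) (hη : StrictMonoOn η (Set.Icc X.bottom X.top))
    {d : ℤ × ℤ → ℝ} (hr : X.RowCond ξ d) (hc : X.ColCond η d) {p : ℝ × ℝ}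
    (hp : p ∉ Set.Icc (ξ X.left) (ξ X.right) ×ˢ Set.Icc (η X.bottom) (η X.top)) :
    X.ofCofactors ξ η d p = 0 := by
  obtain ⟨x, y⟩ := p
  by_cases hy : y ∈ Set.Icc (η X.bottom) (η X.top)
  · rw [← ofCofactors_swap]
    exact ofCofactors_eq_zero_of_col hX.swap hξ (colCond_swap.2 hr) fun hx => hp ⟨hx, hy⟩
  · exact ofCofactors_eq_zero_of_col hX hη hc hy

/-- The coefficient of a knot line in a function that is cubic across that line vanishes. -/
theorem colSum_eq_zero {ξ η : ℤ → ℝ} (hξ : StrictMonoOn ξ (Set.Icc X.left X.right))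
    {d : ℤ × ℤ → ℝ} {i : ℤ} (hi : X.left ≤ i) (hi' : i ≤ X.right) {y : ℝ}
    (h : (fun x => X.ofCofactors ξ η d (x, y)) ∈ cubics (nhds (ξ i))) :
    ∑ j ∈ Finset.Icc X.bottom X.top, d (i, j) * truncPow (η j) y = 0 := by
  simp only [ofCofactors_apply] at h
  refine coeff_eq_zero_of_cubic (s := Finset.Icc X.left X.right) ?_ (Finset.mem_Icc.2 ⟨hi, hi'⟩) h
  rw [Finset.coe_Icc]
  exact hξ.injOn

theorem colCond_of_spline (hX : X.IsTMesh) {ξ η : ℤ → ℝ}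
    (hξ : StrictMonoOn ξ (Set.Icc X.left X.right)) (hη : StrictMonoOn η (Set.Icc X.bottom X.top))
    {d : ℤ × ℤ → ℝ}
    (hbic : ∀ Q ∈ X.faces, IsBicubicOn (X.ofCofactors ξ η d)
      (Set.Ioo (ξ Q.left) (ξ Q.right) ×ˢ Set.Ioo (η Q.bottom) (η Q.top)))
    (hout : ∀ p, p ∉ Set.Icc (ξ X.left) (ξ X.right) ×ˢ Set.Icc (η X.bottom) (η X.top) →
      X.ofCofactors ξ η d p = 0) : X.ColCond η d := by
  intro i b h1 h2 h3 h4 h5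
  rcases lt_or_eq_of_le h4 with hlt | rfl
  · obtain ⟨Q, hQ, q1, q2⟩ := (not_vUnit_iff h1 h2 h3 hlt).1 h5
    have hb := hX.2.2.1 Q hQ
    unfold IntRect.HasCell at q1 q2
    have hlt' : η b < η (b + 1) := hη ⟨h3, by omega⟩ ⟨by omega, by omega⟩ (by omega)
    refine sum_cubes_eq_zero hlt' fun y hy => ?_
    rw [← sum_truncPow_eq (α := fun j => d (i, j)) hη h3 h4 hy.1.le fun _ => hy.2.le]
    refine colSum_eq_zero hξ h1 h2 (cubics_mono ?_ ((hbic Q hQ).mem_cubics (y := y) ?_))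
    · rw [Filter.le_principal_iff]
      exact Ioo_mem_nhds (hξ ⟨by omega, by omega⟩ ⟨h1, h2⟩ (by omega))
        (hξ ⟨h1, h2⟩ ⟨by omega, by omega⟩ (by omega))
    · exact ⟨(hη.monotoneOn ⟨by omega, by omega⟩ ⟨by omega, by omega⟩ (by omega)).trans_lt hy.1,
        hy.2.trans_le (hη.monotoneOn ⟨by omega, by omega⟩ ⟨by omega, by omega⟩ (by omega))⟩
  · refine sum_cubes_eq_zero (lt_add_one (η X.top)) fun y hy => ?_
    rw [← sum_truncPow_eq (α := fun j => d (i, j)) hη h3 le_rfl hy.1.le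
      fun h => absurd h (lt_irrefl _)]
    refine colSum_eq_zero hξ h1 h2 ?_
    rw [show (fun x => X.ofCofactors ξ η d (x, y)) = 0 from funext fun x =>
      hout _ fun hp => absurd hp.2.2 (not_le.2 hy.1)]
    exact Submodule.zero_mem _

/-- The restriction of a bicubic spline to a line is a cubic spline; on the knot lines this
follows by continuity. -/
theorem mem_splines_of_cells {f : ℝ × ℝ → ℝ} {ξ η : ℤ → ℝ} {L R B T : ℤ} (hLR : L < R)
    (hf1 : ∀ y, Continuous fun x => f (x, y)) (hf2 : ∀ x, ContDiff ℝ 2 fun y => f (x, y))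
    (hξ : StrictMonoOn ξ (Set.Icc L R))
    (hcell : ∀ i j, L ≤ i → i < R → B ≤ j → j < T →
      IsBicubicOn f (Set.Ioo (ξ i) (ξ (i + 1)) ×ˢ Set.Ioo (η j) (η (j + 1))))
    (hout : ∀ p, p ∉ Set.Icc (ξ L) (ξ R) ×ˢ Set.Icc (η B) (η T) → f p = 0) (x : ℝ) :
    (fun y => f (x, y)) ∈ splines η B T := by
  refine ⟨hf2 x, fun j hj hj' => ?_, fun y hy => hout _ fun hp => hy hp.2⟩
  by_cases hx : x ∈ Set.Icc (ξ L) (ξ R)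
  · obtain ⟨i, i1, i2, i3, i4⟩ := exists_knot_interval hLR hx.1 hx.2
    have hlt : ξ i < ξ (i + 1) := hξ ⟨i1, i2.le⟩ ⟨by omega, by omega⟩ (by omega)
    obtain ⟨c, hc⟩ := hcell i j i1 i2 hj hj'
    have hc' : IsBicubicOn f (Set.Icc (ξ i) (ξ (i + 1)) ×ˢ Set.Ioo (η j) (η (j + 1))) := by
      refine ⟨c, ?_⟩
      rintro ⟨x, y⟩ ⟨hx, hy⟩
      have : Set.EqOn (fun x => f (x, y))
          (fun x => ∑ i, ∑ j, c i j * x ^ (i : ℕ) * y ^ (j : ℕ)) (Set.Ioo (ξ i) (ξ (i + 1))) :=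
        fun x hx => hc (x, y) ⟨hx, hy⟩
      have := this.closure (hf1 y) (by fun_prop)
      rw [closure_Ioo hlt.ne] at this
      exact this hx
    have hpre : Prod.swap ⁻¹' (Set.Icc (ξ i) (ξ (i + 1)) ×ˢ Set.Ioo (η j) (η (j + 1))) =
      Set.Ioo (η j) (η (j + 1)) ×ˢ Set.Icc (ξ i) (ξ (i + 1)) := Set.preimage_swap_prod _ _
    have h2 := isBicubicOn_swap hc'
    rw [hpre] at h2
    exact h2.mem_cubics ⟨i3, i4⟩
  · rw [show (fun y => f (x, y)) = 0 from funext fun y => hout _ fun hp => hx hp.1]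
    exact Submodule.zero_mem _

/-- Every spline on a T-mesh has vertex cofactors. -/
theorem exists_cofactors (hX : X.IsTMesh) {ξ η : ℤ → ℝ}
    (hξ : StrictMonoOn ξ (Set.Icc X.left X.right)) (hη : StrictMonoOn η (Set.Icc X.bottom X.top))
    {f : ℝ × ℝ → ℝ} (hf : IsC22 f)
    (hbic : ∀ Q ∈ X.faces, IsBicubicOn f
      (Set.Ioo (ξ Q.left) (ξ Q.right) ×ˢ Set.Ioo (η Q.bottom) (η Q.top)))
    (hout : ∀ p, p ∉ Set.Icc (ξ X.left) (ξ X.right) ×ˢ Set.Icc (η X.bottom) (η X.top) →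
      f p = 0) :
    ∃ d ∈ X.cofactorSpace ξ η, X.ofCofactors ξ η d = f := by
  classical
  have hcell : ∀ i j, X.left ≤ i → i < X.right → X.bottom ≤ j → j < X.top →
      IsBicubicOn f (Set.Ioo (ξ i) (ξ (i + 1)) ×ˢ Set.Ioo (η j) (η (j + 1))) := by
    intro i j h1 h2 h3 h4
    obtain ⟨Q, hQ, hc⟩ := hX.exists_cell h1 h2 h3 h4
    have hb := hX.2.2.1 Q hQ
    unfold IntRect.HasCell at hc
    obtain ⟨c, hc'⟩ := hbic Q hQ
    refine ⟨c, fun p hp => hc' p ⟨⟨?_, ?_⟩, ⟨?_, ?_⟩⟩⟩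
    · exact (hξ.monotoneOn ⟨by omega, by omega⟩ ⟨by omega, by omega⟩ (by omega)).trans_lt hp.1.1
    · exact hp.1.2.trans_le (hξ.monotoneOn ⟨by omega, by omega⟩ ⟨by omega, by omega⟩ (by omega))
    · exact (hη.monotoneOn ⟨by omega, by omega⟩ ⟨by omega, by omega⟩ (by omega)).trans_lt hp.2.1
    · exact hp.2.2.trans_le (hη.monotoneOn ⟨by omega, by omega⟩ ⟨by omega, by omega⟩ (by omega))
  have hVy : ∀ x, (fun y => f (x, y)) ∈ splines η X.bottom X.top :=
    mem_splines_of_cells hX.1 (fun y => (hf.1 y).continuous) hf.2.1 hξ hcell hout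
  have hVx : ∀ y, (fun x => f (x, y)) ∈ splines ξ X.left X.right := by
    refine mem_splines_of_cells (f := fun p => f p.swap) hX.2.1 (fun x => (hf.2.1 x).continuous)
      hf.1 hη (fun j i h1 h2 h3 h4 => ?_) fun p hp => hout _ fun hp' => hp ⟨hp'.2, hp'.1⟩
    have := isBicubicOn_swap (hcell i j h3 h4 h1 h2)
    rwa [Set.preimage_swap_prod] at this
  obtain ⟨Λ, hΛ, hΛ'⟩ := exists_coeff_functional hX.1.le hξ
  obtain ⟨M, hM, hM'⟩ := exists_coeff_functional hX.2.1.le hη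
  -- The coefficient functional of the `i`-th truncated power in `x` is applied first, and the
  -- result is a spline in `y`.
  set d : ℤ × ℤ → ℝ := fun v => if v ∈ X.box then M v.2 fun y => Λ v.1 fun x => f (x, y) else 0
    with hd
  have hfd : X.ofCofactors ξ η d = f := by
    funext ⟨x, y⟩
    rw [ofCofactors_apply, hΛ' _ (hVx y) x]
    refine Finset.sum_congr rfl fun i hi => ?_
    congr 1
    have hγ := hM' _ (evalSpan_apply_mem hVy (hΛ i)) y
    rw [hγ]
    refine Finset.sum_congr rfl fun j hj => ?_
    rw [hd]
    simp only
    rw [if_pos]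
    exact Finset.mem_product.2 ⟨hi, hj⟩
  refine ⟨d, ⟨fun p hp => if_neg hp, ?_, ?_⟩, hfd⟩
  · rw [← colCond_swap]
    have hsw : X.swap.ofCofactors η ξ (fun p => d p.swap) = fun p => f p.swap := by
      funext ⟨y, x⟩
      rw [ofCofactors_swap, hfd]
      rfl
    refine colCond_of_spline (X := X.swap) hX.swap (ξ := η) (η := ξ) hη hξ ?_ ?_
    · intro Q hQ
      rw [hsw]
      have := isBicubicOn_swap (hbic Q.swap hQ)
      rwa [Set.preimage_swap_prod] at this
    · intro p hp
      rw [hsw]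
      exact hout _ fun hp' => hp ⟨hp'.2, hp'.1⟩
  · refine colCond_of_spline (X := X) hX hξ hη ?_ ?_
    · rw [hfd]; exact hbic
    · rw [hfd]; exact hout

theorem ofCofactors_injOn {ξ η : ℤ → ℝ} (hξ : StrictMonoOn ξ (Set.Icc X.left X.right))
    (hη : StrictMonoOn η (Set.Icc X.bottom X.top)) {d : ℤ × ℤ → ℝ} (hd : ∀ p ∉ X.box, d p = 0)
    (h : X.ofCofactors ξ η d = 0) : d = 0 := by
  funext ⟨i, j⟩
  by_cases hp : (i, j) ∈ X.box
  · obtain ⟨⟨h1, h2⟩, h3, h4⟩ := mem_box.1 hp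
    have hγ : ∀ y, ∑ j ∈ Finset.Icc X.bottom X.top, d (i, j) * truncPow (η j) y = 0 := by
      intro y
      refine colSum_eq_zero (ξ := ξ) hξ h1 h2 ?_
      rw [h]
      exact Submodule.zero_mem _
    refine coeff_eq_zero_of_cubic (s := Finset.Icc X.bottom X.top) (ξ := η)
      (α := fun j => d (i, j)) ?_ (Finset.mem_Icc.2 ⟨h3, h4⟩) ?_
    · rw [Finset.coe_Icc]
      exact hη.injOn
    · simp only [hγ]
      exact Submodule.zero_mem _
  · exact hd _ hp

/-- The spline space is isomorphic to the space of vertex cofactors. -/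
theorem rank_splineSpace (hT : T.IsTMesh) {ξ η : ℤ → ℝ}
    (hξ : StrictMonoOn ξ (Set.Icc T.left T.right)) (hη : StrictMonoOn η (Set.Icc T.bottom T.top)) :
    Module.rank ℝ (T.splineSpace ξ η) = Module.rank ℝ (T.extended.cofactorSpace ξ η) := by
  have hX := hT.extended
  set Φ := (T.extended.ofCofactors ξ η).domRestrict (T.extended.cofactorSpace ξ η) with hΦ
  have hinj : Function.Injective Φ := by
    rw [injective_iff_map_eq_zero]
    rintro ⟨d, hd⟩ h
    exact Subtype.ext (ofCofactors_injOn hξ hη hd.1 h)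
  have hrange : LinearMap.range Φ = T.splineSpace ξ η := by
    ext f
    constructor
    · rintro ⟨⟨d, hd⟩, rfl⟩
      exact ⟨isC22_ofCofactors, fun Q hQ => isBicubicOn_ofCofactors hX hξ hη hd.2.1 hd.2.2 hQ,
        fun p hp => ofCofactors_eq_zero hX hξ hη hd.2.1 hd.2.2 hp⟩
    · rintro ⟨h1, h2, h3⟩
      obtain ⟨d, hd, hfd⟩ := exists_cofactors hX hξ hη h1 h2 h3
      exact ⟨⟨d, hd⟩, hfd⟩
  exact (((LinearEquiv.ofInjective Φ hinj).trans (LinearEquiv.ofEq _ _ hrange)).rank_eq).symm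

end RectMesh

/-! ### Vertex cofactors and the reduced constraint matrix -/

theorem sum_Icc_split {M : Type*} [AddCommMonoid M] (g : ℤ → M) {L p q : ℤ} (h1 : L ≤ p)
    (h2 : p ≤ q) : ∑ i ∈ Finset.Icc L q, g i =
      ∑ i ∈ Finset.Icc L (p - 1), g i + ∑ i ∈ Finset.Icc p q, g i := by
  rw [← Finset.sum_union]
  · congr 1
    ext i
    simp only [Finset.mem_union, Finset.mem_Icc]
    omega
  · rw [Finset.disjoint_left]
    intro i hi
    simp only [Finset.mem_Icc] at hi ⊢
    omega

/-- If the terms vanish off the runs and add up to zero over every run, then they add up to zero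
from the left end to any gap. -/
theorem sum_eq_zero_of_runs {M : Type*} [AddCommGroup M] {F : ℤ → Prop} {L R : ℤ} {g : ℤ → M}
    (hF : ∀ i, F i → L ≤ i ∧ i < R) (hg : ∀ i, ¬ F (i - 1) → ¬ F i → g i = 0)
    (h : ∀ p q, IsRun F p q → ∑ i ∈ Finset.Icc p q, g i = 0) {a : ℤ} (ha : ¬ F a) :
    ∑ i ∈ Finset.Icc L a, g i = 0 := by
  obtain ⟨n, hn⟩ : ∃ n : ℕ, a < L + n := ⟨(a - L + 1).toNat, by omega⟩
  induction n generalizing a with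
  | zero => rw [Finset.Icc_eq_empty (by push_cast at hn; omega), Finset.sum_empty]
  | succ n ih =>
    push_cast at hn
    rcases lt_or_ge a L with hlt | hge
    · rw [Finset.Icc_eq_empty (by omega), Finset.sum_empty]
    by_cases ha' : F (a - 1)
    · obtain ⟨p, q, hpq, h1, h2⟩ := exists_isRun hF ha'
      obtain ⟨c1, c2, c3, c4⟩ := hpq
      have hq : q = a := by
        by_contra hne
        exact ha (c2 a (by omega) (by omega))
      subst hq
      have hL := (hF p (c2 p le_rfl c1)).1
      rw [sum_Icc_split g hL c1.le, h p q ⟨c1, c2, c3, c4⟩, ih c3 (by omega), add_zero]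
    · rw [sum_Icc_split g hge le_rfl, ih ha' (by omega), Finset.Icc_self, Finset.sum_singleton,
        hg a ha' ha, add_zero]

theorem IsRun.sum_eq_zero {M : Type*} [AddCommGroup M] {F : ℤ → Prop} {L p q : ℤ} {g : ℤ → M}
    (h : IsRun F p q) (hL : L ≤ p) (h1 : ∑ i ∈ Finset.Icc L (p - 1), g i = 0)
    (h2 : ∑ i ∈ Finset.Icc L q, g i = 0) : ∑ i ∈ Finset.Icc p q, g i = 0 := by
  rwa [sum_Icc_split g hL h.1.le, h1, zero_add] at h2

theorem eq_zero_of_sum_pow_eq_zero {e : Fin 4 → ℝ} (h : ∀ x : ℝ, ∑ k, e k * x ^ (k : ℕ) = 0) :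
    e = 0 := by
  set q : Polynomial ℝ := ∑ k : Fin 4, Polynomial.C (e k) * Polynomial.X ^ (k : ℕ) with hq
  have h0 : q = 0 := Polynomial.funext fun x => by
    rw [hq, Polynomial.eval_finsetSum, Polynomial.eval_zero, ← h x]
    simp
  funext k
  have := congrArg (fun p => Polynomial.coeff p (k : ℕ)) h0
  simp only [hq, Polynomial.finsetSum_coeff, Polynomial.coeff_C_mul_X_pow,
    Polynomial.coeff_zero, Fin.val_inj] at this
  simpa using this

/-- The cubes of `X - t` for four values of `t` are a basis of the cubic polynomials. -/
theorem isUnit_cubeMatrix {t : Fin 4 → ℝ} (ht : Function.Injective t) :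
    IsUnit (Matrix.of fun k l : Fin 4 =>
      ((Polynomial.X - Polynomial.C (t l)) ^ 3 : Polynomial ℝ).coeff k) := by
  rw [← Matrix.vecMul_injective_iff_isUnit]
  rw [← Matrix.coe_vecMulLinear, injective_iff_map_eq_zero]
  intro g hg
  refine cubic_functional_eq_zero (S := Finset.univ.image t) ?_ fun x hx => ?_
  · rw [Finset.card_image_of_injective _ ht, Finset.card_univ, Fintype.card_fin]
  · obtain ⟨l, -, rfl⟩ := Finset.mem_image.1 hx
    exact congrFun hg l

theorem sum_cubes_eq {t c : Fin 4 → ℝ} (x : ℝ) : ∑ l, c l * (x - t l) ^ 3 =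
    ∑ k, ((Matrix.of fun k l : Fin 4 =>
      ((Polynomial.X - Polynomial.C (t l)) ^ 3 : Polynomial ℝ).coeff k).mulVec c) k *
      x ^ (k : ℕ) := by
  simp only [sub_cube_eq_sum, Finset.mul_sum, Matrix.mulVec, dotProduct, Matrix.of_apply,
    Finset.sum_mul]
  rw [Finset.sum_comm]
  refine Finset.sum_congr rfl fun k _ => Finset.sum_congr rfl fun l _ => ?_
  ring

theorem cubes_independent {t c : Fin 4 → ℝ} (ht : Function.Injective t)
    (h : ∀ x : ℝ, ∑ l, c l * (x - t l) ^ 3 = 0) : c = 0 := by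
  refine Matrix.mulVec_injective_iff_isUnit.2 (isUnit_cubeMatrix ht) ?_
  simp only [sum_cubes_eq] at h
  rw [eq_zero_of_sum_pow_eq_zero h, Matrix.mulVec_zero]

theorem exists_cubes_eq {t : Fin 4 → ℝ} (ht : Function.Injective t) (e : Fin 4 → ℝ) :
    ∃ c : Fin 4 → ℝ, ∀ x : ℝ, ∑ l, c l * (x - t l) ^ 3 = ∑ k, e k * x ^ (k : ℕ) := by
  obtain ⟨c, hc⟩ := Matrix.mulVec_surjective_iff_isUnit.2 (isUnit_cubeMatrix ht) e
  exact ⟨c, fun x => by rw [sum_cubes_eq, hc]⟩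

/-- The two first and the two last elements of the interval from `L` to `R`. -/
def outerIndex (L R : ℤ) : Fin 4 → ℤ := ![L, L + 1, R - 1, R]

theorem outerIndex_injective {L R : ℤ} (h : L + 4 ≤ R) : Function.Injective (outerIndex L R) := by
  intro k l
  fin_cases k <;> fin_cases l <;> simp [outerIndex] <;> omega

theorem outerIndex_mem {L R : ℤ} (h : L + 4 ≤ R) (k : Fin 4) : outerIndex L R k ∈ Set.Icc L R := by
  rw [Set.mem_Icc]
  fin_cases k <;> simp [outerIndex] <;> omega

theorem exists_outerIndex_iff {L R i : ℤ} :
    (∃ k, outerIndex L R k = i) ↔ i = L ∨ i = L + 1 ∨ i = R - 1 ∨ i = R := by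
  simp only [Fin.exists_fin_succ, outerIndex]
  simp [eq_comm]

theorem sum_outerIndex {L R : ℤ} (h : L + 4 ≤ R) {g : ℤ → ℝ}
    (hg : ∀ i, (∀ k, outerIndex L R k ≠ i) → g i = 0) :
    ∑ i ∈ Finset.Icc L R, g i = ∑ k, g (outerIndex L R k) := by
  rw [← Finset.sum_image (s := Finset.univ) (g := outerIndex L R) (f := g)
    (outerIndex_injective h).injOn]
  symm
  refine Finset.sum_subset (fun i hi => ?_) fun i _ hi => hg i fun k hk => hi ?_
  · obtain ⟨k, -, rfl⟩ := Finset.mem_image.1 hi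
    exact Finset.mem_Icc.2 (outerIndex_mem h k)
  · exact Finset.mem_image.2 ⟨k, Finset.mem_univ k, hk⟩

theorem knot_outerIndex_injective {L R : ℤ} (h : L + 4 ≤ R) {ξ : ℤ → ℝ}
    (hξ : StrictMonoOn ξ (Set.Icc L R)) : Function.Injective fun k => ξ (outerIndex L R k) :=
  fun _ _ hkl => outerIndex_injective h
    (hξ.injOn (outerIndex_mem h _) (outerIndex_mem h _) hkl)

namespace RectMesh

variable {X T : RectMesh}

theorem RowCond.eq_zero {ξ : ℤ → ℝ} {d : ℤ × ℤ → ℝ} (hr : X.RowCond ξ d) {i j : ℤ}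
    (hp : (i, j) ∈ X.box) (h1 : ¬ X.HUnit (i - 1) j) (h2 : ¬ X.HUnit i j) : d (i, j) = 0 := by
  obtain ⟨⟨b1, b2⟩, b3, b4⟩ := mem_box.1 hp
  simp only at b1 b2 b3 b4
  have e1 := hr j i b3 b4 b1 b2 h2 (ξ i + 1)
  rw [sum_Icc_split _ b1 le_rfl, Finset.Icc_self, Finset.sum_singleton] at e1
  have e2 : ∑ k ∈ Finset.Icc X.left (i - 1), d (k, j) * (ξ i + 1 - ξ k) ^ 3 = 0 := by
    rcases eq_or_ne i X.left with he | he
    · rw [Finset.Icc_eq_empty (by omega), Finset.sum_empty]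
    · exact hr j (i - 1) b3 b4 (by omega) (by omega) h1 _
  rw [e2, add_sub_cancel_left, one_pow, mul_one, zero_add] at e1
  exact e1

/-- At a point without a horizontal, or without a vertical, edge the difference of two consecutive
conditions shows that the cofactor vanishes. -/
theorem eq_zero_of_notMem_vertices (hX : X.IsTMesh) {ξ η : ℤ → ℝ} {d : ℤ × ℤ → ℝ}
    (hd : d ∈ X.cofactorSpace ξ η) {p : ℤ × ℤ} (hp : p ∉ X.vertices) : d p = 0 := by
  obtain ⟨h1, h2, h3⟩ := hd
  by_cases hb : p ∈ X.box
  · obtain ⟨i, j⟩ := p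
    rw [hX.mem_vertices, not_and_or, not_or, not_or] at hp
    rcases hp with h | h
    · exact h2.eq_zero hb h.1 h.2
    · have hb' : (j, i) ∈ X.swap.box := by
        rw [mem_box] at hb ⊢
        exact ⟨hb.2, hb.1⟩
      exact (colCond_swap (X := X.swap) (d := fun p => d p.swap)).1 h3 |>.eq_zero hb'
        (hUnit_swap.not.2 h.1) (hUnit_swap.not.2 h.2)
  · exact h1 p hb

/-- The segment conditions in the rows through the active region. -/
def SegCond (T : RectMesh) (ξ : ℤ → ℝ) (d : ℤ × ℤ → ℝ) : Prop :=
  ∀ s ∈ T.hSegs, ∀ x : ℝ, ∑ i ∈ Finset.Icc s.1.1 s.2.1, d (i, s.1.2) * (x - ξ i) ^ 3 = 0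

theorem RowCond.segCond (hT : T.IsTMesh) {ξ : ℤ → ℝ} {d : ℤ × ℤ → ℝ}
    (hr : T.extended.RowCond ξ d) : T.SegCond ξ d := by
  intro s hs x
  obtain ⟨-, ⟨b1, b2⟩, hrun⟩ := hT.mem_hSegs.1 hs
  have hp := hrun.2.1 _ le_rfl hrun.1
  have hq := hrun.2.1 (s.2.1 - 1) (by have := hrun.1; omega) (by omega)
  have c1 : T.left ≤ s.1.1 := hp.1
  have c2 : s.2.1 - 1 < T.right := hq.2.1
  have c3 := hrun.1
  refine hrun.sum_eq_zero (L := T.left) c1 ?_ ?_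
  · rcases eq_or_ne s.1.1 T.left with he | he
    · rw [Finset.Icc_eq_empty (by omega), Finset.sum_empty]
    · exact hr _ _ hp.2.2.1 hp.2.2.2.1 (show T.left ≤ _ by omega) (show _ ≤ T.right by omega)
        hrun.2.2.1 x
  · exact hr _ _ hp.2.2.1 hp.2.2.2.1 (show T.left ≤ _ by omega) (show _ ≤ T.right by omega)
      hrun.2.2.2 x

theorem SegCond.sum_eq_zero (hT : T.IsTMesh) {ξ : ℤ → ℝ} {d : ℤ × ℤ → ℝ} (hs : T.SegCond ξ d)
    (hd : ∀ p ∉ T.extended.vertices, d p = 0) {j : ℤ} (h1 : T.bottom + 2 ≤ j)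
    (h2 : j ≤ T.top - 2) {a : ℤ} (ha : ¬ T.extended.HUnit a j) (x : ℝ) :
    ∑ i ∈ Finset.Icc T.left a, d (i, j) * (x - ξ i) ^ 3 = 0 := by
  refine sum_eq_zero_of_runs (F := fun i => T.extended.HUnit i j) (R := T.right)
    (fun i hi => ⟨hi.1, hi.2.1⟩) (fun i c1 c2 => ?_) (fun p q hpq => ?_) ha
  · rw [hd, zero_mul]
    rw [hT.extended.mem_vertices]
    tauto
  · exact hs ((p, j), (q, j)) (hT.mem_hSegs.2 ⟨rfl, ⟨h1, h2⟩, hpq⟩) x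

/-- All vertices of the extended T-mesh on a segment in an inner row are kept in the simplified
mesh. -/
theorem sum_onSegment (hT : T.IsTMesh) {s : (ℤ × ℤ) × (ℤ × ℤ)} (hs : s ∈ T.hSegs)
    [DecidablePred (OnSegment s)] {F : ℤ × ℤ → ℝ} (hF : ∀ p ∉ T.extended.vertices, F p = 0) :
    ∑ v ∈ T.reducedVertices, (if OnSegment s v then F v else 0) =
      ∑ i ∈ Finset.Icc s.1.1 s.2.1, F (i, s.1.2) := by
  obtain ⟨e, ⟨b1, b2⟩, hrun⟩ := hT.mem_hSegs.1 hs
  rw [← Finset.sum_filter]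
  refine Eq.trans ?_ (Finset.sum_map (Finset.Icc s.1.1 s.2.1)
    ⟨fun i => (i, s.1.2), fun i k h => (Prod.ext_iff.1 h).1⟩ F)
  refine Finset.sum_subset (fun v hv => ?_) fun v hv hv' => hF v fun hvert => hv' ?_
  · obtain ⟨-, h1, h2, h3, h4⟩ := Finset.mem_filter.1 hv
    exact Finset.mem_map.2 ⟨v.1, Finset.mem_Icc.2 ⟨h1, h2⟩, Prod.ext rfl (by
      change s.1.2 = v.2
      omega)⟩
  · obtain ⟨i, hi, rfl⟩ := Finset.mem_map.1 hv
    rw [Finset.mem_Icc] at hi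
    refine Finset.mem_filter.2 ⟨mem_reducedVertices.2 ⟨hvert, fun h => ?_⟩, hi.1, hi.2, le_rfl,
      e.le⟩
    have := h.2
    change s.1.2 = _ ∨ s.1.2 = _ ∨ s.1.2 = _ ∨ s.1.2 = _ at this
    omega

/-- The four rows of the matrix for a horizontal segment are the coefficients of its condition. -/
theorem sum_reducedMatrix (hT : T.IsTMesh) {ξ η : ℤ → ℝ} {d : ℤ × ℤ → ℝ}
    (hd : ∀ p ∉ T.extended.vertices, d p = 0) {s : (ℤ × ℤ) × (ℤ × ℤ)} (hs : s ∈ T.hSegs)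
    (hs' : s ∈ T.reducedSegments) (x : ℝ) :
    ∑ k, (T.reducedMatrix ξ η).mulVec (fun v => d v.1) (⟨s, hs'⟩, k) * x ^ (k : ℕ) =
      ∑ i ∈ Finset.Icc s.1.1 s.2.1, d (i, s.1.2) * (x - ξ i) ^ 3 := by
  classical
  have e : s.1.2 = s.2.2 := (hT.mem_hSegs.1 hs).1
  rw [← sum_onSegment hT hs (F := fun v => d v * (x - ξ v.1) ^ 3) fun p hp => by
    rw [hd p hp, zero_mul]]
  simp only [Matrix.mulVec, dotProduct, Finset.sum_mul, reducedMatrix_apply, if_pos e]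
  rw [Finset.sum_comm, ← Finset.sum_coe_sort T.reducedVertices]
  refine Finset.sum_congr rfl fun v _ => ?_
  split_ifs with h
  · rw [sub_cube_eq_sum, Finset.mul_sum]
    exact Finset.sum_congr rfl fun k _ => by ring
  · simp

theorem sum_reducedMatrix_of_swap (hT : T.IsTMesh) {ξ η : ℤ → ℝ} {d : ℤ × ℤ → ℝ}
    (hd : ∀ p ∉ T.extended.vertices, d p = 0) {s : (ℤ × ℤ) × (ℤ × ℤ)} (hs : s ∈ T.swap.hSegs)
    (hs' : segSwap s ∈ T.reducedSegments) (y : ℝ) :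
    ∑ k, (T.reducedMatrix ξ η).mulVec (fun v => d v.1) (⟨segSwap s, hs'⟩, k) * y ^ (k : ℕ) =
      ∑ j ∈ Finset.Icc s.1.1 s.2.1, d (s.1.2, j) * (y - η j) ^ 3 := by
  classical
  have e : ¬ s.1.1 = s.2.1 := (hT.swap.mem_hSegs.1 hs).2.2.1.ne
  refine Eq.trans ?_ (sum_onSegment hT.swap hs (F := fun v => d v.swap * (y - η v.1) ^ 3)
    fun p hp => ?_)
  swap
  · rw [hd, zero_mul]
    rwa [hT.extended_swap, hT.extended.mem_vertices_swap] at hp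
  simp only [Matrix.mulVec, dotProduct, Finset.sum_mul, reducedMatrix_apply]
  rw [Finset.sum_comm]
  have hsw : ∑ v ∈ T.swap.reducedVertices,
      (if OnSegment s v then d v.swap * (y - η v.1) ^ 3 else 0) =
      ∑ v ∈ T.reducedVertices, if OnSegment (segSwap s) v then d v * (y - η v.2) ^ 3 else 0 := by
    refine Finset.sum_equiv (Equiv.prodComm ℤ ℤ) (fun v => ?_) fun v _ => ?_
    · exact hT.mem_reducedVertices_swap
    · simp only [Equiv.prodComm_apply, onSegment_swap, Prod.snd_swap]
  rw [hsw, ← Finset.sum_coe_sort T.reducedVertices]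
  refine Finset.sum_congr rfl fun v _ => ?_
  have e' : ¬ (segSwap s).1.2 = (segSwap s).2.2 := e
  simp only [if_neg e']
  split_ifs with h
  · rw [sub_cube_eq_sum, Finset.mul_sum]
    exact Finset.sum_congr rfl fun k _ => by ring
  · simp

/-- On functions supported on the vertices, the kernel of the reduced constraint matrix is given
by the segment conditions in both directions. -/
theorem mulVec_eq_zero_iff (hT : T.IsTMesh) {ξ η : ℤ → ℝ} {d : ℤ × ℤ → ℝ}
    (hd : ∀ p ∉ T.extended.vertices, d p = 0) :
    (T.reducedMatrix ξ η).mulVec (fun v => d v.1) = 0 ↔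
      T.SegCond ξ d ∧ T.swap.SegCond η fun p => d p.swap := by
  constructor
  · refine fun h => ⟨fun s hs x => ?_, fun s hs y => ?_⟩
    · rw [← sum_reducedMatrix hT (η := η) hd hs (hT.mem_reducedSegments_iff.2 (.inl hs)), h]
      simp
    · have hs' : segSwap s ∈ T.reducedSegments := hT.mem_reducedSegments_iff.2 (.inr hs)
      refine Eq.trans rfl
        ((sum_reducedMatrix_of_swap hT (ξ := ξ) (η := η) hd hs hs' y).symm.trans ?_)
      · rw [h]
        simp
  · rintro ⟨h1, h2⟩
    funext ⟨⟨s, hs⟩, k⟩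
    rcases hT.mem_reducedSegments_iff.1 hs with h | h
    · refine congrFun (eq_zero_of_sum_pow_eq_zero (e := fun k =>
        (T.reducedMatrix ξ η).mulVec (fun v => d v.1) (⟨s, hs⟩, k)) fun x => ?_) k
      rw [sum_reducedMatrix hT hd h hs, h1 s h x]
    · refine congrFun (eq_zero_of_sum_pow_eq_zero (e := fun k =>
        (T.reducedMatrix ξ η).mulVec (fun v => d v.1) (⟨s, hs⟩, k)) fun y => ?_) k
      exact (sum_reducedMatrix_of_swap hT hd h hs y).trans (h2 _ h y)

theorem isOuterColumn_iff {i : ℤ} :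
    T.IsOuterColumn i ↔ ∃ k, outerIndex T.left T.right k = i := exists_outerIndex_iff.symm

theorem isOuterRow_iff {j : ℤ} :
    T.IsOuterRow j ↔ ∃ l, outerIndex T.bottom T.top l = j := exists_outerIndex_iff.symm

/-- An outer row is a single segment, which fills the line. -/
theorem IsAdmissible.hUnit_outer (hT : T.IsTMesh) (h : T.IsAdmissible) {i j : ℤ}
    (hj : T.IsOuterRow j) (h1 : T.left ≤ i) (h2 : i < T.right) : T.extended.HUnit i j := by
  apply hT.hUnit_extended_of
  have a0 := h.hUnit hT (k := 0) le_rfl (by norm_num) h1 h2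
  have a1 := h.hUnit hT (k := 1) (by norm_num) (by norm_num) h1 h2
  rw [add_zero, sub_zero] at a0
  rcases hj with e | e | e | e <;> rw [e]
  exacts [a0.1, a1.1, a1.2, a0.2]

theorem IsAdmissible.outer_mem_vertices (hT : T.IsTMesh) (h : T.IsAdmissible) {i j : ℤ}
    (hi : T.IsOuterColumn i) (hj : T.IsOuterRow j) : (i, j) ∈ T.extended.vertices := by
  have hw := h.width
  have hh := h.height
  have hcol : ∀ l, T.bottom ≤ l → l < T.top → T.extended.VUnit i l := fun l h1 h2 => by
    have := (h.swap hT).hUnit_outer hT.swap hi h1 h2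
    rwa [hT.extended_swap, hUnit_swap] at this
  rw [hT.extended.mem_vertices]
  refine ⟨?_, ?_⟩
  · rcases eq_or_ne i T.right with e | e
    · exact .inl (h.hUnit_outer hT hj (by omega) (by omega))
    · exact .inr (h.hUnit_outer hT hj (by unfold IsOuterColumn at hi; omega)
        (by unfold IsOuterColumn at hi; omega))
  · rcases eq_or_ne j T.top with e | e
    · exact .inl (hcol _ (by omega) (by omega))
    · exact .inr (hcol _ (by unfold IsOuterRow at hj; omega) (by unfold IsOuterRow at hj; omega))

/-- The row conditions follow from the segment conditions in the rows through the active region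
and the conditions for the four whole outer rows. -/
theorem SegCond.rowCond (hT : T.IsTMesh) (h : T.IsAdmissible) {ξ : ℤ → ℝ} {d : ℤ × ℤ → ℝ}
    (hs : T.SegCond ξ d) (hd : ∀ p ∉ T.extended.vertices, d p = 0)
    (ho : ∀ j, T.IsOuterRow j → ∀ x : ℝ,
      ∑ i ∈ Finset.Icc T.left T.right, d (i, j) * (x - ξ i) ^ 3 = 0) :
    T.extended.RowCond ξ d := by
  intro j a (h1 : T.bottom ≤ j) (h2 : j ≤ T.top) (h3 : T.left ≤ a) (h4 : a ≤ T.right) h5 x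
  by_cases hj : T.IsOuterRow j
  · rcases h4.eq_or_lt with he | hlt
    · rw [he]
      exact ho j hj x
    · exact absurd (h.hUnit_outer hT hj h3 hlt) h5
  · unfold IsOuterRow at hj
    exact hs.sum_eq_zero hT hd (by omega) (by omega) h5 x

/-- Cofactors that vanish on the vertices of the simplified extended T-mesh vanish: in an outer
row only the four corner unknowns are left, and the cubes at four knots are independent. -/
theorem eq_zero_of_reduced_eq_zero (hT : T.IsTMesh) (h : T.IsAdmissible) {ξ η : ℤ → ℝ}
    (hξ : StrictMonoOn ξ (Set.Icc T.left T.right)) {d : ℤ × ℤ → ℝ}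
    (hd : d ∈ T.extended.cofactorSpace ξ η) (h0 : ∀ v ∈ T.reducedVertices, d v = 0) : d = 0 := by
  have hw := h.width
  have hoff : ∀ p, ¬ (T.IsOuterColumn p.1 ∧ T.IsOuterRow p.2) → d p = 0 := fun p hp => by
    by_cases hv : p ∈ T.extended.vertices
    · exact h0 p (mem_reducedVertices.2 ⟨hv, hp⟩)
    · exact eq_zero_of_notMem_vertices hT.extended hd hv
  funext ⟨i, j⟩
  by_cases hp : T.IsOuterColumn i ∧ T.IsOuterRow j
  swap
  · exact hoff _ hp
  obtain ⟨hi, l, rfl⟩ := hp.imp_right isOuterRow_iff.1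
  obtain ⟨k, rfl⟩ := isOuterColumn_iff.1 hi
  have hl := outerIndex_mem h.height l
  refine congrFun (cubes_independent (t := fun k => ξ (outerIndex T.left T.right k))
    (c := fun k => d (outerIndex T.left T.right k, outerIndex T.bottom T.top l))
    (knot_outerIndex_injective hw hξ) fun x => ?_) k
  have := hd.2.1 (outerIndex T.bottom T.top l) T.right hl.1 hl.2 (show T.left ≤ T.right by omega)
    le_rfl (fun hu => absurd hu.2.1 (lt_irrefl _)) x
  rw [← this]
  refine (sum_outerIndex hw (g := fun i => d (i, outerIndex T.bottom T.top l) * (x - ξ i) ^ 3)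
    fun i hi => ?_).symm
  rw [hoff, zero_mul]
  exact fun hc => (isOuterColumn_iff.1 hc.1).elim hi

/-- Every solution of the reduced constraints extends to vertex cofactors: the corner unknowns
are found from the conditions for the outer rows. -/
theorem exists_mem_cofactorSpace (hT : T.IsTMesh) (h : T.IsAdmissible) {ξ η : ℤ → ℝ}
    (hξ : StrictMonoOn ξ (Set.Icc T.left T.right))
    {u : {v // v ∈ T.reducedVertices} → ℝ} (hu : (T.reducedMatrix ξ η).mulVec u = 0) :
    ∃ d ∈ T.extended.cofactorSpace ξ η, (fun v : {v // v ∈ T.reducedVertices} => d v.1) = u := by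
  classical
  have hw := h.width
  have hh := h.height
  set d₀ : ℤ × ℤ → ℝ := fun p => if hp : p ∈ T.reducedVertices then u ⟨p, hp⟩ else 0 with hd₀
  have hcorner : ∀ l, ∃ c : Fin 4 → ℝ, ∀ x : ℝ,
      ∑ k, c k * (x - ξ (outerIndex T.left T.right k)) ^ 3 =
        -∑ i ∈ Finset.Icc T.left T.right,
          d₀ (i, outerIndex T.bottom T.top l) * (x - ξ i) ^ 3 := by
    intro l
    obtain ⟨c, hc⟩ := exists_cubes_eq (knot_outerIndex_injective hw hξ) fun k : Fin 4 =>
      -∑ i ∈ Finset.Icc T.left T.right, d₀ (i, outerIndex T.bottom T.top l) *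
        ((Polynomial.X - Polynomial.C (ξ i)) ^ 3).coeff (k : ℕ)
    refine ⟨c, fun x => ?_⟩
    rw [hc x]
    simp only [sub_cube_eq_sum, Finset.mul_sum, neg_mul, Finset.sum_mul, Finset.sum_neg_distrib]
    rw [Finset.sum_comm]
    congr 1
    refine Finset.sum_congr rfl fun i _ => Finset.sum_congr rfl fun k _ => ?_
    ring
  choose c hc using hcorner
  set d₁ : ℤ × ℤ → ℝ := fun p => ∑ l, ∑ k,
    if p = (outerIndex T.left T.right k, outerIndex T.bottom T.top l) then c l k else 0 with hd₁
  have hd₁_corner : ∀ k l, d₁ (outerIndex T.left T.right k, outerIndex T.bottom T.top l) =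
      c l k := by
    intro k l
    simp only [hd₁, Prod.mk.injEq, (outerIndex_injective hw).eq_iff,
      (outerIndex_injective hh).eq_iff]
    rw [Finset.sum_eq_single l (fun m _ hm => Finset.sum_eq_zero fun n _ => if_neg fun hh =>
      hm hh.2.symm) (by simp), Finset.sum_eq_single k (fun m _ hm => if_neg fun hh =>
      hm hh.1.symm) (by simp), if_pos ⟨rfl, rfl⟩]
  have hd₁_off : ∀ p, ¬ (T.IsOuterColumn p.1 ∧ T.IsOuterRow p.2) → d₁ p = 0 := by
    intro p hp
    refine Finset.sum_eq_zero fun l _ => Finset.sum_eq_zero fun k _ => if_neg fun he => hp ?_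
    rw [he]
    exact ⟨isOuterColumn_iff.2 ⟨k, rfl⟩, isOuterRow_iff.2 ⟨l, rfl⟩⟩
  set d : ℤ × ℤ → ℝ := fun p => d₀ p + d₁ p with hd
  have hdu : (fun v : {v // v ∈ T.reducedVertices} => d v.1) = u := by
    funext v
    simp only [hd]
    rw [hd₁_off _ (mem_reducedVertices.1 v.2).2, add_zero]
    exact dif_pos v.2
  have hsupp : ∀ p ∉ T.extended.vertices, d p = 0 := by
    intro p hp
    have e0 : d₀ p = 0 := dif_neg fun hp' => hp (mem_reducedVertices.1 hp').1
    have e1 : d₁ p = 0 := hd₁_off p fun ⟨h1, h2⟩ => hp (h.outer_mem_vertices hT h1 h2)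
    change d₀ p + d₁ p = 0
    rw [e0, e1, add_zero]
  have hsupp' : ∀ p ∉ T.swap.extended.vertices, d p.swap = 0 := fun p hp => hsupp _ <| by
    rwa [hT.extended_swap, hT.extended.mem_vertices_swap] at hp
  rw [← hdu] at hu
  obtain ⟨s1, s2⟩ := (mulVec_eq_zero_iff hT hsupp).1 hu
  have hrow : T.extended.RowCond ξ d := by
    refine s1.rowCond hT h hsupp fun j hj x => ?_
    obtain ⟨l, rfl⟩ := isOuterRow_iff.1 hj
    simp only [hd, add_mul, Finset.sum_add_distrib]
    rw [sum_outerIndex hw (g := fun i => d₁ (i, outerIndex T.bottom T.top l) * (x - ξ i) ^ 3)]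
    · simp only [hd₁_corner, hc, add_neg_cancel]
    · intro i hi
      rw [hd₁_off, zero_mul]
      exact fun hc => (isOuterColumn_iff.1 hc.1).elim hi
  refine ⟨d, ⟨fun p hp => hsupp p fun hp' => hp (mem_box_of_mem_extended (T := T) hp'),
    hrow, ?_⟩, hdu⟩
  -- The sum over all vertices of the products of cubes vanishes row by row, hence column by
  -- column; the inner columns drop out, and the cubes at the four outer knots are independent.
  have htot : ∀ x y : ℝ, ∑ i ∈ Finset.Icc T.left T.right,
      (∑ j ∈ Finset.Icc T.bottom T.top, d (i, j) * (y - η j) ^ 3) * (x - ξ i) ^ 3 = 0 := by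
    intro x y
    simp only [Finset.sum_mul]
    rw [Finset.sum_comm]
    refine Finset.sum_eq_zero fun j hj => ?_
    rw [Finset.mem_Icc] at hj
    have := hrow j T.right hj.1 hj.2 (show T.left ≤ T.right by omega) le_rfl
      (fun hu => absurd hu.2.1 (lt_irrefl _)) x
    rw [← zero_mul ((y - η j) ^ 3), ← this, Finset.sum_mul]
    exact Finset.sum_congr rfl fun i _ => by ring
  have hgap : ∀ i, ¬ T.swap.extended.HUnit T.top i := fun i hu => absurd hu.2.1 (lt_irrefl _)
  have hcol : ∀ i, T.IsOuterColumn i → ∀ y : ℝ,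
      ∑ j ∈ Finset.Icc T.bottom T.top, d (i, j) * (y - η j) ^ 3 = 0 := by
    intro i hi y
    obtain ⟨k, rfl⟩ := isOuterColumn_iff.1 hi
    refine congrFun (cubes_independent (t := fun k => ξ (outerIndex T.left T.right k))
      (c := fun k => ∑ j ∈ Finset.Icc T.bottom T.top,
        d (outerIndex T.left T.right k, j) * (y - η j) ^ 3)
      (knot_outerIndex_injective hw hξ) fun x => ?_) k
    rw [← htot x y]
    refine (sum_outerIndex hw (g := fun i =>
      (∑ j ∈ Finset.Icc T.bottom T.top, d (i, j) * (y - η j) ^ 3) * (x - ξ i) ^ 3)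
      fun i hi => ?_).symm
    by_cases hb : T.left ≤ i ∧ i ≤ T.right
    · have hi' : ¬ T.IsOuterColumn i := fun hc => (isOuterColumn_iff.1 hc).elim hi
      unfold IsOuterColumn at hi'
      refine mul_eq_zero_of_left ?_ _
      exact s2.sum_eq_zero hT.swap hsupp' (show T.left + 2 ≤ i by omega)
        (show i ≤ T.right - 2 by omega) (hgap i) y
    · refine mul_eq_zero_of_left (Finset.sum_eq_zero fun j _ => ?_) _
      rw [hsupp, zero_mul]
      exact fun hv => hb (mem_box_of_mem_vertices hv |>.imp_right And.left)
  have := s2.rowCond hT.swap (h.swap hT) hsupp' hcol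
  rw [hT.extended_swap] at this
  exact colCond_swap.2 this

/-- Restriction to the vertices of the simplified extended T-mesh identifies the vertex cofactors
with the kernel of the reduced constraint matrix. -/
theorem rank_cofactorSpace (hT : T.IsTMesh) (h : T.IsAdmissible) {ξ η : ℤ → ℝ}
    (hξ : StrictMonoOn ξ (Set.Icc T.left T.right)) :
    Module.rank ℝ (T.extended.cofactorSpace ξ η) =
      Module.rank ℝ (LinearMap.ker (T.reducedMatrix ξ η).mulVecLin) := by
  set ρ : (ℤ × ℤ → ℝ) →ₗ[ℝ] ({v // v ∈ T.reducedVertices} → ℝ) :=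
    LinearMap.funLeft ℝ ℝ Subtype.val with hρ
  set Φ := ρ.domRestrict (T.extended.cofactorSpace ξ η) with hΦ
  have hinj : Function.Injective Φ := by
    rw [injective_iff_map_eq_zero]
    rintro ⟨d, hd⟩ h0
    exact Subtype.ext (eq_zero_of_reduced_eq_zero hT h hξ hd fun v hv => congrFun h0 ⟨v, hv⟩)
  have hrange : LinearMap.range Φ = LinearMap.ker (T.reducedMatrix ξ η).mulVecLin := by
    ext u
    rw [LinearMap.mem_ker, Matrix.mulVecLin_apply]
    constructor
    · rintro ⟨⟨d, hd⟩, rfl⟩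
      refine (mulVec_eq_zero_iff hT
        fun p hp => eq_zero_of_notMem_vertices hT.extended hd hp).2 ⟨hd.2.1.segCond hT, ?_⟩
      refine RowCond.segCond hT.swap ?_
      rw [hT.extended_swap]
      exact (colCond_swap (X := T.extended.swap) (d := fun p => d p.swap)).1 hd.2.2
    · intro hu
      obtain ⟨d, hd, hdu⟩ := exists_mem_cofactorSpace hT h hξ hu
      exact ⟨⟨d, hd⟩, hdu⟩
  exact ((LinearEquiv.ofInjective Φ hinj).trans (LinearEquiv.ofEq _ _ hrange)).rank_eq

/-- The dimension of the spline space in case of full rank. -/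
theorem rank_splineSpace_of_full_rank (hT : T.IsTMesh) (h : T.IsAdmissible) {ξ η : ℤ → ℝ}
    (hξ : StrictMonoOn ξ (Set.Icc T.left T.right)) (hη : StrictMonoOn η (Set.Icc T.bottom T.top))
    (hM : (T.reducedMatrix ξ η).rank = 4 * T.reducedSegments.card) :
    Module.rank ℝ (T.splineSpace ξ η) =
      ((T.activeVertices.card + T.crossingVertices.card + T.overlapVertices.card : ℕ) :
        Cardinal) := by
  rw [rank_splineSpace hT hξ hη, rank_cofactorSpace hT h hξ, ← Module.finrank_eq_rank]
  congr 1
  have h1 := LinearMap.finrank_range_add_finrank_ker (T.reducedMatrix ξ η).mulVecLin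
  rw [Module.finrank_fintype_fun_eq_card, Fintype.card_coe, h.card_reducedVertices hT] at h1
  change (T.reducedMatrix ξ η).rank + _ = _ at h1
  omega

end RectMesh


/-! ### The dimension formula -/

theorem mainTheorem1 (T : RectMesh) (hT : T.IsTMesh) (hadm : T.IsAdmissible)
    (ξ η : ℤ → ℝ) (hξ : StrictMonoOn ξ (Set.Icc T.left T.right))
    (hη : StrictMonoOn η (Set.Icc T.bottom T.top)) :
    (T.IsAnalysisSuitable →
      T.IsDiagonalizable ∧
      (T.reducedMatrix ξ η).rank = 4 * T.reducedSegments.card ∧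
      Module.rank ℝ (T.splineSpace ξ η) =
        ((T.activeVertices.card + T.crossingVertices.card + T.overlapVertices.card : ℕ) :
          Cardinal)) ∧
    ((T.reducedMatrix ξ η).rank = 4 * T.reducedSegments.card →
      Module.rank ℝ (T.splineSpace ξ η) =
        ((T.activeVertices.card + T.crossingVertices.card + T.overlapVertices.card : ℕ) :
          Cardinal)) := by
  refine ⟨fun h => ?_, fun hM => RectMesh.rank_splineSpace_of_full_rank hT hadm hξ hη hM⟩
  have hd := h.isDiagonalizable hT
  have hM := hd.rank hξ hη
  exact ⟨hd, hM, RectMesh.rank_splineSpace_of_full_rank hT hadm hξ hη hM⟩
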